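/- Let $K$ be a field. An arrangement $\mathcal A$ in a finite-dimensional $K$-vector space $V$ is a finite set of linear hyperplanes $H=\ker\alpha_H$ of $V$. A multiarrangement $(\mathcal A,\mu)$ is an arrangement with a multiplicity $\mu:\mathcal A\to\mathbb Z_{\ge 0}$, where hyperplanes of multiplicity $0$ are regarded as absent; $\mathcal A$ is identified with $(\mathcal A,\mathbb 1)$. Let $S=S(V^*)$ and $$D(\mathcal A,\mu)=\{\theta\in\operatorname{Der}_K(S)\mid \theta(\alpha_H)\in\alpha_H^{\mu(H)}S\text{ for all }H\in\mathcal A\}.$$ If this $S$-module is free, $(\mathcal A,\mu)$ is called free, and $\exp(\mathcal A,\mu)$ is the multiset of polynomial degrees of a homogeneous basis (a derivation $\theta$ has polynomial degree $p$ if $\theta(\alpha)$ is homogeneous of degree $p$ or zero for all $\alpha\in V^*$). For $H_0\in\mathcal A$ put $\mathcal A'=\mathcal A\setminus\{H_0\}$ and let $\mathcal A''=\mathcal A^{H_0}=\{H\cap H_0\mid H\in\mathcal A\setminus\{H_0\}\}$, an arrangement in $H_0$. For a multiarrangement $(\mathcal A,\mu)$ and $H_0\in\mathcal A$ with $\mu(H_0)\ge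 1$, the deletion $(\mathcal A',\mu')$ is obtained by lowering $\mu(H_0)$ by $1$ (so $H_0$ is removed if $\mu(H_0)=1$). The restriction $(\mathcal A'',\mu^*)$ carries the Euler multiplicity: for $Y\in\mathcal A''$, $\mathcal A_Y=\{H\in\mathcal A\mid Y\subseteq H\}$ and $H_0=\ker\alpha_0$, the module $D(\mathcal A_Y,\mu|_{\mathcal A_Y})$ has a homogeneous basis $\theta_Y,\psi_Y,D_3,\dots,D_\ell$ $(\ell=\dim V)$ with $\theta_Y\notin\alpha_0\operatorname{Der}_K(S)$, $\psi_Y\in\alpha_0\operatorname{Der}_K(S)$ and $D_3,\dots,D_\ell$ of polynomial degree $0$, and $\mu^*(Y)$ is the polynomial degree of $\theta_Y$. The class of recursively free multiarrangements is the smallest class of multiarrangements in finite-dimensional $K$-vector spaces such that 1. every empty arrangement belongs to it; 2. if for some $H_0\in\mathcal A$ both $(\mathcal A',\mu')$ and $(\mathcal A'',\mu^*)$ belong to it and $\exp(\mathcal A'',\mu^*)\subseteq\exp(\mathcal A',\mu')$ as multisets, then $(\mathcal A,\mu)$ belongs to it; 3. if for some $H_0\in\mathcal A$ both $(\mathcal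 A,\mu)$ and $(\mathcal A'',\mu^*)$ belong to it and $\exp(\mathcal A'',\mu^*)\subseteq\exp(\mathcal A,\mu)$ as multisets, then $(\mathcal A',\mu')$ belongs to it. The class of recursively free arrangements is the smallest class of (simple) arrangements defined by the same three rules with $\mathcal A,\mathcal A',\mathcal A''$ in place of $(\mathcal A,\mu),(\mathcal A',\mu'),(\mathcal A'',\mu^*)$. **Theorem.** Let $\mathcal A$ be a recursively free arrangement in $V$ and let $H_0\in\mathcal A$. Let $\kappa(Y)=|\mathcal A_Y|-1$ for $Y\in\mathcal A^{H_0}$. Then the Ziegler restriction $(\mathcal A^{H_0},\kappa)$ is a recursively free multiarrangement. -/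

import Mathlib

universe u v

noncomputable section

namespace HyperplaneArrangement

variable {K : Type u} [Field K] {V : Type v} [AddCommGroup V] [Module K V]

/-! ### Arrangements -/

/-- A (central, simple) hyperplane arrangement in `V`: a finite set of linear hyperplanes.
The coatoms of the lattice of subspaces are exactly the linear hyperplanes. -/
@[ext] structure Arrangement (K : Type u) [Field K] (V : Type v) [AddCommGroup V]
    [Module K V] where
  hyperplanes : Set (Submodule K V)
  finite : hyperplanes.Finite
  isCoatom : ∀ H ∈ hyperplanes, IsCoatom H

/-- A multiarrangement in `V`: a multiplicity `mult H` for each subspace `H`, zero for all but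
finitely many, and nonzero on hyperplanes only. The underlying simple arrangement consists of the
hyperplanes of nonzero multiplicity, so a hyperplane of multiplicity `0` is the same as an absent
one. -/
@[ext] structure MultiArrangement (K : Type u) [Field K] (V : Type v) [AddCommGroup V]
    [Module K V] where
  mult : Submodule K V →₀ ℕ
  isCoatom : ∀ H ∈ mult.support, IsCoatom H

theorem isCoatom_comap_subtype {H₀ H : Submodule K V} (h₀ : IsCoatom H₀) (h : IsCoatom H)
    (hne : H ≠ H₀) : IsCoatom (H.comap H₀.subtype) := by
  rcases Submodule.isCoatom_comap_or_eq_top H₀.subtype h with h' | h'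
  · exact h'
  · have hle : H₀ ≤ H := Submodule.comap_subtype_eq_top.mp h'
    rcases h₀.le_iff.mp hle with h1 | h1
    · exact absurd h1 h.1
    · exact absurd h1 hne

/-- The hyperplanes `H ∩ H₀` of `H₀`, for `H ∈ A` other than `H₀`. -/
def restrictSet (A : Set (Submodule K V)) (H₀ : Submodule K V) : Set (Submodule K H₀) :=
  (fun H => H.comap H₀.subtype) '' (A \ {H₀})

namespace Arrangement

/-- The empty arrangement in `V`. -/
def empty (K : Type u) [Field K] (V : Type v) [AddCommGroup V] [Module K V] :
    Arrangement K V where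
  hyperplanes := ∅
  finite := Set.finite_empty
  isCoatom := by simp

/-- The deletion `A' = A \ {H₀}`. -/
def deletion (A : Arrangement K V) (H₀ : Submodule K V) : Arrangement K V where
  hyperplanes := A.hyperplanes \ {H₀}
  finite := A.finite.sdiff
  isCoatom H hH := A.isCoatom H hH.1

/-- The restriction `A'' = A^{H₀}`, an arrangement in the vector space `H₀`. -/
def restriction (A : Arrangement K V) (H₀ : Submodule K V) (h₀ : H₀ ∈ A.hyperplanes) :
    Arrangement K H₀ where
  hyperplanes := restrictSet A.hyperplanes H₀
  finite := A.finite.sdiff.image _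
  isCoatom := by
    rintro _ ⟨H, ⟨hH, hne⟩, rfl⟩
    exact isCoatom_comap_subtype (A.isCoatom _ h₀) (A.isCoatom _ hH) hne

/-- The arrangement `A` with the multiplicity function `m` on its hyperplanes. -/
def withMult (A : Arrangement K V) (m : Submodule K V → ℕ) : MultiArrangement K V where
  mult := Finsupp.ofSupportFinite (A.hyperplanes.indicator m)
    (A.finite.subset Set.support_indicator_subset)
  isCoatom H hH := A.isCoatom H <| Set.mem_of_indicator_ne_zero <| Finsupp.mem_support_iff.mp hH

/-- The simple arrangement `A` as a multiarrangement: every hyperplane has multiplicity `1`. -/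
def toMulti (A : Arrangement K V) : MultiArrangement K V :=
  A.withMult fun _ => 1

/-- The localization `A_X` at a subspace `X`: the hyperplanes of `A` containing `X`. -/
def localizationSet (A : Arrangement K V) (X : Submodule K V) : Set (Submodule K V) :=
  {H ∈ A.hyperplanes | X ≤ H}

/-- The Ziegler restriction `(A'', κ)` of `A` on `H₀`, with `κ(Y) = |A_Y| - 1` for `Y ∈ A''`.
(The hyperplane `H₀` itself belongs to `A_Y`, so the subtraction is not truncated.) -/
def zieglerRestriction (A : Arrangement K V) (H₀ : Submodule K V) (h₀ : H₀ ∈ A.hyperplanes) :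
    MultiArrangement K H₀ :=
  (A.restriction H₀ h₀).withMult fun Y => (A.localizationSet (Y.map H₀.subtype)).ncard - 1

end Arrangement

namespace MultiArrangement

/-- The empty multiarrangement in `V`. -/
def empty (K : Type u) [Field K] (V : Type v) [AddCommGroup V] [Module K V] :
    MultiArrangement K V where
  mult := 0
  isCoatom := by simp

/-- The hyperplanes of the underlying simple arrangement. -/
def hyperplanes (M : MultiArrangement K V) : Set (Submodule K V) :=
  M.mult.support

/-- The deletion `(A', μ')` with respect to `H₀`: the multiplicity of `H₀` drops by one (so `H₀`
disappears if its multiplicity was `1`), all others stay the same. -/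
def deletion (M : MultiArrangement K V) (H₀ : Submodule K V) : MultiArrangement K V where
  mult := M.mult - Finsupp.single H₀ 1
  isCoatom H hH := M.isCoatom H (Finsupp.support_tsub hH)

open Classical in
/-- The localization `(A_X, μ_X)` at a subspace `X`. -/
def localization (M : MultiArrangement K V) (X : Submodule K V) : MultiArrangement K V where
  mult := M.mult.filter fun H => X ≤ H
  isCoatom H hH := M.isCoatom H (Finset.filter_subset _ _ (by simpa using hH))

end MultiArrangement

/-! ### Derivations, freeness and exponents -/

/-- The coordinate ring `S = S(V^*)`, the symmetric algebra of the dual space. -/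
abbrev CoordRing (K : Type u) [Field K] (V : Type v) [AddCommGroup V] [Module K V] :=
  SymmetricAlgebra K (Module.Dual K V)

/-- The `S`-module `Der(S)` of `K`-derivations of `S`. -/
abbrev Der (K : Type u) [Field K] (V : Type v) [AddCommGroup V] [Module K V] :=
  Derivation K (CoordRing K V) (CoordRing K V)

/-- A linear form as an element of `S`. -/
abbrev linForm (α : Module.Dual K V) : CoordRing K V :=
  SymmetricAlgebra.ι K (Module.Dual K V) α

/-- The homogeneous part `S_p` of degree `p` of `S`: the linear span of the `p`-fold products
of linear forms. -/
def homogeneousPart (K : Type u) [Field K] (V : Type v) [AddCommGroup V] [Module K V] (p : ℕ) :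
    Submodule K (CoordRing K V) :=
  LinearMap.range (SymmetricAlgebra.ι K (Module.Dual K V)) ^ p

/-- `θ` is homogeneous of polynomial degree `p`. Written as `∑ fᵢ ∂/∂xᵢ`, the `fᵢ = θ(xᵢ)` all
lie in `S_p`; equivalently, `θ` maps every linear form into `S_p`. -/
def HasPDeg (θ : Der K V) (p : ℕ) : Prop :=
  ∀ α : Module.Dual K V, θ (linForm α) ∈ homogeneousPart K V p

/-- The module `D(A, μ)`: the derivations `θ` with `θ(α_H) ∈ α_H ^ μ(H) S` for each `H ∈ A`.
The linear form `α_H` with kernel `H` is unique up to a nonzero scalar; the condition, which does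
not depend on its choice, is asked for every choice. -/
def derModule (M : MultiArrangement K V) : Submodule (CoordRing K V) (Der K V) where
  carrier := {θ | ∀ H ∈ M.hyperplanes, ∀ α : Module.Dual K V, LinearMap.ker α = H →
    linForm α ^ M.mult H ∣ θ (linForm α)}
  add_mem' := by
    intro a b ha hb H hH α hα
    simpa using dvd_add (ha H hH α hα) (hb H hH α hα)
  zero_mem' := by
    intro H _ α _
    simp
  smul_mem' := by
    intro c θ hθ H hH α hα
    simpa using (hθ H hH α hα).mul_left c

/-- The multiarrangement is free, and its multiset of exponents is `e`: the module `D(A, μ)` has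
an `S`-basis of `dim V` homogeneous derivations whose polynomial degrees form the multiset `e`. -/
def HasExponents (M : MultiArrangement K V) (e : Multiset ℕ) : Prop :=
  ∃ (b : Module.Basis (Fin (Module.finrank K V)) (CoordRing K V) (derModule M))
    (d : Fin (Module.finrank K V) → ℕ),
    (∀ i, HasPDeg (b i : Der K V) (d i)) ∧ e = Finset.univ.val.map d

/-! ### The Euler multiplicity -/

/-- `d` is the Euler multiplicity of `(A, μ)` at the hyperplane `Y ∈ A''` of `H₀ = ker α₀`: the
localization at `Y` has a homogeneous basis `{θ, ψ, D₃, …, D_ℓ}` of derivations, where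
`θ ∉ α₀ Der(S)` has polynomial degree `d`, where `ψ ∈ α₀ Der(S)`, and where the `Dₖ` have
polynomial degree `0`, that is, are partial derivatives in constant directions (these are then
directions along `Y`, since `Dₖ` has to kill the linear forms of the hyperplanes in `A_Y`). -/
def IsEulerMultiplicity (M : MultiArrangement K V) (H₀ : Submodule K V) (Y : Submodule K H₀)
    (d : ℕ) : Prop :=
  ∃ (α₀ : Module.Dual K V)
    (b : Module.Basis (Fin (Module.finrank K V)) (CoordRing K V)
      (derModule (M.localization (Y.map H₀.subtype))))
    (i j : Fin (Module.finrank K V)) (p : ℕ),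
    LinearMap.ker α₀ = H₀ ∧ i ≠ j ∧
    HasPDeg (b i : Der K V) d ∧ (¬ ∃ η : Der K V, (b i : Der K V) = linForm α₀ • η) ∧
    HasPDeg (b j : Der K V) p ∧ (∃ η : Der K V, (b j : Der K V) = linForm α₀ • η) ∧
    ∀ k, k ≠ i → k ≠ j → HasPDeg (b k : Der K V) 0

/-- `N` is the (Euler) restriction `(A'', μ^*)` of `(A, μ)` with respect to `H₀`. -/
def IsEulerRestriction (M : MultiArrangement K V) (H₀ : Submodule K V)
    (N : MultiArrangement K H₀) : Prop :=
  N.hyperplanes = restrictSet M.hyperplanes H₀ ∧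
    ∀ Y ∈ N.hyperplanes, IsEulerMultiplicity M H₀ Y (N.mult Y)

/-! ### Recursive freeness -/

/-- The class of recursively free (simple) arrangements, the smallest class of arrangements in
finite-dimensional `K`-vector spaces closed under the three rules below. -/
inductive Arrangement.IsRecursivelyFree {K : Type u} [Field K] :
    ∀ {V : Type v} [AddCommGroup V] [Module K V], Arrangement K V → Prop
  | empty (V : Type v) [AddCommGroup V] [Module K V] [FiniteDimensional K V] :
      IsRecursivelyFree (Arrangement.empty K V)
  | add {V : Type v} [AddCommGroup V] [Module K V] (A : Arrangement K V)
      (H₀ : Submodule K V) (h₀ : H₀ ∈ A.hyperplanes) (e' e'' : Multiset ℕ)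
      (hdel : IsRecursivelyFree (A.deletion H₀))
      (hres : IsRecursivelyFree (A.restriction H₀ h₀))
      (he' : HasExponents (A.deletion H₀).toMulti e')
      (he'' : HasExponents (A.restriction H₀ h₀).toMulti e'')
      (hle : e'' ≤ e') : IsRecursivelyFree A
  | delete {V : Type v} [AddCommGroup V] [Module K V] (A : Arrangement K V)
      (H₀ : Submodule K V) (h₀ : H₀ ∈ A.hyperplanes) (e e'' : Multiset ℕ)
      (hA : IsRecursivelyFree A)
      (hres : IsRecursivelyFree (A.restriction H₀ h₀))
      (he : HasExponents A.toMulti e)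
      (he'' : HasExponents (A.restriction H₀ h₀).toMulti e'')
      (hle : e'' ≤ e) : IsRecursivelyFree (A.deletion H₀)

/-- The class of recursively free multiarrangements, the smallest class of multiarrangements in
finite-dimensional `K`-vector spaces closed under the three rules below. -/
inductive MultiArrangement.IsRecursivelyFree {K : Type u} [Field K] :
    ∀ {V : Type v} [AddCommGroup V] [Module K V], MultiArrangement K V → Prop
  | empty (V : Type v) [AddCommGroup V] [Module K V] [FiniteDimensional K V] :
      IsRecursivelyFree (MultiArrangement.empty K V)
  | add {V : Type v} [AddCommGroup V] [Module K V] (M : MultiArrangement K V)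
      (H₀ : Submodule K V) (h₀ : H₀ ∈ M.hyperplanes) (N : MultiArrangement K H₀)
      (hN : IsEulerRestriction M H₀ N) (e' e'' : Multiset ℕ)
      (hdel : IsRecursivelyFree (M.deletion H₀))
      (hres : IsRecursivelyFree N)
      (he' : HasExponents (M.deletion H₀) e')
      (he'' : HasExponents N e'')
      (hle : e'' ≤ e') : IsRecursivelyFree M
  | delete {V : Type v} [AddCommGroup V] [Module K V] (M : MultiArrangement K V)
      (H₀ : Submodule K V) (h₀ : H₀ ∈ M.hyperplanes) (N : MultiArrangement K H₀)
      (hN : IsEulerRestriction M H₀ N) (e e'' : Multiset ℕ)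
      (hM : IsRecursivelyFree M)
      (hres : IsRecursivelyFree N)
      (he : HasExponents M e)
      (he'' : HasExponents N e'')
      (hle : e'' ≤ e) : IsRecursivelyFree (M.deletion H₀)

end HyperplaneArrangement

end

/-! The statement becomes accessible to induction once the Ziegler restrictions and the arrangement
itself are treated alike. For an injection `j : W →ₗ[K] V`, the pull-back `MultiArrangement.pull`
gives a hyperplane of W the sum of the multiplicities of the hyperplanes with that trace and forgets
those containing the range. If the range is V, this is a copy of A; for the inclusion of `H₀` it is
the Ziegler restriction. By induction over the rules that generate A, every pull-back of A with
range V or a hyperplane of A is recursively free (`Arrangement.IsRecursivelyFree.pull`). Arbitrary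
injections are allowed because iterated restriction produces H ∩ H₁ in several incarnations.

Take a step with A, A' = A \ {H} and A''. The inclusion of exponents yields an adapted basis
(`IsAdaptedBasis`): a homogeneous basis η, θ₁, …, θₙ of D(A') with all θᵢ in D(A). Then α_H η, θ₁,
…, θₙ is a basis of D(A), and the θᵢ restrict to a basis of D(A''). See
`exists_isAdaptedBasis_of_add`, `exists_isAdaptedBasis_of_delete` and
`IsAdaptedBasis.isDerBasis_restriction`.

Let L be the range of j. If L = V, everything is transported along j. If L is a hyperplane other
than H, the pull-back of A' is the deletion of the pull-back of A at L ∩ H. The Euler derivation can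
be moved among the θᵢ, and multiples of it correct the other members so that they kill α_L. By
Ziegler's theorem (`IsDerBasis.pull_of_range_eq_ker`) these restrict to an adapted basis on L, and
further to a basis for the pull-back of A'' to L ∩ H, which is recursively free by induction
(`isRecursivelyFree_pull_deletion_iff`).

The case L = H occurs only for addition and uses A'' alone. After correction by the Euler
derivation, the remaining θᵢ kill α_H. Their restrictions φᵢ form a basis of D(A'') together with
the Euler derivation of H, and they also lie in D(A'', κ). Hence the multiplicities can be raised
from 1 to κ one unit at a time, the Euler restriction at Y always being the Ziegler restriction of
A'' to Y (`isRecursivelyFree_of_mem_derModule`).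

It remains to recognize Euler restrictions. Localization in codimension two reduces to a plane,
where an explicit basis gives the Euler multiplicity d and a complementary number s: on H, the
values of D(M) at the equation y of Y are divisible by y ^ d, and the leading coefficients of D(M')
at α_H by y ^ s. Comparison with Saito's determinant then forces the multiplicity at Y to be d
(`isEulerRestriction_of_det`). -/

noncomputable section

namespace HyperplaneArrangement

open Module

variable {K : Type u} [Field K] {V : Type v} [AddCommGroup V] [Module K V]

/-! ### Polynomial functions: degrees, restriction, prime linear forms -/

section

/-! ### The grading of the coordinate ring -/

/-- A choice of polynomial coordinates on `S(V^*)`. -/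
def coordEquiv (K : Type u) [Field K] (V : Type v) [AddCommGroup V] [Module K V] :
    CoordRing K V ≃ₐ[K] MvPolynomial (Module.Free.ChooseBasisIndex K (Dual K V)) K :=
  SymmetricAlgebra.equivMvPolynomial (Module.Free.chooseBasis K (Dual K V))

/-- In degree 1 the forms of a basis go to the variables, and both gradings consist of the powers of
their degree 1 part. -/
theorem map_coordEquiv_homogeneousPart (p : ℕ) :
    (homogeneousPart K V p).map (coordEquiv K V).toLinearMap =
      MvPolynomial.homogeneousSubmodule _ K p := by
  have h1 : (LinearMap.range (SymmetricAlgebra.ι K (Dual K V))).map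
      (coordEquiv K V).toLinearMap = MvPolynomial.homogeneousSubmodule _ K 1 := by
    rw [MvPolynomial.homogeneousSubmodule_one_eq_span_X, LinearMap.range_eq_map,
      ← (Module.Free.chooseBasis K (Dual K V)).span_eq, Submodule.map_span, Submodule.map_span,
      ← Set.range_comp, ← Set.range_comp]
    congr 2
    funext i
    exact SymmetricAlgebra.equivMvPolynomial_ι_apply _ i
  have h2 := Submodule.map_pow (LinearMap.range (SymmetricAlgebra.ι K (Dual K V)))
    (coordEquiv K V).toAlgHom p
  rw [← MvPolynomial.homogeneousSubmodule_one_pow, ← h1]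
  exact h2

theorem mem_homogeneousPart_iff {p : ℕ} {f : CoordRing K V} :
    f ∈ homogeneousPart K V p ↔ (coordEquiv K V f).IsHomogeneous p := by
  rw [← MvPolynomial.mem_homogeneousSubmodule, ← map_coordEquiv_homogeneousPart]
  constructor
  · intro h
    exact ⟨f, h, rfl⟩
  · rintro ⟨g, hg, h⟩
    rwa [← (coordEquiv K V).injective h]

/-- The homogeneous component of degree `p`. -/
def homComp (p : ℕ) : CoordRing K V →ₗ[K] CoordRing K V :=
  (coordEquiv K V).symm.toLinearMap ∘ₗ MvPolynomial.homogeneousComponent p ∘ₗ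
    (coordEquiv K V).toLinearMap

theorem homComp_mem (p : ℕ) (f : CoordRing K V) : homComp p f ∈ homogeneousPart K V p := by
  rw [mem_homogeneousPart_iff]
  simpa [homComp] using MvPolynomial.homogeneousComponent_isHomogeneous p (coordEquiv K V f)

theorem homComp_of_mem {p : ℕ} {f : CoordRing K V} (hf : f ∈ homogeneousPart K V p) (q : ℕ) :
    homComp q f = if q = p then f else 0 := by
  rw [mem_homogeneousPart_iff] at hf
  have := MvPolynomial.homogeneousComponent_of_mem (m := q)
    ((MvPolynomial.mem_homogeneousSubmodule _ _).2 hf)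
  simp only [homComp, LinearMap.comp_apply, AlgEquiv.toLinearMap_apply, this]
  split_ifs <;> simp

theorem homComp_eq_self {p : ℕ} {f : CoordRing K V} (hf : f ∈ homogeneousPart K V p) :
    homComp p f = f := by simp [homComp_of_mem hf]

theorem exists_sum_homComp (f : CoordRing K V) : ∃ N, f = ∑ i ∈ Finset.range N, homComp i f := by
  refine ⟨(coordEquiv K V f).totalDegree + 1, ?_⟩
  apply (coordEquiv K V).injective
  conv_lhs => rw [← MvPolynomial.sum_homogeneousComponent (coordEquiv K V f)]
  rw [map_sum]
  simp [homComp]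

theorem mul_mem_homogeneousPart {p q : ℕ} {f g : CoordRing K V} (hf : f ∈ homogeneousPart K V p)
    (hg : g ∈ homogeneousPart K V q) : f * g ∈ homogeneousPart K V (p + q) := by
  unfold homogeneousPart
  rw [pow_add]
  exact Submodule.mul_mem_mul hf hg

theorem one_mem_homogeneousPart : (1 : CoordRing K V) ∈ homogeneousPart K V 0 := by
  unfold homogeneousPart
  rw [pow_zero]
  exact Submodule.one_le.1 le_rfl

theorem linForm_mem (α : Dual K V) : linForm α ∈ homogeneousPart K V 1 := by
  unfold homogeneousPart
  rw [pow_one]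
  exact ⟨α, rfl⟩

theorem pow_mem_homogeneousPart {p : ℕ} {f : CoordRing K V} (hf : f ∈ homogeneousPart K V p)
    (n : ℕ) : f ^ n ∈ homogeneousPart K V (n * p) := by
  induction n with
  | zero => simpa using one_mem_homogeneousPart
  | succ n ih =>
    rw [pow_succ, add_mul, one_mul]
    exact mul_mem_homogeneousPart ih hf

theorem linForm_pow_mem (α : Dual K V) (n : ℕ) : linForm α ^ n ∈ homogeneousPart K V n := by
  simpa using pow_mem_homogeneousPart (linForm_mem α) n

theorem prod_mem_homogeneousPart {ι : Type*} (s : Finset ι) (f : ι → CoordRing K V) (d : ι → ℕ)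
    (h : ∀ i ∈ s, f i ∈ homogeneousPart K V (d i)) :
    ∏ i ∈ s, f i ∈ homogeneousPart K V (∑ i ∈ s, d i) := by
  classical
  induction s using Finset.induction_on with
  | empty => simpa using one_mem_homogeneousPart
  | insert a s ha ih =>
    rw [Finset.prod_insert ha, Finset.sum_insert ha]
    exact mul_mem_homogeneousPart (h a (by simp)) (ih fun i hi => h i (by simp [hi]))

theorem homComp_mul_of_le {p q : ℕ} (hpq : p ≤ q) {f : CoordRing K V}
    (hf : f ∈ homogeneousPart K V p) (g : CoordRing K V) :
    homComp q (f * g) = f * homComp (q - p) g := by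
  obtain ⟨N, hN⟩ := exists_sum_homComp g
  have key : ∀ i, homComp q (f * homComp i g) = f * homComp (q - p) (homComp i g) := by
    intro i
    rw [homComp_of_mem (mul_mem_homogeneousPart hf (homComp_mem i g)),
      homComp_of_mem (homComp_mem i g)]
    have : q = p + i ↔ q - p = i := by omega
    simp only [this]
    split_ifs <;> simp
  rw [hN, Finset.mul_sum, map_sum, map_sum, Finset.mul_sum]
  exact Finset.sum_congr rfl fun i _ => key i

theorem homComp_mul_of_lt {p q : ℕ} (hpq : q < p) {f : CoordRing K V}
    (hf : f ∈ homogeneousPart K V p) (g : CoordRing K V) :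
    homComp q (f * g) = 0 := by
  obtain ⟨N, hN⟩ := exists_sum_homComp g
  rw [hN, Finset.mul_sum, map_sum]
  refine Finset.sum_eq_zero fun i _ => ?_
  rw [homComp_of_mem (mul_mem_homogeneousPart hf (homComp_mem i g)), if_neg (by omega)]

theorem mem_homogeneousPart_zero_iff {f : CoordRing K V} :
    f ∈ homogeneousPart K V 0 ↔ ∃ c : K, f = algebraMap K _ c := by
  unfold homogeneousPart
  rw [pow_zero, Submodule.mem_one]
  simp [eq_comm]

theorem eq_zero_of_mem_of_mem {p q : ℕ} (hpq : p ≠ q) {f : CoordRing K V}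
    (hp : f ∈ homogeneousPart K V p) (hq : f ∈ homogeneousPart K V q) : f = 0 := by
  rw [← homComp_eq_self hp, homComp_of_mem hq, if_neg hpq]

/-- A cofactor of a nonzero homogeneous element in a homogeneous element is homogeneous. -/
theorem mem_of_mul_mem {p q : ℕ} {f g : CoordRing K V} (hf : f ∈ homogeneousPart K V p)
    (hf0 : f ≠ 0) (hfg : f * g ∈ homogeneousPart K V (p + q)) : g ∈ homogeneousPart K V q := by
  have h := homComp_eq_self hfg
  rw [homComp_mul_of_le (by omega) hf] at h
  rw [← mul_left_cancel₀ hf0 h, Nat.add_sub_cancel_left]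
  exact homComp_mem _ _

theorem eq_zero_of_mul_mem_of_lt {p q : ℕ} (hqp : q < p) {f g : CoordRing K V}
    (hf : f ∈ homogeneousPart K V p) (hfg : f * g ∈ homogeneousPart K V q) : f * g = 0 := by
  rw [← homComp_eq_self hfg, homComp_mul_of_lt hqp hf]

theorem isUnit_mem_homogeneousPart_zero {f : CoordRing K V} (hf : IsUnit f) :
    f ∈ homogeneousPart K V 0 := by
  rw [mem_homogeneousPart_zero_iff]
  have h := (hf.map (coordEquiv K V))
  rw [MvPolynomial.isUnit_iff_eq_C_of_isReduced] at h
  obtain ⟨r, -, hr⟩ := h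
  refine ⟨r, (coordEquiv K V).injective ?_⟩
  rw [hr, AlgEquiv.commutes]
  rfl

theorem degree_eq_of_associated {p q : ℕ} {f g : CoordRing K V} (h : Associated f g) (hf0 : f ≠ 0)
    (hf : f ∈ homogeneousPart K V p) (hg : g ∈ homogeneousPart K V q) : p = q := by
  obtain ⟨c, rfl⟩ := h
  by_contra hne
  have h1 := mul_mem_homogeneousPart hf (isUnit_mem_homogeneousPart_zero c.isUnit)
  have := eq_zero_of_mem_of_mem hne h1 hg
  simp [hf0] at this

/-! ### Pulling back polynomials along linear maps -/

variable {W : Type v} [AddCommGroup W] [Module K W]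

/-- The restriction of polynomial functions along a linear map. -/
def res (j : W →ₗ[K] V) : CoordRing K V →ₐ[K] CoordRing K W :=
  SymmetricAlgebra.lift (SymmetricAlgebra.ι K (Dual K W) ∘ₗ j.dualMap)

@[simp] theorem res_linForm (j : W →ₗ[K] V) (β : Dual K V) :
    res j (linForm β) = linForm (β ∘ₗ j) := by
  simp [res, LinearMap.dualMap_apply']

theorem res_comp {U : Type v} [AddCommGroup U] [Module K U] (i : U →ₗ[K] W) (j : W →ₗ[K] V) :
    (res i).comp (res j) = res (j ∘ₗ i) := by
  apply SymmetricAlgebra.algHom_ext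
  ext β
  change res i (res j (linForm β)) = res (j ∘ₗ i) (linForm β)
  simp [LinearMap.comp_assoc]

theorem res_res {U : Type v} [AddCommGroup U] [Module K U] (i : U →ₗ[K] W) (j : W →ₗ[K] V)
    (f : CoordRing K V) : res i (res j f) = res (j ∘ₗ i) f :=
  DFunLike.congr_fun (res_comp i j) f

theorem res_id (f : CoordRing K V) : res (LinearMap.id : V →ₗ[K] V) f = f := by
  have : res (LinearMap.id : V →ₗ[K] V) = AlgHom.id K _ := by
    apply SymmetricAlgebra.algHom_ext
    ext β
    change res _ (linForm β) = linForm β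
    simp
  rw [this]
  rfl

theorem res_mem (j : W →ₗ[K] V) {p : ℕ} {f : CoordRing K V} (hf : f ∈ homogeneousPart K V p) :
    res j f ∈ homogeneousPart K W p := by
  have h : (homogeneousPart K V p).map (res j).toLinearMap ≤ homogeneousPart K W p := by
    unfold homogeneousPart
    rw [Submodule.map_pow]
    refine pow_le_pow_left' ?_ p
    rintro _ ⟨_, ⟨β, rfl⟩, rfl⟩
    exact ⟨β ∘ₗ j, (res_linForm j β).symm⟩
  exact h ⟨f, hf, rfl⟩

/-- Every polynomial on `W` lifts along an injection, preserving homogeneity. -/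
theorem exists_res_eq {j : W →ₗ[K] V} (hj : Function.Injective j) (g : CoordRing K W) :
    ∃ f, res j f = g ∧ ∀ p, g ∈ homogeneousPart K W p → f ∈ homogeneousPart K V p := by
  obtain ⟨r, hr⟩ := j.exists_leftInverse_of_injective (LinearMap.ker_eq_bot.2 hj)
  refine ⟨res r g, ?_, fun p hp => res_mem r hp⟩
  rw [res_res, hr, res_id]

theorem exists_comp_eq {j : W →ₗ[K] V} (hj : Function.Injective j) (γ : Dual K W) :
    ∃ β : Dual K V, β ∘ₗ j = γ := by
  obtain ⟨r, hr⟩ := j.exists_leftInverse_of_injective (LinearMap.ker_eq_bot.2 hj)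
  exact ⟨γ ∘ₗ r, by rw [LinearMap.comp_assoc, hr]; rfl⟩

theorem linForm_injective : Function.Injective (linForm (K := K) (V := V)) := by
  intro a b h
  ext v
  have h2 := congrArg (SymmetricAlgebra.lift (Module.Dual.eval K V v)) h
  simpa using h2

@[simp] theorem linForm_zero : linForm (0 : Dual K V) = 0 := map_zero _

theorem linForm_ne_zero {α : Dual K V} (hα : α ≠ 0) : linForm α ≠ 0 := by
  intro h
  exact hα (linForm_injective (h.trans (map_zero _).symm))

/-- The functionals vanishing on a hyperplane are multiples of an equation of it. -/
theorem exists_smul_of_ker_le {α β : Dual K V} (h : LinearMap.ker α ≤ LinearMap.ker β) :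
    ∃ c : K, β = c • α := by
  have := mem_span_of_iInf_ker_le_ker (L := fun _ : Unit => α) (K := β) (by simpa using h)
  rw [Set.range_const, Submodule.mem_span_singleton] at this
  obtain ⟨c, hc⟩ := this
  exact ⟨c, hc.symm⟩

/-- Composition with `w ↦ w - α w • v` changes a linear form β by β(v) α. This congruence modulo α
passes to sums and products, hence to all polynomials. -/
theorem linForm_dvd_sub {j : W →ₗ[K] V} {α : Dual K V} {v : V} {r : V →ₗ[K] W}
    (hr : ∀ w, j (r w) = w - α w • v) (f : CoordRing K V) :
    linForm α ∣ f - res (j ∘ₗ r) f := by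
  induction f using SymmetricAlgebra.induction with
  | algebraMap r => simp
  | ι β =>
    change linForm α ∣ linForm β - res _ (linForm β)
    rw [res_linForm]
    refine ⟨algebraMap K _ (β v), ?_⟩
    have : β - β ∘ₗ j ∘ₗ r = β v • α := by
      ext w
      simp [hr, mul_comm]
    change SymmetricAlgebra.ι K _ _ - SymmetricAlgebra.ι K _ _ = _
    rw [← map_sub, this, map_smul, Algebra.smul_def, mul_comm]
  | mul a b ha hb =>
    rw [map_mul]
    have : a * b - res (j ∘ₗ r) a * res (j ∘ₗ r) b =
      (a - res (j ∘ₗ r) a) * b + res (j ∘ₗ r) a * (b - res (j ∘ₗ r) b) := by ring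
    rw [this]
    exact dvd_add (ha.mul_right _) (hb.mul_left _)
  | add a b ha hb =>
    rw [map_add, add_sub_add_comm]
    exact dvd_add ha hb

/-- For α v = 1 the projection onto `ker α` along v factors through j, so f is congruent modulo α to
the pull-back of its own restriction. -/
theorem res_eq_zero_iff {j : W →ₗ[K] V} (hj : Function.Injective j) {α : Dual K V} (hα : α ≠ 0)
    (hr : LinearMap.range j = LinearMap.ker α) (f : CoordRing K V) :
    res j f = 0 ↔ linForm α ∣ f := by
  constructor
  · intro hf
    obtain ⟨v, hv⟩ : ∃ v, α v = 1 := by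
      obtain ⟨w, hw⟩ := DFunLike.ne_iff.1 hα
      exact ⟨(α w)⁻¹ • w, by simp at hw; simp [hw]⟩
    obtain ⟨r, hrj⟩ : ∃ r : V →ₗ[K] W, ∀ w, j (r w) = w - α w • v := by
      let q : V →ₗ[K] LinearMap.range j := LinearMap.codRestrict _
        (LinearMap.id - α.smulRight v) (by intro w; rw [hr]; simp [hv])
      refine ⟨(LinearEquiv.ofInjective j hj).symm.toLinearMap ∘ₗ q, fun w => ?_⟩
      have := LinearEquiv.apply_symm_apply (LinearEquiv.ofInjective j hj) (q w)
      simp [q]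
    have := linForm_dvd_sub hrj f
    rwa [← res_res, hf, map_zero, sub_zero] at this
  · rintro ⟨g, rfl⟩
    have : α ∘ₗ j = 0 := by
      ext w
      have : j w ∈ LinearMap.ker α := hr ▸ LinearMap.mem_range_self j w
      simpa using this
    rw [map_mul, res_linForm, this, linForm_zero, zero_mul]

/-- The multiples of α are the kernel of a ring homomorphism into the domain of polynomials on `ker
α`. -/
theorem prime_linForm {α : Dual K V} (hα : α ≠ 0) : Prime (linForm α) := by
  have hj := Submodule.injective_subtype (LinearMap.ker α)
  have hiff := res_eq_zero_iff hj hα (by simp)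
  refine ⟨linForm_ne_zero hα, fun hu => ?_, fun a b hab => ?_⟩
  · have := isUnit_iff_exists_inv.1 hu
    obtain ⟨g, hg⟩ := this
    have h2 := (hiff 1).2 ⟨g, hg.symm⟩
    simp at h2
  · rw [← hiff, map_mul, mul_eq_zero, hiff, hiff] at hab
    exact hab

theorem dvd_linForm_iff {α β : Dual K V} (hα : α ≠ 0) :
    linForm α ∣ linForm β ↔ LinearMap.ker α ≤ LinearMap.ker β := by
  have hj := Submodule.injective_subtype (LinearMap.ker α)
  rw [← res_eq_zero_iff hj hα (by simp), res_linForm]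
  constructor
  · intro h w hw
    have h2 := linForm_injective (h.trans (map_zero _).symm)
    exact DFunLike.congr_fun h2 ⟨w, hw⟩
  · intro h
    have : β ∘ₗ (LinearMap.ker α).subtype = 0 := by
      ext ⟨w, hw⟩
      exact h hw
    rw [this, linForm_zero]

instance : UniqueFactorizationMonoid (CoordRing K V) :=
  (coordEquiv K V).toMulEquiv.symm.uniqueFactorizationMonoid inferInstance

end

/-! ### Logarithmic derivations and Saito's criterion -/

section

variable {W : Type v} [AddCommGroup W] [Module K W]

/-! ### Divisibility by products of prime powers -/

section Primes

variable {R ι : Type*} [CommRing R]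

theorem not_pow_succ_dvd_pow_mul [IsDomain R] {p b : R} (hp : Prime p) (hb : ¬ p ∣ b) (m : ℕ) :
    ¬ p ^ (m + 1) ∣ p ^ m * b := by
  rw [pow_succ, mul_dvd_mul_iff_left (pow_ne_zero _ hp.ne_zero)]
  exact hb

theorem le_of_pow_dvd_pow_mul [IsDomain R] {p b : R} (hp : Prime p) (hb : ¬ p ∣ b) {k m : ℕ}
    (h : p ^ k ∣ p ^ m * b) : k ≤ m := by
  by_contra hlt
  exact not_pow_succ_dvd_pow_mul hp hb m ((pow_dvd_pow p (by omega)).trans h)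

theorem not_dvd_prod_pow {p : R} (hp : Prime p) (s : Finset ι) (q : ι → R) (k : ι → ℕ)
    (h : ∀ i ∈ s, ¬ p ∣ q i) : ¬ p ∣ ∏ i ∈ s, q i ^ k i := by
  rw [hp.dvd_finsetProd_iff]
  rintro ⟨i, hi, hd⟩
  exact h i hi (hp.dvd_of_dvd_pow hd)

variable [IsDomain R] [UniqueFactorizationMonoid R]

theorem prod_pow_dvd (s : Finset ι) (p : ι → R) (k : ι → ℕ) (hp : ∀ i ∈ s, Prime (p i))
    (hne : ∀ i ∈ s, ∀ j ∈ s, i ≠ j → ¬ p i ∣ p j) {f : R} (h : ∀ i ∈ s, p i ^ k i ∣ f) :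
    ∏ i ∈ s, p i ^ k i ∣ f := by
  refine Finset.prod_dvd_of_isRelPrime ?_ h
  intro i hi j hj hij
  exact (((hp i hi).irreducible.isRelPrime_iff_not_dvd).2 (hne i hi j hj hij)).pow

/-- The divisor splits along the product into pieces associated to powers of one prime each, and `h`
bounds these powers. This turns a crude bound for a determinant into the exact exponents. -/
theorem dvd_prod_pow [DecidableEq ι] (s : Finset ι) (p : ι → R) (k N : ι → ℕ)
    (hp : ∀ i ∈ s, Prime (p i)) {a : R} (ha : a ∣ ∏ i ∈ s, p i ^ N i)
    (h : ∀ i ∈ s, ¬ p i ^ (k i + 1) ∣ a) : a ∣ ∏ i ∈ s, p i ^ k i := by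
  induction s using Finset.induction_on generalizing a with
  | empty => simpa using ha
  | insert i s hi ih =>
    rw [Finset.prod_insert hi] at ha ⊢
    obtain ⟨a₁, a₂, h1, h2, rfl⟩ := exists_dvd_and_dvd_of_dvd_mul ha
    have hpi := hp i (by simp)
    refine mul_dvd_mul ?_ (ih (fun j hj => hp j (by simp [hj])) h2 fun j hj hd =>
      h j (by simp [hj]) (hd.mul_left _))
    obtain ⟨l, -, hl⟩ := (dvd_prime_pow hpi _).1 h1
    rw [hl.dvd_iff_dvd_left]
    refine pow_dvd_pow _ ?_
    by_contra hlt
    exact h i (by simp) (((pow_dvd_pow _ (by omega)).trans hl.symm.dvd).mul_right _)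

end Primes

/-! ### Equations of hyperplanes and the defining polynomial -/

theorem exists_ker_eq {H : Submodule K V} (hH : IsCoatom H) :
    ∃ α : Dual K V, LinearMap.ker α = H := by
  obtain ⟨f, hf, hle⟩ := Submodule.exists_le_ker_of_lt_top H hH.lt_top
  refine ⟨f, ?_⟩
  rcases hH.le_iff.1 hle with h | h
  · exact absurd (LinearMap.ker_eq_top.1 h) hf
  · exact h

open Classical in
/-- A linear form defining the hyperplane `H`. -/
def formOf (H : Submodule K V) : Dual K V :=
  if h : IsCoatom H then (exists_ker_eq h).choose else 0

theorem ker_formOf {H : Submodule K V} (hH : IsCoatom H) : LinearMap.ker (formOf H) = H := by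
  rw [formOf, dif_pos hH]
  exact (exists_ker_eq hH).choose_spec

theorem ne_zero_of_ker_eq {H : Submodule K V} (hH : IsCoatom H) {α : Dual K V}
    (hα : LinearMap.ker α = H) : α ≠ 0 := by
  rintro rfl
  exact hH.1 (by rw [← hα, LinearMap.ker_zero])

theorem formOf_ne_zero {H : Submodule K V} (hH : IsCoatom H) : formOf H ≠ 0 :=
  ne_zero_of_ker_eq hH (ker_formOf hH)

theorem isCoatom_ker {α : Dual K V} (hα : α ≠ 0) : IsCoatom (LinearMap.ker α) :=
  LinearMap.isCoatom_ker_of_surjective (LinearMap.surjective hα)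

theorem exists_eq_smul_of_ker_eq {α β : Dual K V} (hβ : β ≠ 0)
    (h : LinearMap.ker α = LinearMap.ker β) : ∃ c : K, c ≠ 0 ∧ β = c • α := by
  obtain ⟨c, hc⟩ := exists_smul_of_ker_le h.le
  refine ⟨c, ?_, hc⟩
  rintro rfl
  exact hβ (by simpa using hc)

theorem linForm_smul (c : K) (α : Dual K V) :
    linForm (c • α) = algebraMap K _ c * linForm α := by
  rw [linForm, map_smul, Algebra.smul_def]

theorem isUnit_algebraMap {c : K} (hc : c ≠ 0) : IsUnit (algebraMap K (CoordRing K V) c) :=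
  (IsUnit.mk0 c hc).map _

theorem associated_linForm {α β : Dual K V} (hβ : β ≠ 0)
    (h : LinearMap.ker α = LinearMap.ker β) : Associated (linForm α) (linForm β) := by
  obtain ⟨c, hc, rfl⟩ := exists_eq_smul_of_ker_eq hβ h
  rw [linForm_smul]
  exact (associated_unit_mul_left _ _ (isUnit_algebraMap (V := V) hc)).symm

theorem linForm_dvd_iff_of_ker {H H' : Submodule K V} (hH : IsCoatom H) (hH' : IsCoatom H')
    {α β : Dual K V} (hα : LinearMap.ker α = H) (hβ : LinearMap.ker β = H') :
    linForm α ∣ linForm β ↔ H = H' := by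
  rw [dvd_linForm_iff (ne_zero_of_ker_eq hH hα), hα, hβ]
  constructor
  · intro h
    rcases hH.le_iff.1 h with h | h
    · exact absurd h hH'.1
    · exact h.symm
  · rintro rfl
    exact le_rfl

theorem prime_formOf {H : Submodule K V} (hH : IsCoatom H) : Prime (linForm (formOf H)) :=
  prime_linForm (formOf_ne_zero hH)

theorem formOf_dvd_iff {H H' : Submodule K V} (hH : IsCoatom H) (hH' : IsCoatom H') :
    linForm (formOf H) ∣ linForm (formOf H') ↔ H = H' :=
  linForm_dvd_iff_of_ker hH hH' (ker_formOf hH) (ker_formOf hH')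

/-- The product of the powers `α_H ^ m(H)`. -/
def powProd (m : Submodule K V →₀ ℕ) : CoordRing K V :=
  m.prod fun H k => linForm (formOf H) ^ k

/-- The defining polynomial of a multiarrangement. -/
def MultiArrangement.defPoly (M : MultiArrangement K V) : CoordRing K V := powProd M.mult

theorem MultiArrangement.isCoatom' (M : MultiArrangement K V) {H : Submodule K V}
    (h : M.mult H ≠ 0) : IsCoatom H := M.isCoatom H (by simpa using h)

theorem MultiArrangement.mem_hyperplanes {M : MultiArrangement K V} {H : Submodule K V} :
    H ∈ M.hyperplanes ↔ M.mult H ≠ 0 := by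
  simp [MultiArrangement.hyperplanes]

theorem powProd_add (m m' : Submodule K V →₀ ℕ) : powProd (m + m') = powProd m * powProd m' := by
  classical
  exact Finsupp.prod_add_index' (by simp) (by intros; rw [pow_add])

theorem powProd_single (H : Submodule K V) (k : ℕ) :
    powProd (Finsupp.single H k) = linForm (formOf H) ^ k :=
  Finsupp.prod_single_index (by simp)

theorem powProd_ne_zero {m : Submodule K V →₀ ℕ} (h : ∀ H ∈ m.support, IsCoatom H) :
    powProd m ≠ 0 :=
  Finset.prod_ne_zero_iff.2 fun H hH => pow_ne_zero _ (prime_formOf (h H hH)).ne_zero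

theorem powProd_mem (m : Submodule K V →₀ ℕ) :
    powProd m ∈ homogeneousPart K V (m.sum fun _ k => k) :=
  prod_mem_homogeneousPart _ _ _ fun _ _ => linForm_pow_mem _ _

theorem not_dvd_powProd {H : Submodule K V} (hH : IsCoatom H) {m : Submodule K V →₀ ℕ}
    (h : ∀ H' ∈ m.support, IsCoatom H') (h0 : m H = 0) :
    ¬ linForm (formOf H) ∣ powProd m := by
  refine not_dvd_prod_pow (prime_formOf hH) _ _ _ fun H' hH' => ?_
  rw [formOf_dvd_iff hH (h H' hH')]
  rintro rfl
  simp [h0] at hH'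

theorem powProd_dvd_iff {m : Submodule K V →₀ ℕ} (h : ∀ H ∈ m.support, IsCoatom H)
    {f : CoordRing K V} :
    powProd m ∣ f ↔ ∀ H ∈ m.support, linForm (formOf H) ^ m H ∣ f := by
  constructor
  · intro hf H hH
    exact (Finset.dvd_prod_of_mem (fun H => linForm (formOf H) ^ m H) hH).trans hf
  · intro hf
    refine prod_pow_dvd _ _ _ (fun H hH => prime_formOf (h H hH)) (fun H hH H' hH' hne => ?_) hf
    rwa [formOf_dvd_iff (h H hH) (h H' hH')]

theorem powProd_erase (m : Submodule K V →₀ ℕ) (H : Submodule K V) :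
    powProd m = linForm (formOf H) ^ m H * powProd (m.erase H) := by
  rw [← powProd_single, ← powProd_add, Finsupp.single_add_erase]

theorem le_of_pow_dvd_powProd {H : Submodule K V} (hH : IsCoatom H) {m : Submodule K V →₀ ℕ}
    (h : ∀ H' ∈ m.support, IsCoatom H') {k : ℕ} (hk : linForm (formOf H) ^ k ∣ powProd m) :
    k ≤ m H := by
  classical
  rw [powProd_erase m H] at hk
  refine le_of_pow_dvd_pow_mul (prime_formOf hH) (not_dvd_powProd hH (fun H' hH' => ?_)
    (by simp)) hk
  exact h H' (by rw [Finsupp.support_erase] at hH'; exact Finset.mem_of_mem_erase hH')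

/-- Rescaling a linear form changes the divisibility only by units, so one equation per hyperplane
suffices. Multiplicity 0 makes the condition void, which lets H range over all coatoms. -/
theorem mem_derModule_iff {M : MultiArrangement K V} {θ : Der K V} :
    θ ∈ derModule M ↔
      ∀ H, IsCoatom H → linForm (formOf H) ^ M.mult H ∣ θ (linForm (formOf H)) := by
  constructor
  · intro h H hH
    by_cases h0 : M.mult H = 0
    · simp [h0]
    · exact h H (MultiArrangement.mem_hyperplanes.2 h0) _ (ker_formOf hH)
  · intro h H hH α hα
    have hc := M.isCoatom' (MultiArrangement.mem_hyperplanes.1 hH)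
    obtain ⟨c, hc0, rfl⟩ := exists_eq_smul_of_ker_eq (ne_zero_of_ker_eq hc hα)
      ((ker_formOf hc).trans hα.symm)
    have h1 := h H hc
    rw [linForm_smul, mul_pow, ← map_pow, Derivation.leibniz, Derivation.map_algebraMap, smul_zero,
      add_zero, smul_eq_mul]
    rw [(isUnit_algebraMap (V := V) (pow_ne_zero _ hc0)).mul_left_dvd]
    exact h1.mul_left _

theorem dvd_of_mem_derModule {M : MultiArrangement K V} {θ : Der K V} (h : θ ∈ derModule M)
    {H : Submodule K V} (_hH : IsCoatom H) {α : Dual K V} (hα : LinearMap.ker α = H) :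
    linForm α ^ M.mult H ∣ θ (linForm α) := by
  by_cases h0 : M.mult H = 0
  · simp [h0]
  · exact h H (MultiArrangement.mem_hyperplanes.2 h0) _ hα

theorem derModule_anti {M N : MultiArrangement K V} (h : ∀ H, N.mult H ≤ M.mult H) :
    derModule M ≤ derModule N := by
  intro θ hθ
  rw [mem_derModule_iff] at hθ ⊢
  intro H hH
  exact (pow_dvd_pow _ (h H)).trans (hθ H hH)

/-! ### Derivations -/

theorem der_ext {θ η : Der K V} (h : ∀ α : Dual K V, θ (linForm α) = η (linForm α)) : θ = η := by
  ext f
  induction f using SymmetricAlgebra.induction with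
  | algebraMap r => simp
  | ι β => exact h β
  | mul a b ha hb => simp [ha, hb]
  | add a b ha hb => simp [ha, hb]

theorem der_ext_basis {ι : Type*} (x : Basis ι K (Dual K V)) {θ η : Der K V}
    (h : ∀ i, θ (linForm (x i)) = η (linForm (x i))) : θ = η := by
  refine der_ext fun α => ?_
  have : θ.toLinearMap ∘ₗ SymmetricAlgebra.ι K (Dual K V) =
    η.toLinearMap ∘ₗ SymmetricAlgebra.ι K (Dual K V) := x.ext fun i => h i
  exact LinearMap.congr_fun this α

/-- The derivation with prescribed values on linear forms. -/
def mkDer (g : Dual K V →ₗ[K] CoordRing K V) : Der K V :=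
  -- A derivation D is the second component of an algebra map f ↦ f + D(f) ε into S ⊕ Sε with ε² =
  -- 0, and such a map can be prescribed on linear forms.
  let F : CoordRing K V →ₐ[K] TrivSqZeroExt (CoordRing K V) (CoordRing K V) :=
    SymmetricAlgebra.lift (TrivSqZeroExt.inlAlgHom K (CoordRing K V) (CoordRing K V) ∘ₗ
      SymmetricAlgebra.ι K (Dual K V) +
      (TrivSqZeroExt.inrHom (CoordRing K V) (CoordRing K V)).restrictScalars K ∘ₗ g)
  have hF : ∀ f, (F f).fst = f := fun f => by
    have : (TrivSqZeroExt.fstHom K (CoordRing K V) (CoordRing K V)).comp F = AlgHom.id K _ := by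
      apply SymmetricAlgebra.algHom_ext
      ext β
      simp [F]
    exact DFunLike.congr_fun this f
  Derivation.mk' ((TrivSqZeroExt.sndHom (CoordRing K V) (CoordRing K V)).restrictScalars K ∘ₗ
    F.toLinearMap) fun a b => by
      simp [TrivSqZeroExt.snd_mul, hF, mul_comm]

@[simp] theorem mkDer_linForm (g : Dual K V →ₗ[K] CoordRing K V) (α : Dual K V) :
    mkDer g (linForm α) = g α := by
  simp [mkDer]

theorem mkDer_hasPDeg {g : Dual K V →ₗ[K] CoordRing K V} {p : ℕ}
    (h : ∀ α, g α ∈ homogeneousPart K V p) : HasPDeg (mkDer g) p := fun α => by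
  rw [mkDer_linForm]
  exact h α

/-- The Euler derivation. -/
def euler (K : Type u) [Field K] (V : Type v) [AddCommGroup V] [Module K V] : Der K V :=
  mkDer (SymmetricAlgebra.ι K (Dual K V))

@[simp] theorem euler_linForm (α : Dual K V) : euler K V (linForm α) = linForm α :=
  mkDer_linForm _ _

theorem euler_hasPDeg : HasPDeg (euler K V) 1 := mkDer_hasPDeg linForm_mem

/-- The coordinate derivations of a basis of the dual space. -/
def coordDer {ι : Type*} [DecidableEq ι] (x : Basis ι K (Dual K V)) (i : ι) : Der K V :=
  mkDer (x.constr K fun j => if i = j then 1 else 0)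

theorem coordDer_linForm {ι : Type*} [DecidableEq ι] (x : Basis ι K (Dual K V)) (i j : ι) :
    coordDer x i (linForm (x j)) = if i = j then 1 else 0 := by
  rw [coordDer, mkDer_linForm, Basis.constr_basis]

theorem coordDer_mem {ι : Type*} [DecidableEq ι] (x : Basis ι K (Dual K V)) (i : ι) :
    HasPDeg (coordDer x i) 0 := by
  refine mkDer_hasPDeg fun α => ?_
  have : LinearMap.range (x.constr K fun j => if i = j then (1 : CoordRing K V) else 0) ≤
      homogeneousPart K V 0 := by
    rw [Basis.constr_range, Submodule.span_le]
    rintro _ ⟨j, rfl⟩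
    dsimp only
    split_ifs
    · exact one_mem_homogeneousPart
    · exact Submodule.zero_mem _
  exact this ⟨α, rfl⟩

theorem HasPDeg.smul {θ : Der K V} {p q : ℕ} (h : HasPDeg θ p) {f : CoordRing K V}
    (hf : f ∈ homogeneousPart K V q) : HasPDeg (f • θ) (q + p) := fun α => by
  simpa using mul_mem_homogeneousPart hf (h α)

theorem HasPDeg.of_smul {η : Der K V} {p q : ℕ} {f : CoordRing K V}
    (hf : f ∈ homogeneousPart K V q) (hf0 : f ≠ 0) (h : HasPDeg (f • η) (q + p)) :
    HasPDeg η p := fun α => by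
  have := h α
  rw [Derivation.smul_apply, smul_eq_mul] at this
  exact mem_of_mul_mem hf hf0 this

theorem der_sum_apply {ι : Type*} (s : Finset ι) (c : ι → CoordRing K V) (θ : ι → Der K V)
    (f : CoordRing K V) : (∑ i ∈ s, c i • θ i) f = ∑ i ∈ s, c i * θ i f := by
  classical
  induction s using Finset.induction_on with
  | empty => simp
  | insert a s ha ih => simp [Finset.sum_insert ha, ih]

/-! ### Coefficient matrices -/

/-- The coefficient matrix of a family of derivations. -/
def coeffMatrix {n : ℕ} (x : Fin n → Dual K V) (θ : Fin n → Der K V) :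
    Matrix (Fin n) (Fin n) (CoordRing K V) :=
  Matrix.of fun i j => θ i (linForm (x j))

@[simp] theorem coeffMatrix_apply {n : ℕ} (x : Fin n → Dual K V) (θ : Fin n → Der K V)
    (i j : Fin n) : coeffMatrix x θ i j = θ i (linForm (x j)) := rfl

theorem linForm_sum {ι : Type*} (s : Finset ι) (c : ι → K) (x : ι → Dual K V) :
    linForm (∑ i ∈ s, c i • x i) = ∑ i ∈ s, algebraMap K _ (c i) * linForm (x i) := by
  rw [linForm, map_sum]
  exact Finset.sum_congr rfl fun i _ => linForm_smul _ _

theorem der_linForm_sum {ι : Type*} (s : Finset ι) (c : ι → K) (x : ι → Dual K V)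
    (θ : Der K V) : θ (linForm (∑ i ∈ s, c i • x i)) =
      ∑ i ∈ s, algebraMap K _ (c i) * θ (linForm (x i)) := by
  rw [linForm_sum, map_sum]
  refine Finset.sum_congr rfl fun i _ => ?_
  rw [Derivation.leibniz, Derivation.map_algebraMap, smul_zero, add_zero, smul_eq_mul]

/-- A column of the coefficient matrix may be replaced by any linear form. -/
theorem exists_mul_det_coeffMatrix {n : ℕ} (x : Basis (Fin n) K (Dual K V)) {α : Dual K V}
    (hα : α ≠ 0) (θ : Fin n → Der K V) : ∃ (c : K) (j : Fin n), c ≠ 0 ∧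
      ((coeffMatrix x θ).updateCol j fun i => θ i (linForm α)).det =
        algebraMap K _ c * (coeffMatrix x θ).det := by
  obtain ⟨j, hj⟩ : ∃ j, x.repr α j ≠ 0 := by
    by_contra! h
    exact hα (x.repr.map_eq_zero_iff.1 (Finsupp.ext h))
  refine ⟨x.repr α j, j, hj, ?_⟩
  have := Matrix.det_updateCol_sum (coeffMatrix x θ) j
    fun k => algebraMap K (CoordRing K V) (x.repr α k)
  rw [smul_eq_mul] at this
  rw [← this]
  congr 2
  funext i
  conv_lhs => rw [← x.sum_repr α]
  rw [der_linForm_sum]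
  simp

/-- Up to a nonzero constant, some column can be replaced by the values at α_H, all divisible by α_H
^ μ(H). Powers of equations of distinct hyperplanes are coprime, so their product divides as well.
-/
theorem defPoly_dvd_det {n : ℕ} (x : Basis (Fin n) K (Dual K V)) {M : MultiArrangement K V}
    {θ : Fin n → Der K V} (h : ∀ i, θ i ∈ derModule M) : M.defPoly ∣ (coeffMatrix x θ).det := by
  refine (powProd_dvd_iff M.isCoatom).2 fun H hH => ?_
  have hc := M.isCoatom H hH
  obtain ⟨c, j, hc0, hdet⟩ := exists_mul_det_coeffMatrix x (formOf_ne_zero hc) θ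
  rw [← (isUnit_algebraMap (V := V) hc0).dvd_mul_left, ← hdet]
  choose g hg using fun i => mem_derModule_iff.1 (h i) H hc
  have : (fun i => θ i (linForm (formOf H))) = linForm (formOf H) ^ M.mult H • g := by
    funext i
    simp [hg]
  rw [this, Matrix.det_updateCol_smul]
  exact dvd_mul_right _ _

theorem det_coeffMatrix_associated {n : ℕ} (x x' : Basis (Fin n) K (Dual K V))
    (θ : Fin n → Der K V) : Associated (coeffMatrix x θ).det (coeffMatrix x' θ).det := by
  have h : coeffMatrix x' θ = coeffMatrix x θ * (x.toMatrix x').map (algebraMap K _) := by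
    ext i j
    rw [Matrix.mul_apply, coeffMatrix_apply]
    conv_lhs => rw [← x.sum_repr (x' j)]
    rw [der_linForm_sum]
    refine Finset.sum_congr rfl fun k _ => ?_
    rw [coeffMatrix_apply, Matrix.map_apply, Basis.toMatrix_apply, mul_comm]
  have hu : IsUnit ((x.toMatrix x').map (algebraMap K (CoordRing K V))).det := by
    have h2 : IsUnit (x.toMatrix x').det := by
      refine IsUnit.of_mul_eq_one (x'.toMatrix x).det ?_
      rw [← Matrix.det_mul, Basis.toMatrix_mul_toMatrix_flip, Matrix.det_one]
    have h3 := h2.map (algebraMap K (CoordRing K V))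
    rwa [RingHom.map_det] at h3
  rw [h, Matrix.det_mul]
  exact (associated_mul_unit_right _ _ hu)

/-! ### Saito's criterion -/

/-- `θ` is a basis of the module `D(M)`. -/
structure IsDerBasis {ι : Type*} (M : MultiArrangement K V) (θ : ι → Der K V) : Prop where
  mem : ∀ i, θ i ∈ derModule M
  li : LinearIndependent (CoordRing K V) θ
  span : ∀ η ∈ derModule M, η ∈ Submodule.span (CoordRing K V) (Set.range θ)

theorem linearIndependent_of_det_ne_zero {n : ℕ} (x : Fin n → Dual K V)
    {θ : Fin n → Der K V} (h : (coeffMatrix x θ).det ≠ 0) :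
    LinearIndependent (CoordRing K V) θ := by
  rw [Fintype.linearIndependent_iff]
  intro c hc
  have : Matrix.vecMul c (coeffMatrix x θ) = 0 := by
    funext j
    have := congrArg (fun η : Der K V => η (linForm (x j))) hc
    simp only [der_sum_apply] at this
    simpa [Matrix.vecMul, dotProduct] using this
  exact fun i => congrFun (Matrix.eq_zero_of_vecMul_eq_zero h this) i

/-- Cramer's rule: replacing one member by some η in D(M) gives a determinant divisible by Q(M),
hence by the original one, so the coefficients of η are polynomials. -/
theorem isDerBasis_of_det {n : ℕ} (x : Basis (Fin n) K (Dual K V)) {M : MultiArrangement K V}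
    {θ : Fin n → Der K V} (hmem : ∀ i, θ i ∈ derModule M)
    (hdet : Associated (coeffMatrix x θ).det M.defPoly) : IsDerBasis M θ := by
  have h0 : (coeffMatrix x θ).det ≠ 0 := hdet.ne_zero_iff.2 (powProd_ne_zero M.isCoatom)
  refine ⟨hmem, linearIndependent_of_det_ne_zero x h0, fun η hη => ?_⟩
  have hupd : ∀ i, ∃ c, (coeffMatrix x (Function.update θ i η)).det =
      (coeffMatrix x θ).det * c := by
    intro i
    refine hdet.dvd.trans (defPoly_dvd_det x fun k => ?_)
    by_cases hk : k = i
    · subst hk; simpa using hη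
    · simpa [hk] using hmem k
  choose c hc using hupd
  have : η = ∑ i, c i • θ i := by
    refine der_ext_basis x fun j => mul_left_cancel₀ h0 ?_
    have := congrFun (Matrix.mulVec_cramer (coeffMatrix x θ).transpose
      fun k => η (linForm (x k))) j
    simp only [Matrix.mulVec, dotProduct, Matrix.cramer_transpose_apply, Matrix.det_transpose,
      Pi.smul_apply, smul_eq_mul, Matrix.transpose_apply, coeffMatrix_apply] at this
    rw [← this, der_sum_apply, Finset.mul_sum]
    refine Finset.sum_congr rfl fun i _ => ?_
    have h2 : (coeffMatrix x θ).updateRow i (fun k => η (linForm (x k))) =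
        coeffMatrix x (Function.update θ i η) := by
      ext a b
      by_cases ha : a = i
      · subst ha; simp
      · simp [ha]
    rw [h2, hc]
    ring
  rw [this]
  exact Submodule.sum_mem _ fun i _ => Submodule.smul_mem _ _ (Submodule.subset_span ⟨i, rfl⟩)

theorem IsDerBasis.exists_coeff {n : ℕ} {M : MultiArrangement K V} {θ : Fin n → Der K V}
    (h : IsDerBasis M θ) {η : Der K V} (hη : η ∈ derModule M) :
    ∃ c : Fin n → CoordRing K V, η = ∑ i, c i • θ i := by
  obtain ⟨c, hc⟩ := (Submodule.mem_span_range_iff_exists_fun _).1 (h.span η hη)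
  exact ⟨c, hc.symm⟩

theorem IsDerBasis.det_dvd {n : ℕ} {M : MultiArrangement K V} {θ : Fin n → Der K V}
    (h : IsDerBasis M θ) (x : Fin n → Dual K V) {η : Fin n → Der K V}
    (hη : ∀ i, η i ∈ derModule M) : (coeffMatrix x θ).det ∣ (coeffMatrix x η).det := by
  choose c hc using fun i => h.exists_coeff (hη i)
  have : coeffMatrix x η = Matrix.of c * coeffMatrix x θ := by
    ext i j
    rw [Matrix.mul_apply, coeffMatrix_apply, hc i, der_sum_apply]
    rfl
  rw [this, Matrix.det_mul]
  exact dvd_mul_left _ _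

/-- A basis of the dual of `W` extends by an equation `α` of `W` to a basis of the dual of `V`. -/
theorem exists_basis_cons {n : ℕ} {j : W →ₗ[K] V} (hj : Function.Injective j) {α : Dual K V}
    (hα : α ≠ 0) (hr : LinearMap.range j = LinearMap.ker α) (y : Basis (Fin n) K (Dual K W)) :
    ∃ x : Basis (Fin (n + 1)) K (Dual K V), x 0 = α ∧ ∀ i, x i.succ ∘ₗ j = y i := by
  choose x₁ hx₁ using fun i => exists_comp_eq hj (y i)
  have hαj : α ∘ₗ j = 0 := by
    ext w
    have : j w ∈ LinearMap.ker α := hr ▸ LinearMap.mem_range_self j w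
    simpa using this
  have hsum : ∀ c : Fin n → K, (∑ i, c i • x₁ i) ∘ₗ j = ∑ i, c i • y i := by
    intro c
    ext w
    simp [LinearMap.sum_apply, ← hx₁]
  have hli : LinearIndependent K (Fin.cons α x₁ : Fin (n + 1) → Dual K V) := by
    rw [Fintype.linearIndependent_iff]
    intro c hc
    rw [Fin.sum_univ_succ] at hc
    simp only [Fin.cons_zero, Fin.cons_succ] at hc
    have h1 := congrArg (fun β : Dual K V => β ∘ₗ j) hc
    simp only [LinearMap.add_comp, LinearMap.smul_comp, hαj, smul_zero, zero_add, hsum,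
      LinearMap.zero_comp] at h1
    have h2 := Fintype.linearIndependent_iff.1 y.linearIndependent _ h1
    intro i
    refine Fin.cases ?_ h2 i
    simp only [h2, zero_smul, Finset.sum_const_zero, add_zero] at hc
    exact (smul_eq_zero.1 hc).resolve_right hα
  have hsp : ⊤ ≤ Submodule.span K (Set.range (Fin.cons α x₁ : Fin (n + 1) → Dual K V)) := by
    intro β _
    have h1 := hsum (y.repr (β ∘ₗ j))
    rw [y.sum_repr] at h1
    obtain ⟨c, hc⟩ := exists_smul_of_ker_le (α := α)
      (β := β - ∑ i, y.repr (β ∘ₗ j) i • x₁ i) (by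
        rw [← hr]
        rintro _ ⟨w, rfl⟩
        have := LinearMap.congr_fun h1 w
        simp only [LinearMap.comp_apply] at this
        rw [LinearMap.mem_ker, LinearMap.sub_apply, this, sub_self])
    rw [sub_eq_iff_eq_add] at hc
    rw [hc]
    refine Submodule.add_mem _ (Submodule.smul_mem _ _ (Submodule.subset_span ⟨0, rfl⟩))
      (Submodule.sum_mem _ fun i _ => Submodule.smul_mem _ _ (Submodule.subset_span ⟨i.succ, ?_⟩))
    simp
  refine ⟨Basis.mk hli hsp, by simp, fun i => by simp [hx₁]⟩

theorem exists_basis_dual_ker {n : ℕ} (x : Basis (Fin (n + 1)) K (Dual K V)) {α : Dual K V}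
    (hα : α ≠ 0) : Nonempty (Basis (Fin n) K (Dual K (LinearMap.ker α))) := by
  have : FiniteDimensional K (Dual K V) := .of_basis x
  have : FiniteDimensional K V := Module.finite_dual_iff K |>.1 this
  have h1 : finrank K V = n + 1 := by
    rw [← Subspace.dual_finrank_eq, finrank_eq_card_basis x, Fintype.card_fin]
  have h2 : finrank K (Dual K (LinearMap.ker α)) = n := by
    have h3 := LinearMap.finrank_range_add_finrank_ker α
    rw [LinearMap.range_eq_top.2 (LinearMap.surjective hα), finrank_top, finrank_self, h1] at h3
    rw [Subspace.dual_finrank_eq]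
    omega
  exact ⟨finBasisOfFinrankEq K _ h2⟩

/-- The converse of Saito's criterion. -/
theorem IsDerBasis.det_associated {n : ℕ} {M : MultiArrangement K V} {θ : Fin n → Der K V}
    (h : IsDerBasis M θ) (x : Basis (Fin n) K (Dual K V)) :
    Associated (coeffMatrix x θ).det M.defPoly := by
  classical
  refine associated_of_dvd_dvd ?_ (defPoly_dvd_det x h.mem)
  -- Because Q ∂ᵢ lies in D(M), the determinant divides Qⁿ and has no prime factors besides the α_H.
  -- It remains to bound the exponent of each α_H.
  have hQ : ∀ i, M.defPoly • coordDer x i ∈ derModule M := by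
    intro i
    rw [mem_derModule_iff]
    intro H hH
    rw [Derivation.smul_apply, smul_eq_mul, MultiArrangement.defPoly, powProd_erase M.mult H]
    exact (dvd_mul_right _ _).mul_right _
  have h1 : (coeffMatrix x θ).det ∣ M.defPoly ^ n := by
    refine (h.det_dvd x hQ).trans (dvd_of_eq ?_)
    have : coeffMatrix x (fun i => M.defPoly • coordDer x i) =
        Matrix.diagonal fun _ => M.defPoly := by
      ext i j
      simp [coordDer_linForm, Matrix.diagonal_apply]
    rw [this, Matrix.det_diagonal]
    simp
  rw [MultiArrangement.defPoly, powProd, Finsupp.prod, ← Finset.prod_pow] at h1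
  simp only [← pow_mul] at h1
  refine dvd_prod_pow _ _ _ _ (fun H hH => prime_formOf (M.isCoatom H hH)) h1 fun H hH hd => ?_
  have hc := M.isCoatom H hH
  cases n with
  | zero =>
    simp only [Matrix.det_isEmpty] at hd
    exact (prime_formOf hc).not_isUnit (isUnit_of_dvd_one
      ((dvd_pow_self _ (by simp)).trans hd))
  | succ n =>
    obtain ⟨y⟩ := exists_basis_dual_ker x (formOf_ne_zero hc)
    obtain ⟨x', hx0, -⟩ := exists_basis_cons (Submodule.injective_subtype _) (formOf_ne_zero hc)
      (by simp) y
    rw [(det_coeffMatrix_associated x x' θ).dvd_iff_dvd_right] at hd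
    set P := powProd (M.mult.erase H) with hP
    have hQP : M.defPoly = linForm (formOf H) ^ M.mult H * P := powProd_erase _ _
    have hPn : ¬ linForm (formOf H) ∣ P := not_dvd_powProd hc (fun H' hH' => M.isCoatom H' (by
      rw [Finsupp.support_erase] at hH'; exact Finset.mem_of_mem_erase hH')) (by simp)
    -- In coordinates beginning with α_H, the later ∂ᵢ kill α_H, so P, which is Q without its power
    -- of α_H, suffices as their factor. The determinant Q Pⁿ of this family contains α_H exactly
    -- μ(H) times.
    let η : Fin (n + 1) → Der K V := Fin.cons (M.defPoly • coordDer x' 0)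
      fun i => P • coordDer x' i.succ
    have hη : ∀ i, η i ∈ derModule M := by
      intro i
      rw [mem_derModule_iff]
      intro H' hH'
      refine Fin.cases ?_ (fun i => ?_) i
      · simp only [η, Fin.cons_zero]
        rw [Derivation.smul_apply, smul_eq_mul, MultiArrangement.defPoly, powProd_erase M.mult H']
        exact (dvd_mul_right _ _).mul_right _
      · simp only [η, Fin.cons_succ]
        rw [Derivation.smul_apply, smul_eq_mul]
        by_cases hHH : H' = H
        · subst hHH
          rw [← hx0, coordDer_linForm]
          simp
        · refine Dvd.dvd.mul_right ?_ _
          rw [hP, powProd_erase _ H', Finsupp.erase_ne hHH]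
          exact dvd_mul_right _ _
    have h2 := hd.trans (h.det_dvd x' hη)
    have h3 : coeffMatrix x' η = Matrix.diagonal (Fin.cons M.defPoly fun _ => P) := by
      ext i j
      rw [coeffMatrix_apply, Matrix.diagonal_apply]
      refine Fin.cases ?_ (fun i => ?_) i <;> simp [η, coordDer_linForm]
    rw [h3, Matrix.det_diagonal, Fin.prod_univ_succ] at h2
    simp only [Fin.cons_zero, Fin.cons_succ, Finset.prod_const] at h2
    rw [hQP, mul_assoc] at h2
    refine not_pow_succ_dvd_pow_mul (prime_formOf hc) ?_ _ h2
    rw [(prime_formOf hc).dvd_mul]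
    rintro (h | h)
    · exact hPn h
    · exact hPn ((prime_formOf hc).dvd_of_dvd_pow h)

end

/-! ### Restriction of derivations and pull-back of multiarrangements -/

section

variable {W : Type v} [AddCommGroup W] [Module K W]

/-! ### Exponents -/

theorem exists_basis_of_isDerBasis {n : ℕ} {M : MultiArrangement K V} {θ : Fin n → Der K V}
    (h : IsDerBasis M θ) :
    ∃ b : Basis (Fin n) (CoordRing K V) (derModule M), ∀ i, (b i : Der K V) = θ i := by
  have hli : LinearIndependent (CoordRing K V) fun i => (⟨θ i, h.mem i⟩ : derModule M) :=
    LinearIndependent.of_comp (derModule M).subtype h.li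
  have hsp : ⊤ ≤ Submodule.span (CoordRing K V)
      (Set.range fun i => (⟨θ i, h.mem i⟩ : derModule M)) := by
    rintro ⟨η, hη⟩ -
    obtain ⟨c, hc⟩ := h.exists_coeff hη
    have : (⟨η, hη⟩ : derModule M) = ∑ i, c i • ⟨θ i, h.mem i⟩ := by
      apply Subtype.ext
      simp [hc]
    rw [this]
    exact Submodule.sum_mem _ fun i _ => Submodule.smul_mem _ _ (Submodule.subset_span ⟨i, rfl⟩)
  exact ⟨Basis.mk hli hsp, fun i => by simp⟩

theorem hasExponents_of_isDerBasis {n : ℕ} (hn : finrank K V = n) {M : MultiArrangement K V}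
    {θ : Fin n → Der K V} {d : Fin n → ℕ} (h : IsDerBasis M θ) (hd : ∀ i, HasPDeg (θ i) (d i)) :
    HasExponents M (Finset.univ.val.map d) := by
  subst hn
  obtain ⟨b, hb⟩ := exists_basis_of_isDerBasis h
  exact ⟨b, d, fun i => by rw [hb]; exact hd i, rfl⟩

theorem linearIndependent_coe_basis {R E ι : Type*} [CommRing R] [AddCommGroup E] [Module R E]
    {N : Submodule R E} (b : Basis ι R N) : LinearIndependent R (fun i => (b i : E)) ∧
      ∀ x ∈ N, x ∈ Submodule.span R (Set.range fun i => (b i : E)) := by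
  refine ⟨b.linearIndependent.map' N.subtype (Submodule.ker_subtype _), fun x hx => ?_⟩
  have h1 : Submodule.map N.subtype (Submodule.span R (Set.range b)) = N := by
    rw [b.span_eq, Submodule.map_subtype_top]
  rw [Submodule.map_span, ← Set.range_comp] at h1
  exact h1.ge hx

theorem HasExponents.exists_isDerBasis {n : ℕ} (hn : finrank K V = n) {M : MultiArrangement K V}
    {e : Multiset ℕ} (h : HasExponents M e) : ∃ (θ : Fin n → Der K V) (d : Fin n → ℕ),
      IsDerBasis M θ ∧ (∀ i, HasPDeg (θ i) (d i)) ∧ e = Finset.univ.val.map d := by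
  subst hn
  obtain ⟨b, d, hd, he⟩ := h
  obtain ⟨h1, h2⟩ := linearIndependent_coe_basis b
  exact ⟨fun i => (b i : Der K V), d, ⟨fun i => (b i).2, h1, h2⟩, hd, he⟩

/-! ### Restricting derivations -/

/-- `θ'` is the restriction of `θ` along `j`. -/
def RestrictsTo (j : W →ₗ[K] V) (θ : Der K V) (θ' : Der K W) : Prop :=
  ∀ β : Dual K V, θ' (linForm (β ∘ₗ j)) = res j (θ (linForm β))

theorem RestrictsTo.comp {U : Type v} [AddCommGroup U] [Module K U] {i : U →ₗ[K] W}
    {j : W →ₗ[K] V} {θ : Der K V} {θ' : Der K W} {θ'' : Der K U} (h : RestrictsTo j θ θ')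
    (h' : RestrictsTo i θ' θ'') : RestrictsTo (j ∘ₗ i) θ θ'' := fun β => by
  rw [← LinearMap.comp_assoc, h', h, res_res]

theorem RestrictsTo.smul {j : W →ₗ[K] V} {θ : Der K V} {θ' : Der K W} (h : RestrictsTo j θ θ')
    (f : CoordRing K V) : RestrictsTo j (f • θ) (res j f • θ') := fun β => by
  simp [h β]

theorem RestrictsTo.sum {ι : Type*} (s : Finset ι) {j : W →ₗ[K] V} {θ : ι → Der K V}
    {θ' : ι → Der K W} (c : ι → CoordRing K V) (h : ∀ i ∈ s, RestrictsTo j (θ i) (θ' i)) :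
    RestrictsTo j (∑ i ∈ s, c i • θ i) (∑ i ∈ s, res j (c i) • θ' i) := fun β => by
  rw [der_sum_apply, der_sum_apply, map_sum]
  refine Finset.sum_congr rfl fun i hi => ?_
  rw [h i hi β, map_mul]

theorem restrictsTo_euler (j : W →ₗ[K] V) : RestrictsTo j (euler K V) (euler K W) :=
  fun β => by simp

theorem RestrictsTo.hasPDeg {j : W →ₗ[K] V} (hj : Function.Injective j) {θ : Der K V}
    {θ' : Der K W} (h : RestrictsTo j θ θ') {p : ℕ} (hp : HasPDeg θ p) : HasPDeg θ' p := by
  intro γ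
  obtain ⟨β, rfl⟩ := exists_comp_eq hj γ
  rw [h]
  exact res_mem j (hp β)

theorem exists_restrictsTo {j : W →ₗ[K] V} (hj : Function.Injective j) {θ : Der K V}
    (h : ∀ β : Dual K V, β ∘ₗ j = 0 → res j (θ (linForm β)) = 0) :
    ∃ θ' : Der K W, RestrictsTo j θ θ' := by
  obtain ⟨r, hr⟩ := j.exists_leftInverse_of_injective (LinearMap.ker_eq_bot.2 hj)
  refine ⟨mkDer ((res j).toLinearMap ∘ₗ θ.toLinearMap ∘ₗ SymmetricAlgebra.ι K (Dual K V) ∘ₗ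
    r.dualMap), fun β => ?_⟩
  rw [mkDer_linForm]
  change res j (θ (linForm ((β ∘ₗ j) ∘ₗ r))) = _
  rw [← sub_eq_zero, ← map_sub, ← map_sub, linForm, ← map_sub]
  refine h _ ?_
  rw [LinearMap.sub_comp, LinearMap.comp_assoc, hr, LinearMap.comp_id, sub_self]

/-- The functionals vanishing on the range of `j`, for `j` parametrizing `ker α`. -/
theorem eq_smul_of_comp_eq_zero {j : W →ₗ[K] V} {α β : Dual K V}
    (hr : LinearMap.range j = LinearMap.ker α) (h : β ∘ₗ j = 0) : ∃ c : K, β = c • α := by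
  refine exists_smul_of_ker_le ?_
  rw [← hr]
  rintro _ ⟨w, rfl⟩
  exact LinearMap.congr_fun h w

theorem der_smul_linForm (θ : Der K V) (c : K) (α : Dual K V) :
    θ (linForm (c • α)) = algebraMap K _ c * θ (linForm α) := by
  rw [linForm_smul, Derivation.leibniz, Derivation.map_algebraMap, smul_zero, add_zero,
    smul_eq_mul]

theorem comp_eq_zero_of_range {j : W →ₗ[K] V} {α : Dual K V}
    (hr : LinearMap.range j = LinearMap.ker α) : α ∘ₗ j = 0 := by
  ext w
  have : j w ∈ LinearMap.ker α := hr ▸ LinearMap.mem_range_self j w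
  simpa using this

theorem exists_restrictsTo_of_dvd {j : W →ₗ[K] V} (hj : Function.Injective j) {α : Dual K V}
    (hr : LinearMap.range j = LinearMap.ker α) {θ : Der K V}
    (h : linForm α ∣ θ (linForm α)) : ∃ θ' : Der K W, RestrictsTo j θ θ' := by
  refine exists_restrictsTo hj fun β hβ => ?_
  obtain ⟨c, rfl⟩ := eq_smul_of_comp_eq_zero hr hβ
  obtain ⟨g, hg⟩ := h
  rw [der_smul_linForm, hg, map_mul, map_mul, res_linForm, comp_eq_zero_of_range hr, linForm_zero]
  simp

/-- A derivation restricting to zero on `ker α` is divisible by `α`. -/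
theorem exists_eq_smul_of_restrictsTo_zero {j : W →ₗ[K] V} (hj : Function.Injective j)
    {α : Dual K V} (hα : α ≠ 0) (hr : LinearMap.range j = LinearMap.ker α) {θ : Der K V}
    (h : RestrictsTo j θ 0) : ∃ η : Der K V, θ = linForm α • η := by
  have h1 : ∀ β : Dual K V, linForm α ∣ θ (linForm β) := fun β => by
    rw [← res_eq_zero_iff hj hα hr, ← h β]
    simp
  let x := Module.Free.chooseBasis K (Dual K V)
  choose g hg using fun i => h1 (x i)
  refine ⟨mkDer (x.constr K g), der_ext_basis x fun i => ?_⟩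
  rw [Derivation.smul_apply, mkDer_linForm, Basis.constr_basis, hg, smul_eq_mul]

/-! ### Determinants under restriction -/

theorem det_coeffMatrix_restrictsTo {n : ℕ} {j : W →ₗ[K] V} {x : Fin n → Dual K V}
    {y : Fin n → Dual K W} (hy : ∀ i, x i ∘ₗ j = y i) {θ : Fin n → Der K V}
    {θ' : Fin n → Der K W} (h : ∀ i, RestrictsTo j (θ i) (θ' i)) :
    (coeffMatrix y θ').det = res j (coeffMatrix x θ).det := by
  rw [AlgHom.map_det]
  congr 1
  ext a b
  simp [← hy, h a (x b)]

/-- The column of `x 0` is divisible by the k-th power of `x 0`. After removal of this factor, its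
entries below the top one still vanish under `res j`, and expanding along it leaves a single minor,
the determinant of the restricted derivations. -/
theorem exists_det_cons {n : ℕ} {j : W →ₗ[K] V} {x : Fin (n + 1) → Dual K V}
    {y : Fin n → Dual K W} (hx0 : x 0 ∘ₗ j = 0) (hy : ∀ i : Fin n, x i.succ ∘ₗ j = y i)
    {θ : Fin n → Der K V} {θ' : Fin n → Der K W} (h : ∀ i, RestrictsTo j (θ i) (θ' i))
    {η : Der K V} {k : ℕ} {g : CoordRing K V} (hη : η (linForm (x 0)) = linForm (x 0) ^ k * g)
    (hθ : ∀ i, linForm (x 0) ^ (k + 1) ∣ θ i (linForm (x 0))) :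
    ∃ D, (coeffMatrix x (Fin.cons η θ)).det = linForm (x 0) ^ k * D ∧
      res j D = res j g * (coeffMatrix y θ').det := by
  choose t ht using hθ
  let u : Fin (n + 1) → CoordRing K V := Fin.cons g fun i => linForm (x 0) * t i
  refine ⟨((coeffMatrix x (Fin.cons η θ)).updateCol 0 u).det, ?_, ?_⟩
  · rw [← Matrix.det_updateCol_smul]
    congr 1
    ext a b
    refine Fin.cases ?_ (fun b => ?_) b
    · rw [Matrix.updateCol_self, coeffMatrix_apply]
      refine Fin.cases ?_ (fun a => ?_) a
      · simp [u, hη]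
      · simp only [Fin.cons_succ, Pi.smul_apply, u, smul_eq_mul, ht]
        ring
    · rw [Matrix.updateCol_ne (Fin.succ_ne_zero b)]
  · rw [AlgHom.map_det, Matrix.det_succ_column_zero, Fin.sum_univ_succ]
    have h0 : ∀ i : Fin n, res j (u i.succ) = 0 := fun i => by
      simp only [u, Fin.cons_succ, map_mul, res_linForm, hx0, linForm_zero, zero_mul]
    have hz : ∀ i : Fin n, ((res j).mapMatrix
        ((coeffMatrix x (Fin.cons η θ)).updateCol 0 u)) i.succ 0 = 0 := fun i => by
      rw [AlgHom.mapMatrix_apply, Matrix.map_apply, Matrix.updateCol_self, h0]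
    simp only [hz, mul_zero, zero_mul, Finset.sum_const_zero, add_zero]
    rw [AlgHom.mapMatrix_apply, Matrix.map_apply, Matrix.updateCol_self]
    simp only [Fin.val_zero, pow_zero, one_mul, u, Fin.cons_zero]
    congr 2
    ext a b
    simp [← hy, h a (x b.succ), Fin.succAbove_zero]

/-! ### Pulling back multiarrangements -/

/-- The pull-back of a multiplicity function along a linear map. -/
def pullMult (m : Submodule K V →₀ ℕ) (j : W →ₗ[K] V) : Submodule K W →₀ ℕ :=
  (m.mapDomain (Submodule.comap j)).erase ⊤

theorem exists_of_pullMult_ne_zero {m : Submodule K V →₀ ℕ} {j : W →ₗ[K] V} {Y : Submodule K W}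
    (h : pullMult m j Y ≠ 0) : Y ≠ ⊤ ∧ ∃ H ∈ m.support, H.comap j = Y := by
  classical
  by_cases hY : Y = ⊤
  · subst hY
    simp [pullMult] at h
  · rw [pullMult, Finsupp.erase_ne hY, ← Finsupp.mem_support_iff] at h
    have := Finsupp.mapDomain_support h
    rw [Finset.mem_image] at this
    exact ⟨hY, this⟩

/-- The pull-back of a multiarrangement along a linear map; the hyperplanes containing the range
disappear. -/
def MultiArrangement.pull (M : MultiArrangement K V) (j : W →ₗ[K] V) : MultiArrangement K W where
  mult := pullMult M.mult j
  isCoatom Y hY := by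
    obtain ⟨h1, H, hH, rfl⟩ := exists_of_pullMult_ne_zero (Finsupp.mem_support_iff.1 hY)
    exact (Submodule.isCoatom_comap_or_eq_top j (M.isCoatom H hH)).resolve_right h1

theorem pullMult_apply [DecidableEq (Submodule K W)] (m : Submodule K V →₀ ℕ) (j : W →ₗ[K] V)
    {Y : Submodule K W} (hY : Y ≠ ⊤) :
    pullMult m j Y = ∑ H ∈ m.support with H.comap j = Y, m H := by
  rw [pullMult, Finsupp.erase_ne hY, Finsupp.mapDomain, Finsupp.sum_apply, Finsupp.sum,
    Finset.sum_filter]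
  exact Finset.sum_congr rfl fun H _ => by rw [Finsupp.single_apply]

theorem le_pullMult (m : Submodule K V →₀ ℕ) (j : W →ₗ[K] V) {H : Submodule K V}
    (hY : H.comap j ≠ ⊤) : m H ≤ pullMult m j (H.comap j) := by
  classical
  rw [pullMult_apply m j hY]
  by_cases h : m H = 0
  · simp [h]
  · exact Finset.single_le_sum (f := fun H => m H) (fun _ _ => Nat.zero_le _) (by simpa using h)

theorem MultiArrangement.mem_pull_hyperplanes {M : MultiArrangement K V} {j : W →ₗ[K] V}
    {Y : Submodule K W} : Y ∈ (M.pull j).hyperplanes ↔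
      Y ≠ ⊤ ∧ ∃ H ∈ M.hyperplanes, H.comap j = Y := by
  rw [mem_hyperplanes]
  constructor
  · exact exists_of_pullMult_ne_zero
  · rintro ⟨h1, H, hH, rfl⟩
    have := le_pullMult M.mult j h1
    have h2 := mem_hyperplanes.1 hH
    change pullMult M.mult j _ ≠ 0
    omega

theorem pullMult_add (m m' : Submodule K V →₀ ℕ) (j : W →ₗ[K] V) :
    pullMult (m + m') j = pullMult m j + pullMult m' j := by
  rw [pullMult, Finsupp.mapDomain_add, Finsupp.erase_add]
  rfl

theorem pullMult_single {H : Submodule K V} {j : W →ₗ[K] V} (hH : H.comap j ≠ ⊤) (k : ℕ) :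
    pullMult (Finsupp.single H k) j = Finsupp.single (H.comap j) k := by
  rw [pullMult, Finsupp.mapDomain_single, Finsupp.erase_single_ne hH.symm]

theorem pullMult_single_of_eq_top {H : Submodule K V} {j : W →ₗ[K] V} (hH : H.comap j = ⊤)
    (k : ℕ) : pullMult (Finsupp.single H k) j = 0 := by
  rw [pullMult, Finsupp.mapDomain_single, hH, Finsupp.erase_single]

theorem ker_comp (α : Dual K V) (j : W →ₗ[K] V) :
    LinearMap.ker (α ∘ₗ j) = (LinearMap.ker α).comap j := LinearMap.ker_comp _ _

/-- Factors with the same trace coalesce and their exponents add up; `hj` keeps every factor from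
restricting to zero. -/
theorem res_powProd (m : Submodule K V →₀ ℕ) (j : W →ₗ[K] V)
    (h : ∀ H ∈ m.support, IsCoatom H) (hj : ∀ H ∈ m.support, H.comap j ≠ ⊤) :
    Associated (res j (powProd m)) (powProd (pullMult m j)) := by
  classical
  induction m using Finsupp.induction with
  | zero => simp [powProd, pullMult]
  | single_add H k m hH hk ih =>
    have hs : (Finsupp.single H k + m).support = insert H m.support := by
      rw [Finsupp.support_add_eq, Finsupp.support_single _ hk, Finset.insert_eq]
      rw [Finsupp.support_single _ hk]
      simpa using hH
    rw [hs] at h hj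
    have hc := h H (by simp)
    have ht := hj H (by simp)
    have hc' := (Submodule.isCoatom_comap_or_eq_top j hc).resolve_right ht
    rw [powProd_add, map_mul, pullMult_add, powProd_add, pullMult_single ht, powProd_single,
      powProd_single, map_pow, res_linForm]
    refine Associated.mul_mul (Associated.pow_pow ?_)
      (ih (fun H hH => h H (by simp [hH])) fun H hH => hj H (by simp [hH]))
    refine associated_linForm (formOf_ne_zero hc') ?_
    rw [ker_formOf hc', ker_comp, ker_formOf hc]

/-- If H has trace Y, then α_H differs from a multiple of β by a form vanishing on W, which θ kills;
so α_H ^ μ(H) divides θ(β). These powers are coprime for distinct H, and on W their product becomes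
the power of the equation of Y with the summed exponent. -/
theorem mem_derModule_pull {M : MultiArrangement K V} {j : W →ₗ[K] V}
    (hj : Function.Injective j) {θ : Der K V} {θ' : Der K W} (h : RestrictsTo j θ θ')
    (hθ : θ ∈ derModule M) (h0 : ∀ β : Dual K V, β ∘ₗ j = 0 → θ (linForm β) = 0) :
    θ' ∈ derModule (M.pull j) := by
  classical
  rw [mem_derModule_iff]
  intro Y hY
  obtain ⟨β, hβ⟩ := exists_comp_eq hj (formOf Y)
  rw [← hβ, h]
  change linForm (β ∘ₗ j) ^ pullMult M.mult j Y ∣ _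
  rw [pullMult_apply _ _ hY.1]
  have key : ∀ H ∈ M.mult.support.filter fun H => H.comap j = Y,
      linForm (formOf H) ^ M.mult H ∣ θ (linForm β) := by
    intro H hH
    rw [Finset.mem_filter] at hH
    have hc := M.isCoatom H hH.1
    obtain ⟨c, hc0, hc1⟩ := exists_eq_smul_of_ker_eq (α := β ∘ₗ j) (β := formOf H ∘ₗ j) (by
      refine ne_zero_of_ker_eq hY ?_
      rw [ker_comp, ker_formOf hc, hH.2]) (by
      rw [hβ, ker_formOf hY, ker_comp, ker_formOf hc, hH.2])
    have h1 := h0 (formOf H - c • β) (by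
      rw [LinearMap.sub_comp, LinearMap.smul_comp, hc1, sub_self])
    rw [linForm, map_sub, map_sub, sub_eq_zero] at h1
    have h2 := mem_derModule_iff.1 hθ H hc
    rw [linForm, h1] at h2
    have h3 := der_smul_linForm θ c β
    rw [linForm] at h3
    rw [h3] at h2
    exact (isUnit_algebraMap (V := V) hc0).dvd_mul_left.1 h2
  have h4 := prod_pow_dvd _ (fun H => linForm (formOf H)) M.mult (fun H hH =>
    prime_formOf (M.isCoatom H (Finset.mem_filter.1 hH).1)) (fun H hH H' hH' hne => by
      rwa [formOf_dvd_iff (M.isCoatom H (Finset.mem_filter.1 hH).1)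
        (M.isCoatom H' (Finset.mem_filter.1 hH').1)]) key
  have h5 := map_dvd (res j) h4
  rw [map_prod] at h5
  refine dvd_trans (Associated.dvd ?_) h5
  rw [← Finset.prod_pow_eq_pow_sum]
  refine Associated.prod _ _ _ fun H hH => ?_
  rw [map_pow, res_linForm]
  rw [Finset.mem_filter] at hH
  have hker : LinearMap.ker (formOf H ∘ₗ j) = Y := by
    rw [ker_comp, ker_formOf (M.isCoatom H hH.1), hH.2]
  refine Associated.pow_pow (associated_linForm (ne_zero_of_ker_eq hY hker) ?_)
  rw [hβ, ker_formOf hY, hker]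

end

/-! ### Simple arrangements, their deletions and their traces -/

section

variable {W : Type v} [AddCommGroup W] [Module K W]

/-! ### Simple arrangements as multiarrangements -/

open Classical in
theorem Arrangement.withMult_mult (A : Arrangement K V) (m : Submodule K V → ℕ)
    (H : Submodule K V) : (A.withMult m).mult H = if H ∈ A.hyperplanes then m H else 0 := by
  simp [withMult, Finsupp.ofSupportFinite, Set.indicator_apply]

open Classical in
theorem Arrangement.toMulti_mult (A : Arrangement K V) (H : Submodule K V) :
    A.toMulti.mult H = if H ∈ A.hyperplanes then 1 else 0 := A.withMult_mult _ _

theorem Arrangement.toMulti_hyperplanes (A : Arrangement K V) :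
    A.toMulti.hyperplanes = A.hyperplanes := by
  ext H
  rw [MultiArrangement.mem_hyperplanes, toMulti_mult]
  split_ifs with h <;> simp [h]

theorem Arrangement.mem_support (A : Arrangement K V) {H : Submodule K V} :
    H ∈ A.toMulti.mult.support ↔ H ∈ A.hyperplanes := by
  rw [← A.toMulti_hyperplanes]
  rfl

theorem MultiArrangement.deletion_mult (M : MultiArrangement K V) (H : Submodule K V) :
    (M.deletion H).mult = M.mult - Finsupp.single H 1 := rfl

theorem MultiArrangement.deletion_mult_self (M : MultiArrangement K V) (H : Submodule K V) :
    (M.deletion H).mult H = M.mult H - 1 := by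
  simp [deletion_mult]

theorem MultiArrangement.deletion_mult_of_ne (M : MultiArrangement K V) {H H' : Submodule K V}
    (h : H' ≠ H) : (M.deletion H).mult H' = M.mult H' := by
  simp [deletion_mult, h.symm]

theorem MultiArrangement.deletion_add (M : MultiArrangement K V) {H : Submodule K V}
    (h : H ∈ M.hyperplanes) : (M.deletion H).mult + Finsupp.single H 1 = M.mult := by
  have h1 := mem_hyperplanes.1 h
  ext H'
  by_cases hH : H' = H
  · subst hH
    rw [Finsupp.add_apply, deletion_mult_self, Finsupp.single_eq_same]
    omega
  · rw [Finsupp.add_apply, deletion_mult_of_ne _ hH, Finsupp.single_eq_of_ne hH, add_zero]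

theorem Arrangement.toMulti_deletion (A : Arrangement K V) (H : Submodule K V) :
    (A.deletion H).toMulti = A.toMulti.deletion H := by
  ext H'
  by_cases hH : H' = H
  · subst hH
    rw [MultiArrangement.deletion_mult_self, toMulti_mult, toMulti_mult, if_neg (by simp [deletion])]
    split_ifs <;> rfl
  · rw [MultiArrangement.deletion_mult_of_ne _ hH, toMulti_mult, toMulti_mult]
    have : H' ∈ (A.deletion H).hyperplanes ↔ H' ∈ A.hyperplanes := by
      change H' ∈ A.hyperplanes \ {H} ↔ _
      rw [Set.mem_sdiff, Set.mem_singleton_iff]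
      exact and_iff_left hH
    by_cases h : H' ∈ A.hyperplanes
    · rw [if_pos h, if_pos (this.2 h)]
    · rw [if_neg h, if_neg (mt this.1 h)]

theorem MultiArrangement.defPoly_eq_mul (M : MultiArrangement K V) {H : Submodule K V}
    (h : H ∈ M.hyperplanes) : M.defPoly = (M.deletion H).defPoly * linForm (formOf H) := by
  rw [defPoly, ← M.deletion_add h, powProd_add, powProd_single, pow_one]
  rfl

theorem MultiArrangement.pull_deletion (M : MultiArrangement K V) {H : Submodule K V}
    (h : H ∈ M.hyperplanes) {j : W →ₗ[K] V} (hj : H.comap j ≠ ⊤) :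
    (M.deletion H).pull j = (M.pull j).deletion (H.comap j) := by
  ext1
  have h1 : pullMult M.mult j =
      pullMult (M.deletion H).mult j + Finsupp.single (H.comap j) 1 := by
    rw [← pullMult_single hj, ← pullMult_add, M.deletion_add h]
  change pullMult (M.deletion H).mult j = pullMult M.mult j - _
  rw [h1, add_tsub_cancel_right]

theorem MultiArrangement.pull_deletion_of_eq_top (M : MultiArrangement K V) {H : Submodule K V}
    (h : H ∈ M.hyperplanes) {j : W →ₗ[K] V} (hj : H.comap j = ⊤) :
    (M.deletion H).pull j = M.pull j := by
  ext1
  change pullMult (M.deletion H).mult j = pullMult M.mult j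
  rw [← M.deletion_add h, pullMult_add, pullMult_single_of_eq_top hj, add_zero]

theorem MultiArrangement.isEmpty_pull {M : MultiArrangement K V} {j : W →ₗ[K] V}
    (h : ∀ H ∈ M.hyperplanes, H.comap j = ⊤) : M.pull j = MultiArrangement.empty K W := by
  ext Y
  by_contra hne
  obtain ⟨h1, H, hH, h2⟩ := mem_pull_hyperplanes.1 (mem_hyperplanes.2 hne)
  exact h1 (h2 ▸ h H hH)

theorem comap_eq_top_iff {j : W →ₗ[K] V} {H H₀ : Submodule K V} (hH : IsCoatom H)
    (hH₀ : IsCoatom H₀) (hr : LinearMap.range j = H₀) : H.comap j = ⊤ ↔ H = H₀ := by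
  rw [← top_le_iff, ← Submodule.map_le_iff_le_comap, Submodule.map_top, hr]
  constructor
  · intro h
    exact (hH₀.le_iff.1 h).resolve_left hH.1
  · rintro rfl
    exact le_rfl

/-- A hyperplane of A contains Y exactly if it is `H₀` or has trace Y on `H₀`; the `- 1` in κ
discards `H₀`. -/
theorem Arrangement.zieglerRestriction_eq_pull (A : Arrangement K V) (H₀ : Submodule K V)
    (h₀ : H₀ ∈ A.hyperplanes) : A.zieglerRestriction H₀ h₀ = A.toMulti.pull H₀.subtype := by
  classical
  have hc := A.isCoatom _ h₀
  have htop : ∀ H ∈ A.hyperplanes, H.comap H₀.subtype = ⊤ ↔ H = H₀ := fun H hH =>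
    comap_eq_top_iff (A.isCoatom _ hH) hc (by simp)
  ext Y
  rw [zieglerRestriction, withMult_mult]
  split_ifs with hY
  · obtain ⟨H₁, ⟨h1, h2⟩, rfl⟩ := hY
    have h2' : H₁ ≠ H₀ := h2
    have hne : H₁.comap H₀.subtype ≠ ⊤ := fun h => h2' ((htop H₁ h1).1 h)
    have hcY := (Submodule.isCoatom_comap_or_eq_top H₀.subtype (A.isCoatom _ h1)).resolve_right hne
    change _ = pullMult A.toMulti.mult _ _
    rw [pullMult_apply _ _ hne]
    have hset : A.localizationSet ((H₁.comap H₀.subtype).map H₀.subtype) =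
        insert H₀ (A.toMulti.mult.support.filter fun H =>
          H.comap H₀.subtype = H₁.comap H₀.subtype : Finset (Submodule K V)) := by
      ext H
      rw [Finset.mem_coe, Finset.mem_insert, Finset.mem_filter, A.mem_support]
      change _ ∧ _ ↔ _
      rw [Submodule.map_le_iff_le_comap]
      constructor
      · rintro ⟨hH, hle⟩
        rcases hcY.le_iff.1 hle with h | h
        · exact Or.inl ((htop H hH).1 h)
        · exact Or.inr ⟨hH, h⟩
      · rintro (rfl | ⟨hH, h⟩)
        · exact ⟨h₀, by simp⟩
        · exact ⟨hH, h.ge⟩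
    rw [hset, Set.ncard_coe_finset, Finset.card_insert_of_notMem,
      Nat.add_sub_cancel, Finset.card_eq_sum_ones]
    · refine Finset.sum_congr rfl fun H hH => ?_
      rw [toMulti_mult, if_pos (A.mem_support.1 (Finset.mem_filter.1 hH).1)]
    · rw [Finset.mem_filter, not_and]
      intro _ h
      exact hne (h ▸ (htop H₀ h₀).2 rfl)
  · by_contra hne
    obtain ⟨h1, H, hH, h2⟩ := MultiArrangement.mem_pull_hyperplanes.1
      (MultiArrangement.mem_hyperplanes.2 (Ne.symm hne))
    rw [A.toMulti_hyperplanes] at hH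
    refine hY ⟨H, ⟨hH, ?_⟩, h2⟩
    rintro (rfl : H = H₀)
    exact h1 (h2 ▸ (htop H h₀).2 rfl)

/-- The linear map `j` between the hyperplanes `j⁻¹(H)` and `H`. -/
def hyperplaneMap (j : W →ₗ[K] V) (H : Submodule K V) : H.comap j →ₗ[K] H :=
  j.restrict (p := H.comap j) (q := H) fun _ h => h

theorem hyperplaneMap_injective {j : W →ₗ[K] V} (hj : Function.Injective j) (H : Submodule K V) :
    Function.Injective (hyperplaneMap j H) := fun _ _ h =>
  Subtype.ext (hj (congrArg Subtype.val h))

theorem range_hyperplaneMap (j : W →ₗ[K] V) (H : Submodule K V) :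
    LinearMap.range (hyperplaneMap j H) = (LinearMap.range j).comap H.subtype := by
  ext ⟨v, hv⟩
  simp only [LinearMap.mem_range, Submodule.mem_comap, Submodule.subtype_apply]
  constructor
  · rintro ⟨w, hw⟩
    exact ⟨w, congrArg Subtype.val hw⟩
  · rintro ⟨w, rfl⟩
    exact ⟨⟨w, hv⟩, rfl⟩

/-- Both sides consist of the proper traces of the hyperplanes of A on the preimage of H. -/
theorem Arrangement.restrictSet_pull (A : Arrangement K V) {H : Submodule K V}
    (h : H ∈ A.hyperplanes) {j : W →ₗ[K] V} (hj : H.comap j ≠ ⊤) :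
    restrictSet (A.toMulti.pull j).hyperplanes (H.comap j) =
      ((A.restriction H h).toMulti.pull (hyperplaneMap j H)).hyperplanes := by
  have hL := (Submodule.isCoatom_comap_or_eq_top j (A.isCoatom _ h)).resolve_right hj
  ext X
  rw [MultiArrangement.mem_pull_hyperplanes, toMulti_hyperplanes]
  constructor
  · rintro ⟨Y, ⟨hY, hne⟩, rfl⟩
    have hYc := (A.toMulti.pull j).isCoatom' (MultiArrangement.mem_hyperplanes.1 hY)
    obtain ⟨h1, H', hH', rfl⟩ := MultiArrangement.mem_pull_hyperplanes.1 hY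
    rw [toMulti_hyperplanes] at hH'
    refine ⟨(isCoatom_comap_subtype hL hYc hne).1, H'.comap H.subtype, ⟨H', ⟨hH', ?_⟩, rfl⟩, rfl⟩
    rintro (rfl : H' = H)
    exact hne rfl
  · rintro ⟨hX, _, ⟨H', ⟨hH', hne⟩, rfl⟩, rfl⟩
    have hX' : (H'.comap j).comap (H.comap j).subtype ≠ ⊤ := hX
    refine ⟨H'.comap j, ⟨MultiArrangement.mem_pull_hyperplanes.2 ⟨?_, H', ?_, rfl⟩, ?_⟩, rfl⟩
    · intro ht
      rw [ht] at hX'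
      simp at hX'
    · rwa [toMulti_hyperplanes]
    · intro ht
      have ht' : H'.comap j = H.comap j := ht
      rw [ht'] at hX'
      simp at hX'

/-- Derivations in `D(A)` restrict to the simple restriction. -/
theorem mem_derModule_restriction {A : Arrangement K V} {H : Submodule K V}
    (h : H ∈ A.hyperplanes) {θ : Der K V} {θ' : Der K H} (hr : RestrictsTo H.subtype θ θ')
    (hθ : θ ∈ derModule A.toMulti) : θ' ∈ derModule (A.restriction H h).toMulti := by
  intro Y hY β hβ
  have hY1 := hY
  rw [Arrangement.toMulti_hyperplanes] at hY
  have hYc := (A.restriction H h).isCoatom Y hY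
  rw [Arrangement.toMulti_mult, if_pos hY, pow_one]
  obtain ⟨H', ⟨hH', hne⟩, rfl⟩ := hY
  have hc := A.isCoatom _ hH'
  have h1 := dvd_of_mem_derModule hθ hc (ker_formOf hc)
  rw [Arrangement.toMulti_mult, if_pos hH', pow_one] at h1
  have h2 := map_dvd (res H.subtype) h1
  rw [res_linForm, ← hr] at h2
  obtain ⟨c, hc0, hc1⟩ := exists_eq_smul_of_ker_eq (α := formOf H' ∘ₗ H.subtype) (β := β)
    (ne_zero_of_ker_eq hYc hβ) (by rw [ker_comp, ker_formOf hc]; exact hβ.symm)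
  rw [hc1, der_smul_linForm, linForm_smul]
  exact mul_dvd_mul_left _ h2

/-- Multiplying a derivation by an equation of `H` raises the multiplicity of `H`. -/
theorem smul_mem_derModule {M : MultiArrangement K V} {H : Submodule K V}
    {α : Dual K V} (hα : LinearMap.ker α = H) {η : Der K V}
    (hη : η ∈ derModule (M.deletion H)) : linForm α • η ∈ derModule M := by
  rw [mem_derModule_iff] at hη ⊢
  intro H' hH'
  rw [Derivation.smul_apply, smul_eq_mul]
  by_cases h : H' = H
  · subst h
    have h1 := hη H' hH'
    rw [MultiArrangement.deletion_mult_self] at h1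
    have h2 := (associated_linForm (ne_zero_of_ker_eq hH' hα)
      ((ker_formOf hH').trans hα.symm)).dvd
    refine (pow_dvd_pow _ (show M.mult H' ≤ 1 + (M.mult H' - 1) by omega)).trans ?_
    rw [pow_add, pow_one]
    exact mul_dvd_mul h2 h1
  · have h1 := hη H' hH'
    rw [MultiArrangement.deletion_mult_of_ne _ h] at h1
    exact h1.mul_left _

theorem mem_derModule_of_smul_mem {M : MultiArrangement K V} {H : Submodule K V}
    (hH : IsCoatom H) {α : Dual K V} (hα : LinearMap.ker α = H) {η : Der K V}
    (hη : linForm α • η ∈ derModule M) : η ∈ derModule (M.deletion H) := by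
  have hp := prime_linForm (ne_zero_of_ker_eq hH hα)
  rw [mem_derModule_iff] at hη ⊢
  intro H' hH'
  have h1 := hη H' hH'
  rw [Derivation.smul_apply, smul_eq_mul] at h1
  by_cases h : H' = H
  · subst h
    rw [MultiArrangement.deletion_mult_self]
    by_cases h0 : M.mult H' = 0
    · simp [h0]
    have h2 := (associated_linForm (formOf_ne_zero hH')
      (hα.trans (ker_formOf hH').symm)).dvd
    have h3 : linForm (formOf H') ^ (M.mult H' - 1) * linForm (formOf H') ∣
        η (linForm (formOf H')) * linForm (formOf H') := by
      rw [← pow_succ, Nat.sub_add_cancel (Nat.pos_of_ne_zero h0)]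
      exact h1.trans ((mul_dvd_mul_right h2 _).trans (mul_comm _ _).dvd)
    exact (mul_dvd_mul_iff_right (prime_formOf hH').ne_zero).1 h3
  · rw [MultiArrangement.deletion_mult_of_ne _ h]
    refine (prime_formOf hH').pow_dvd_of_dvd_mul_left _ ?_ h1
    rw [linForm_dvd_iff_of_ker hH' hH (ker_formOf hH') hα]
    exact h

/-- A derivation in `D(M')` lies in `D(M)` if it satisfies the condition at `H`. -/
theorem mem_derModule_of_deletion {M : MultiArrangement K V} {H : Submodule K V}
    (hH : IsCoatom H) {α : Dual K V} (hα : LinearMap.ker α = H) {η : Der K V}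
    (hη : η ∈ derModule (M.deletion H)) (h : linForm α ^ M.mult H ∣ η (linForm α)) :
    η ∈ derModule M := by
  rw [mem_derModule_iff] at hη ⊢
  intro H' hH'
  by_cases hne : H' = H
  · subst hne
    obtain ⟨c, hc0, hc⟩ := exists_eq_smul_of_ker_eq (formOf_ne_zero hH)
      (hα.trans (ker_formOf hH).symm)
    rw [hc, der_smul_linForm, linForm_smul, mul_pow, ← map_pow,
      (isUnit_algebraMap (V := V) (pow_ne_zero _ hc0)).mul_left_dvd]
    exact h.mul_left _
  · have h1 := hη H' hH'
    rwa [MultiArrangement.deletion_mult_of_ne _ hne] at h1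

theorem derModule_le_deletion (M : MultiArrangement K V) (H : Submodule K V) :
    derModule M ≤ derModule (M.deletion H) := by
  refine derModule_anti fun H' => ?_
  by_cases h : H' = H
  · subst h
    rw [MultiArrangement.deletion_mult_self]
    omega
  · rw [MultiArrangement.deletion_mult_of_ne _ h]

theorem euler_mem_derModule (A : Arrangement K V) : euler K V ∈ derModule A.toMulti := by
  rw [mem_derModule_iff]
  intro H hH
  rw [euler_linForm, Arrangement.toMulti_mult]
  split_ifs <;> simp

end

/-! ### Row operations and adapted bases in the plane -/

section

variable {W : Type v} [AddCommGroup W] [Module K W]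

/-! ### Changing bases of `D(M)` -/

/-- Adding multiples of one row to the others preserves the determinant, so Saito's criterion
applies to the new family. -/
theorem IsDerBasis.add_smul {n : ℕ} (x : Basis (Fin n) K (Dual K V)) {M : MultiArrangement K V}
    {θ θ' : Fin n → Der K V} (h : IsDerBasis M θ) (k : Fin n) (c : Fin n → CoordRing K V)
    (hk : c k = 0) (hθ' : ∀ i, θ' i = θ i + c i • θ k) : IsDerBasis M θ' := by
  refine isDerBasis_of_det x (fun i => ?_) ?_
  · rw [hθ']
    exact Submodule.add_mem _ (h.mem i) (Submodule.smul_mem _ _ (h.mem k))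
  · have : (coeffMatrix x θ').det = (coeffMatrix x θ).det :=
      Matrix.det_eq_of_forall_row_eq_smul_add_const c k hk fun i j => by simp [hθ']
    rw [this]
    exact h.det_associated x

theorem IsDerBasis.comp_equiv {ι ι' : Type*} {M : MultiArrangement K V} {θ : ι → Der K V}
    (h : IsDerBasis M θ) (σ : ι' ≃ ι) : IsDerBasis M (θ ∘ σ) :=
  ⟨fun i => h.mem _, h.li.comp σ σ.injective, by rw [σ.surjective.range_comp]; exact h.span⟩

theorem IsDerBasis.update_of_isUnit {n : ℕ} (x : Basis (Fin n) K (Dual K V))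
    {M : MultiArrangement K V} {θ : Fin n → Der K V} (h : IsDerBasis M θ) (k : Fin n)
    (c : Fin n → CoordRing K V) (hk : IsUnit (c k)) :
    IsDerBasis M (Function.update θ k (∑ i, c i • θ i)) := by
  refine isDerBasis_of_det x (fun i => ?_) ?_
  · by_cases hi : i = k
    · subst hi
      rw [Function.update_self]
      exact Submodule.sum_mem _ fun i _ => Submodule.smul_mem _ _ (h.mem i)
    · rw [Function.update_of_ne hi]
      exact h.mem i
  · have : coeffMatrix x (Function.update θ k (∑ i, c i • θ i)) =
        (coeffMatrix x θ).updateRow k (∑ i, c i • coeffMatrix x θ i) := by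
      ext a b
      by_cases ha : a = k
      · subst ha
        simp [der_sum_apply]
      · simp [ha]
    rw [this, Matrix.det_updateRow_sum, smul_eq_mul]
    exact (associated_unit_mul_left _ _ hk).trans (h.det_associated x)

theorem det_coeffMatrix_smul_cons {n : ℕ} (x : Fin (n + 1) → Dual K V) (f : CoordRing K V)
    (η : Der K V) (θ : Fin n → Der K V) :
    (coeffMatrix x (Fin.cons (f • η) θ)).det = f * (coeffMatrix x (Fin.cons η θ)).det := by
  have : coeffMatrix x (Fin.cons (f • η) θ) =
      (coeffMatrix x (Fin.cons η θ)).updateRow 0 (f • coeffMatrix x (Fin.cons η θ) 0) := by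
    ext a b
    refine Fin.cases ?_ (fun a => ?_) a
    · simp
    · simp [Matrix.updateRow_ne]
  rw [this, Matrix.det_updateRow_smul, Matrix.updateRow_eq_self]

/-- Given a basis `η, θ₁, …` of `D(M')` with `θᵢ ∈ D(M)`, the family `α η, θ₁, …` is a basis of
`D(M)`. -/
theorem IsDerBasis.smul_cons {n : ℕ} (x : Basis (Fin (n + 1)) K (Dual K V))
    {M : MultiArrangement K V} {H : Submodule K V} (hH : H ∈ M.hyperplanes) {α : Dual K V}
    (hα : LinearMap.ker α = H) {θ : Fin n → Der K V} {η : Der K V}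
    (h : IsDerBasis (M.deletion H) (Fin.cons η θ)) (hθ : ∀ i, θ i ∈ derModule M) :
    IsDerBasis M (Fin.cons (linForm α • η) θ) := by
  have hc := M.isCoatom H hH
  have hη : η ∈ derModule (M.deletion H) := h.mem 0
  refine isDerBasis_of_det x (fun i => ?_) ?_
  · refine Fin.cases ?_ (fun i => ?_) i
    · exact smul_mem_derModule hα hη
    · exact hθ i
  · rw [det_coeffMatrix_smul_cons, M.defPoly_eq_mul hH, mul_comm]
    exact (h.det_associated x).mul_mul (associated_linForm (formOf_ne_zero hc)
      (hα.trans (ker_formOf hc).symm))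

/-- A homogeneous basis has degrees summing up to the total multiplicity. -/
theorem IsDerBasis.sum_degree {n : ℕ} (x : Basis (Fin n) K (Dual K V))
    {M : MultiArrangement K V} {θ : Fin n → Der K V} (h : IsDerBasis M θ) {d : Fin n → ℕ}
    (hd : ∀ i, HasPDeg (θ i) (d i)) : ∑ i, d i = M.mult.sum fun _ k => k := by
  have h1 := h.det_associated x
  have h0 : (coeffMatrix x θ).det ≠ 0 := h1.ne_zero_iff.2 (powProd_ne_zero M.isCoatom)
  refine degree_eq_of_associated h1 h0 ?_ (powProd_mem _)
  rw [Matrix.det_apply]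
  refine Submodule.sum_mem _ fun σ _ => ?_
  have := prod_mem_homogeneousPart Finset.univ (fun i => coeffMatrix x θ (σ i) i)
    (fun i => d (σ i)) fun i _ => hd (σ i) _
  rw [Equiv.sum_comp σ d] at this
  rcases Int.units_eq_one_or (Equiv.Perm.sign σ) with hs | hs
  · rw [hs, one_smul]
    exact this
  · rw [hs, Units.neg_smul, one_smul]
    exact Submodule.neg_mem _ this

/-! ### Multiarrangements in a plane -/

theorem eq_of_mem_homogeneousPart_line {t : Dual K V} (ht : ∀ γ : Dual K V, ∃ c : K, γ = c • t)
    {p : ℕ} {f : CoordRing K V} (hf : f ∈ homogeneousPart K V p) :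
    ∃ c : K, f = algebraMap K _ c * linForm t ^ p := by
  have h1 : LinearMap.range (SymmetricAlgebra.ι K (Dual K V)) ≤
      Submodule.span K {linForm t} := by
    rintro _ ⟨γ, rfl⟩
    obtain ⟨c, rfl⟩ := ht γ
    rw [map_smul]
    exact Submodule.smul_mem _ _ (Submodule.mem_span_singleton_self _)
  have h2 := pow_le_pow_left' h1 p hf
  rw [Submodule.span_pow, Set.singleton_pow, Submodule.mem_span_singleton] at h2
  obtain ⟨c, rfl⟩ := h2
  exact ⟨c, Algebra.smul_def _ _⟩

theorem degree_of_pow_mul_mem {f g : CoordRing K V} {a p : ℕ} (hf : f ∈ homogeneousPart K V a)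
    (h : f * g ∈ homogeneousPart K V p) (h0 : f * g ≠ 0) :
    ∃ s, p = a + s ∧ g ∈ homogeneousPart K V s := by
  rcases lt_or_ge p a with hlt | hle
  · exact absurd (eq_zero_of_mul_mem_of_lt hlt hf h) h0
  · obtain ⟨s, rfl⟩ := Nat.exists_eq_add_of_le hle
    exact ⟨s, rfl, mem_of_mul_mem hf (left_ne_zero_of_mul h0) h⟩

theorem exists_plane_line (x : Basis (Fin 2) K (Dual K V)) {α : Dual K V} (hα : α ≠ 0) :
    ∃ (y : Basis (Fin 2) K (Dual K V)), y 0 = α ∧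
      ∀ γ : Dual K (LinearMap.ker α), ∃ c : K, γ = c • (y 1 ∘ₗ (LinearMap.ker α).subtype) := by
  obtain ⟨u⟩ := exists_basis_dual_ker x hα
  obtain ⟨y, hy0, hy⟩ := exists_basis_cons (Submodule.injective_subtype _) hα (by simp) u
  refine ⟨y, hy0, fun γ => ⟨u.repr γ 0, ?_⟩⟩
  have h1 := hy 0
  rw [Fin.succ_zero_eq_one] at h1
  rw [h1]
  conv_lhs => rw [← u.sum_repr γ]
  simp

/-- D(M) and D(M') differ by a single factor α in η(α), so the restriction of g to H is the whole
obstruction. -/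
theorem mem_derModule_iff_dvd {M : MultiArrangement K V} {H : Submodule K V}
    (hH : H ∈ M.hyperplanes) {α : Dual K V} (hα : LinearMap.ker α = H) {η : Der K V}
    (hη : η ∈ derModule (M.deletion H)) {g : CoordRing K V}
    (hg : η (linForm α) = linForm α ^ (M.mult H - 1) * g) :
    η ∈ derModule M ↔ linForm α ∣ g := by
  have hc := M.isCoatom H hH
  have h0 := MultiArrangement.mem_hyperplanes.1 hH
  have hp := prime_linForm (ne_zero_of_ker_eq hc hα)
  have hpow : linForm α ^ M.mult H = linForm α ^ (M.mult H - 1) * linForm α := by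
    rw [← pow_succ, Nat.sub_add_cancel (Nat.pos_of_ne_zero h0)]
  constructor
  · intro h
    have h1 := dvd_of_mem_derModule h hc hα
    rwa [hg, hpow, mul_dvd_mul_iff_left (pow_ne_zero _ hp.ne_zero)] at h1
  · intro h
    refine mem_derModule_of_deletion hc hα hη ?_
    rw [hg, hpow]
    exact mul_dvd_mul_left _ h

theorem exists_eq_pow_mul {M : MultiArrangement K V} {H : Submodule K V}
    (hH : H ∈ M.hyperplanes) {α : Dual K V} (hα : LinearMap.ker α = H) {η : Der K V}
    (hη : η ∈ derModule (M.deletion H)) :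
    ∃ g, η (linForm α) = linForm α ^ (M.mult H - 1) * g := by
  have h1 := dvd_of_mem_derModule hη (M.isCoatom H hH) hα
  rwa [MultiArrangement.deletion_mult_self] at h1

/-- In a plane, a homogeneous basis of `D(M')` can be adapted to `D(M)`. -/
theorem exists_adapted_basis_plane (x : Basis (Fin 2) K (Dual K V)) {M : MultiArrangement K V}
    {H : Submodule K V} (hH : H ∈ M.hyperplanes)
    {θ : Fin 2 → Der K V} {p : Fin 2 → ℕ} (hb : IsDerBasis (M.deletion H) θ)
    (hp : ∀ i, HasPDeg (θ i) (p i)) :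
    ∃ (η : Der K V) (ξ : Fin 1 → Der K V) (a b : ℕ), HasPDeg η a ∧ HasPDeg (ξ 0) b ∧
      (∀ i, ξ i ∈ derModule M) ∧ IsDerBasis (M.deletion H) (Fin.cons η ξ : Fin 2 → Der K V) := by
  have hc := M.isCoatom H hH
  obtain ⟨α, hα⟩ := exists_ker_eq hc
  have hα0 := ne_zero_of_ker_eq hc hα
  subst hα
  obtain ⟨y, rfl, ht⟩ := exists_plane_line x hα0
  let j := (LinearMap.ker (y 0)).subtype
  have hj : Function.Injective j := Submodule.injective_subtype _
  have hres := res_eq_zero_iff hj hα0 (by simp [j])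
  choose g hg using fun k => exists_eq_pow_mul hH rfl (hb.mem k)
  have hmem := fun k => mem_derModule_iff_dvd hH rfl (hb.mem k) (hg k)
  -- the swapped form of the basis
  have hcons : ∀ f : Fin 2 → Der K V, f = Fin.cons (f 0) fun _ : Fin 1 => f 1 := by
    intro f
    funext i
    fin_cases i <;> rfl
  have hb' : IsDerBasis (M.deletion (LinearMap.ker (y 0))) (θ ∘ Equiv.swap 0 1) :=
    hb.comp_equiv _
  -- If g k vanishes on H, then θ k already lies in D(M) and only the order of the basis matters.
  by_cases h0 : res j (g 0) = 0
  · refine ⟨θ 1, fun _ => θ 0, p 1, p 0, hp 1, hp 0, fun _ => (hmem 0).2 ((hres _).1 h0), ?_⟩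
    rw [hcons (θ ∘ Equiv.swap 0 1)] at hb'
    simpa using hb'
  by_cases h1 : res j (g 1) = 0
  · refine ⟨θ 0, fun _ => θ 1, p 0, p 1, hp 0, hp 1, fun _ => (hmem 1).2 ((hres _).1 h1), ?_⟩
    rwa [hcons θ] at hb
  have hgne : ∀ k, res j (g k) ≠ 0 := fun k => by fin_cases k; exacts [h0, h1]
  have hdeg : ∀ k, ∃ s, p k = (M.mult (LinearMap.ker (y 0)) - 1) + s ∧ g k ∈ homogeneousPart K V s := by
    intro k
    have hk := hp k (y 0)
    rw [hg k] at hk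
    refine degree_of_pow_mul_mem (linForm_pow_mem _ _) hk
      (mul_ne_zero (pow_ne_zero _ (linForm_ne_zero hα0)) ?_)
    intro hz
    exact hgne k (by rw [hz]; exact map_zero (res j))
  choose s hs hgs using hdeg
  choose c hcs using fun k => eq_of_mem_homogeneousPart_line ht (res_mem j (hgs k))
  have hc0 : ∀ k, c k ≠ 0 := by
    intro k hk
    apply hgne k
    rw [hcs k, hk, RingHom.map_zero, zero_mul]
  -- On the line H the obstructions are now nonzero monomials of degrees s 0 and s 1. The one of
  -- larger degree is cancelled by a multiple of the other; as p l - p k = s l - s k, homogeneity is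
  -- kept.
  have key : ∀ k l : Fin 2, k ≠ l → s k ≤ s l →
      IsDerBasis (M.deletion (LinearMap.ker (y 0))) (Fin.cons (θ k) fun _ : Fin 1 => θ l) →
      ∃ (η : Der K V) (ξ : Fin 1 → Der K V) (a b : ℕ), HasPDeg η a ∧ HasPDeg (ξ 0) b ∧
      (∀ i, ξ i ∈ derModule M) ∧ IsDerBasis (M.deletion (LinearMap.ker (y 0)))
        (Fin.cons η ξ : Fin 2 → Der K V) := by
    intro k l hkl hle hbas
    let f : CoordRing K V := algebraMap K _ (-(c l * (c k)⁻¹)) * linForm (y 1) ^ (s l - s k)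
    have hf : f ∈ homogeneousPart K V (s l - s k) := by
      have := mul_mem_homogeneousPart (mem_homogeneousPart_zero_iff.2
        ⟨-(c l * (c k)⁻¹), rfl⟩) (linForm_pow_mem (y 1) (s l - s k))
      rwa [zero_add] at this
    have hnew : θ l + f • θ k ∈ derModule (M.deletion (LinearMap.ker (y 0))) :=
      Submodule.add_mem _ (hb.mem l) (Submodule.smul_mem _ _ (hb.mem k))
    refine ⟨θ k, fun _ => θ l + f • θ k, p k, p l, hp k, ?_, fun _ => ?_, ?_⟩
    · intro β
      have h2 := (hp k).smul hf β
      rw [show s l - s k + p k = p l by rw [hs k, hs l]; omega] at h2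
      exact Submodule.add_mem _ (hp l β) h2
    · rw [mem_derModule_iff_dvd (g := g l + f * g k) hH rfl hnew, ← hres, map_add, map_mul,
        hcs l, hcs k]
      · simp only [f, map_mul, map_pow, res_linForm, AlgHom.commutes]
        have h3 : linForm (y 1 ∘ₗ j) ^ (s l - s k) * linForm (y 1 ∘ₗ j) ^ s k =
            linForm (y 1 ∘ₗ j) ^ s l := by
          rw [← pow_add, Nat.sub_add_cancel hle]
        have h4 : algebraMap K (CoordRing K (LinearMap.ker (y 0))) (c l) +
            algebraMap K _ (-(c l * (c k)⁻¹)) * algebraMap K _ (c k) = 0 := by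
          rw [← map_mul, ← map_add, neg_mul, inv_mul_cancel_right₀ (hc0 k), add_neg_cancel,
            RingHom.map_zero]
        calc _ = (algebraMap K (CoordRing K (LinearMap.ker (y 0))) (c l) +
            algebraMap K _ (-(c l * (c k)⁻¹)) * algebraMap K _ (c k)) *
              linForm (y 1 ∘ₗ j) ^ s l := by
                rw [← h3]
                ring
          _ = 0 := by rw [h4, zero_mul]
      · rw [Derivation.add_apply, Derivation.smul_apply, hg l, hg k, smul_eq_mul]
        ring
    · refine hbas.add_smul y 0 (Fin.cons 0 fun _ => f) rfl fun i => ?_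
      fin_cases i <;> simp
  rcases le_total (s 0) (s 1) with h | h
  · refine key 0 1 (by simp) h ?_
    rwa [hcons θ] at hb
  · refine key 1 0 (by simp) h ?_
    rw [hcons (θ ∘ Equiv.swap 0 1)] at hb'
    simpa using hb'

end

/-! ### Freeness and the Euler multiplicity in the plane -/

section

variable {W : Type v} [AddCommGroup W] [Module K W]

theorem isDerBasis_coordDer {n : ℕ} (x : Basis (Fin n) K (Dual K V)) {M : MultiArrangement K V}
    (h : M.mult = 0) : IsDerBasis M (coordDer x) := by
  refine isDerBasis_of_det x (fun i => ?_) ?_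
  · rw [mem_derModule_iff]
    intro H _
    simp [h]
  · have : coeffMatrix x (coordDer x) = 1 := by
      ext i j
      rw [coeffMatrix_apply, coordDer_linForm, Matrix.one_apply]
    rw [this, Matrix.det_one, MultiArrangement.defPoly, h]
    simp [powProd]

/-- Induction on the total multiplicity: an adapted basis η, ξ of D(M') yields the basis α η, ξ of
D(M). -/
theorem exists_isDerBasis_plane (x : Basis (Fin 2) K (Dual K V)) (M : MultiArrangement K V) :
    ∃ (θ : Fin 2 → Der K V) (p : Fin 2 → ℕ), IsDerBasis M θ ∧ ∀ i, HasPDeg (θ i) (p i) := by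
  induction hN : M.mult.sum (fun _ k => k) using Nat.strong_induction_on generalizing M with
  | _ N ih =>
    by_cases h0 : M.mult = 0
    · exact ⟨coordDer x, fun _ => 0, isDerBasis_coordDer x h0, coordDer_mem x⟩
    · obtain ⟨H, hH⟩ := Finsupp.ne_iff.1 h0
      have hH' : H ∈ M.hyperplanes := MultiArrangement.mem_hyperplanes.2 hH
      obtain ⟨θ, p, hb, hp⟩ := ih ((M.deletion H).mult.sum fun _ k => k) (by
        rw [← hN, ← M.deletion_add hH', Finsupp.sum_add_index' (by simp) (by simp),
          Finsupp.sum_single_index rfl]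
        exact Nat.lt_succ_self _) (M.deletion H) rfl
      obtain ⟨η, ξ, a, b, ha, hb', hξ, hbas⟩ := exists_adapted_basis_plane x hH' hb hp
      obtain ⟨α, hα⟩ := exists_ker_eq (M.isCoatom' hH)
      refine ⟨_, Fin.cons (1 + a) fun _ => b, hbas.smul_cons x hH' hα hξ, fun i => ?_⟩
      fin_cases i
      · exact ha.smul (linForm_mem α)
      · exact hb'

/-- The Euler multiplicity of a plane multiarrangement at the line `H`, together with its
characterization modulo an equation `α` of `H`. -/
theorem exists_euler_basis_plane (x : Basis (Fin 2) K (Dual K V)) {M : MultiArrangement K V}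
    {H : Submodule K V} (hH : H ∈ M.hyperplanes) {α : Dual K V} (hα : LinearMap.ker α = H) :
    ∃ (η : Der K V) (ξ : Fin 1 → Der K V) (d s : ℕ), HasPDeg (ξ 0) d ∧
      HasPDeg η (M.mult H - 1 + s) ∧ (∀ i, ξ i ∈ derModule M) ∧
      IsDerBasis (M.deletion H) (Fin.cons η ξ : Fin 2 → Der K V) ∧
      d + s + M.mult H = M.mult.sum (fun _ k => k) ∧
      ∀ y : Dual K V, y ∘ₗ H.subtype ≠ 0 →
        (∃ c : K, c ≠ 0 ∧ linForm α ∣ ξ 0 (linForm y) - algebraMap K _ c * linForm y ^ d) ∧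
        ∃ (c : K) (g : CoordRing K V), c ≠ 0 ∧
          η (linForm α) = linForm α ^ (M.mult H - 1) * g ∧
          linForm α ∣ g - algebraMap K _ c * linForm y ^ s := by
  have hc := M.isCoatom H hH
  have hm0 := MultiArrangement.mem_hyperplanes.1 hH
  subst hα
  have hα0 := ne_zero_of_ker_eq hc rfl
  obtain ⟨θ₀, p₀, hb₀, hp₀⟩ := exists_isDerBasis_plane x (M.deletion (LinearMap.ker α))
  obtain ⟨η, ξ, a, b, ha, hb, hξ, hbas⟩ := exists_adapted_basis_plane x hH hb₀ hp₀
  obtain ⟨x', hx', ht⟩ := exists_plane_line x hα0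
  let j := (LinearMap.ker α).subtype
  have hj : Function.Injective j := Submodule.injective_subtype _
  have hrange : LinearMap.range j = LinearMap.ker α := by simp [j]
  have hres := res_eq_zero_iff hj hα0 hrange
  obtain ⟨g, hg⟩ := exists_eq_pow_mul hH rfl (hbas.mem 0)
  have hξα := fun i => dvd_of_mem_derModule (hξ i) hc rfl
  choose ξ' hξ' using fun i => exists_restrictsTo_of_dvd hj hrange
    ((dvd_pow_self _ hm0).trans (hξα i))
  obtain ⟨D, hD1, hD2⟩ := exists_det_cons (x := x') (y := fun i : Fin 1 => x' i.succ ∘ₗ j)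
    (by rw [hx']; exact comp_eq_zero_of_range hrange) (fun _ => rfl) hξ' (η := η)
    (k := M.mult (LinearMap.ker α) - 1) (g := g) (by rw [hx']; exact hg) (fun i => by
      rw [hx', Nat.sub_add_cancel (Nat.pos_of_ne_zero hm0)]
      exact hξα i)
  have hdet := hbas.det_associated x'
  -- Otherwise α would divide Q(M') more often than its multiplicity there allows. Hence g and the
  -- value of ξ do not vanish on the line H and are nonzero monomials there.
  have hD0 : res j D ≠ 0 := by
    rw [Ne, hres]
    intro hdvd
    have h1 : linForm α ^ (M.mult (LinearMap.ker α) - 1 + 1) ∣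
        (M.deletion (LinearMap.ker α)).defPoly := by
      refine dvd_trans ?_ hdet.dvd
      rw [hD1, hx', pow_succ]
      exact mul_dvd_mul_left _ hdvd
    have h2 := (associated_linForm hα0 (ker_formOf hc)).dvd
    have h3 := le_of_pow_dvd_powProd hc (M.deletion (LinearMap.ker α)).isCoatom
      ((pow_dvd_pow_of_dvd h2 _).trans h1)
    rw [MultiArrangement.deletion_mult_self] at h3
    omega
  rw [hD2, Matrix.det_unique] at hD0
  have hg0 := left_ne_zero_of_mul hD0
  have hξ0 : ξ' 0 (linForm (x' 1 ∘ₗ j)) ≠ 0 := right_ne_zero_of_mul hD0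
  have hgne : g ≠ 0 := fun h => hg0 (by rw [h]; exact map_zero (res j))
  obtain ⟨s, rfl, hgs⟩ : ∃ s, a = (M.mult (LinearMap.ker α) - 1) + s ∧
      g ∈ homogeneousPart K V s := by
    have h1 := ha α
    change η (linForm α) = _ at hg
    rw [hg] at h1
    exact degree_of_pow_mul_mem (linForm_pow_mem _ _) h1
      (mul_ne_zero (pow_ne_zero _ (linForm_ne_zero hα0)) hgne)
  refine ⟨η, ξ, b, s, hb, ha, hξ, hbas, ?_, fun y hy => ⟨?_, ?_⟩⟩
  -- The degrees of the basis α η, ξ of D(M) add up to the total multiplicity.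
  · have h1 := (hbas.smul_cons x hH rfl hξ).sum_degree x
      (d := Fin.cons (1 + (M.mult (LinearMap.ker α) - 1 + s)) fun _ => b) (fun i => by
        fin_cases i
        · exact ha.smul (linForm_mem α)
        · exact hb)
    rw [← h1, Fin.sum_univ_two]
    change _ = 1 + (M.mult (LinearMap.ker α) - 1 + s) + b
    omega
  · obtain ⟨e, he⟩ := ht (y ∘ₗ j)
    have ht' : ∀ γ : Dual K (LinearMap.ker α), ∃ c : K, γ = c • (y ∘ₗ j) := fun γ => by
      have he0 : e ≠ 0 := by rintro rfl; exact hy (by rw [he, zero_smul])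
      obtain ⟨e', rfl⟩ := ht γ
      exact ⟨e' * e⁻¹, by rw [he, smul_smul, inv_mul_cancel_right₀ he0]⟩
    obtain ⟨c, hc'⟩ := eq_of_mem_homogeneousPart_line ht' (res_mem j (hb y))
    refine ⟨c, ?_, ?_⟩
    · rintro rfl
      rw [RingHom.map_zero, zero_mul, ← hξ' 0, he, der_smul_linForm] at hc'
      have he0 : e ≠ 0 := by rintro rfl; exact hy (by rw [he, zero_smul])
      exact (mul_ne_zero (isUnit_algebraMap he0).ne_zero hξ0) hc'
    · rw [← hres, map_sub, hc', map_mul, map_pow, res_linForm, AlgHom.commutes, sub_self]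
  · obtain ⟨e, he⟩ := ht (y ∘ₗ j)
    have ht' : ∀ γ : Dual K (LinearMap.ker α), ∃ c : K, γ = c • (y ∘ₗ j) := fun γ => by
      have he0 : e ≠ 0 := by rintro rfl; exact hy (by rw [he, zero_smul])
      obtain ⟨e', rfl⟩ := ht γ
      exact ⟨e' * e⁻¹, by rw [he, smul_smul, inv_mul_cancel_right₀ he0]⟩
    obtain ⟨c, hc'⟩ := eq_of_mem_homogeneousPart_line ht' (res_mem j hgs)
    refine ⟨c, g, ?_, hg, ?_⟩
    · rintro rfl
      rw [RingHom.map_zero, zero_mul] at hc'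
      exact hg0 hc'
    · rw [← hres, map_sub, hc', map_mul, map_pow, res_linForm, AlgHom.commutes, sub_self]

end

/-! ### Reduction from codimension two to the plane -/

section

variable {W : Type v} [AddCommGroup W] [Module K W] {U : Type v} [AddCommGroup U] [Module K U]

/-! ### Localization at a subspace of codimension two -/

/-- The extension of a derivation from a direct summand `U` of `V`, by zero on the complement. -/
def liftDer (i : U →ₗ[K] V) (q : V →ₗ[K] U) (θ : Der K U) : Der K V :=
  mkDer ((res q).toLinearMap ∘ₗ θ.toLinearMap ∘ₗ SymmetricAlgebra.ι K (Dual K U) ∘ₗ i.dualMap)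

theorem liftDer_linForm (i : U →ₗ[K] V) (q : V →ₗ[K] U) (θ : Der K U) (β : Dual K V) :
    liftDer i q θ (linForm β) = res q (θ (linForm (β ∘ₗ i))) := mkDer_linForm _ _

theorem liftDer_hasPDeg (i : U →ₗ[K] V) (q : V →ₗ[K] U) {θ : Der K U} {p : ℕ}
    (h : HasPDeg θ p) : HasPDeg (liftDer i q θ) p :=
  fun β => by
    rw [liftDer_linForm]
    exact res_mem q (h _)

theorem liftDer_mem {i : U →ₗ[K] V} {q : V →ₗ[K] U} {M : MultiArrangement K V}
    (hM : ∀ H ∈ M.hyperplanes, (formOf H ∘ₗ i) ∘ₗ q = formOf H) {θ : Der K U}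
    (hθ : θ ∈ derModule (M.pull i)) : liftDer i q θ ∈ derModule M := by
  rw [mem_derModule_iff]
  intro H hH
  by_cases h0 : M.mult H = 0
  · simp [h0]
  have hfix := hM H (MultiArrangement.mem_hyperplanes.2 h0)
  have hker : LinearMap.ker (formOf H ∘ₗ i) = H.comap i := by rw [ker_comp, ker_formOf hH]
  have htop : H.comap i ≠ ⊤ := by
    rw [← hker, Ne, LinearMap.ker_eq_top]
    intro h
    rw [h] at hfix
    exact formOf_ne_zero hH (by rw [← hfix, LinearMap.zero_comp])
  have hc := (Submodule.isCoatom_comap_or_eq_top i hH).resolve_right htop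
  have h1 := map_dvd (res q) (dvd_of_mem_derModule hθ hc hker)
  rw [liftDer_linForm]
  refine dvd_trans ?_ h1
  rw [map_pow, res_linForm, hfix]
  exact pow_dvd_pow _ (le_pullMult M.mult i htop)

theorem res_defPoly_pull {i : U →ₗ[K] V} {q : V →ₗ[K] U} {M : MultiArrangement K V}
    (hM : ∀ H ∈ M.hyperplanes, (formOf H ∘ₗ i) ∘ₗ q = formOf H) :
    Associated M.defPoly (res q (M.pull i).defPoly) := by
  have h1 : Associated (res i M.defPoly) (M.pull i).defPoly := by
    refine res_powProd M.mult i M.isCoatom fun H hH htop => ?_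
    have hfix := hM H hH
    have hc := M.isCoatom H hH
    have : formOf H ∘ₗ i = 0 := by
      rw [← LinearMap.ker_eq_top, ker_comp, ker_formOf hc, htop]
    rw [this, LinearMap.zero_comp] at hfix
    exact formOf_ne_zero hc hfix.symm
  have h2 := h1.map (res q)
  rw [res_res] at h2
  have h3 : res (i ∘ₗ q) M.defPoly = M.defPoly := by
    rw [MultiArrangement.defPoly, powProd, Finsupp.prod, map_prod]
    refine Finset.prod_congr rfl fun H hH => ?_
    rw [map_pow, res_linForm, ← LinearMap.comp_assoc, hM H hH]
  rwa [h3] at h2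

theorem coordDer_natAdd {m n : ℕ} {q : V →ₗ[K] U} {x : Basis (Fin (m + n)) K (Dual K V)}
    {u : Basis (Fin m) K (Dual K U)} (hu : ∀ k, x (Fin.castAdd n k) = u k ∘ₗ q) (k : Fin n)
    (γ : Dual K U) : coordDer x (Fin.natAdd m k) (linForm (γ ∘ₗ q)) = 0 := by
  have : (coordDer x (Fin.natAdd m k)).toLinearMap ∘ₗ SymmetricAlgebra.ι K (Dual K V) ∘ₗ
      q.dualMap = 0 := u.ext fun l => by
    change coordDer x (Fin.natAdd m k) (linForm (u l ∘ₗ q)) = 0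
    rw [← hu, coordDer_linForm, if_neg]
    intro h
    have := congrArg Fin.val h
    simp at this
    omega
  exact LinearMap.congr_fun this γ

/-- By `hM` all equations come from U, so M is the product of a multiarrangement in U with an empty
one. The coefficient matrix is block diagonal with an identity block, and Saito's criterion applies.
-/
theorem isDerBasis_liftDer {m n : ℕ} {i : U →ₗ[K] V} {q : V →ₗ[K] U}
    {x : Basis (Fin (m + n)) K (Dual K V)} {u : Basis (Fin m) K (Dual K U)}
    (hqi : q ∘ₗ i = LinearMap.id)
    (hu : ∀ k, x (Fin.castAdd n k) = u k ∘ₗ q) (hx : ∀ k, x (Fin.natAdd m k) ∘ₗ i = 0)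
    {M : MultiArrangement K V} (hM : ∀ H ∈ M.hyperplanes, (formOf H ∘ₗ i) ∘ₗ q = formOf H)
    {θ : Fin m → Der K U} (h : IsDerBasis (M.pull i) θ) :
    IsDerBasis M (Fin.append (fun k => liftDer i q (θ k))
      fun k => coordDer x (Fin.natAdd m k)) := by
  refine isDerBasis_of_det x (fun k => ?_) ?_
  · refine Fin.addCases (fun k => ?_) (fun k => ?_) k
    · rw [Fin.append_left]
      exact liftDer_mem hM (h.mem k)
    · rw [Fin.append_right, mem_derModule_iff]
      intro H hH
      by_cases h0 : M.mult H = 0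
      · simp [h0]
      · rw [← hM H (MultiArrangement.mem_hyperplanes.2 h0), coordDer_natAdd hu]
        exact dvd_zero _
  · have hmat : (coeffMatrix x (Fin.append (fun k => liftDer i q (θ k))
        fun k => coordDer x (Fin.natAdd m k))).submatrix finSumFinEquiv finSumFinEquiv =
        Matrix.fromBlocks ((res q).mapMatrix (coeffMatrix u θ)) 0 0 1 := by
      ext a b
      rcases a with a | a <;> rcases b with b | b
      · simp only [Matrix.submatrix_apply, finSumFinEquiv_apply_left, coeffMatrix_apply,
          Fin.append_left, Matrix.fromBlocks_apply₁₁, AlgHom.mapMatrix_apply, Matrix.map_apply]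
        rw [liftDer_linForm, hu, LinearMap.comp_assoc, hqi]
        rfl
      · simp only [Matrix.submatrix_apply, finSumFinEquiv_apply_left, finSumFinEquiv_apply_right,
          coeffMatrix_apply, Fin.append_left, Matrix.fromBlocks_apply₁₂]
        rw [liftDer_linForm, hx, linForm_zero, map_zero, map_zero]
        rfl
      · simp only [Matrix.submatrix_apply, finSumFinEquiv_apply_left, finSumFinEquiv_apply_right,
          coeffMatrix_apply, Fin.append_right, Matrix.fromBlocks_apply₂₁]
        rw [hu, coordDer_natAdd hu]
        rfl
      · simp only [Matrix.submatrix_apply, finSumFinEquiv_apply_right,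
          coeffMatrix_apply, Fin.append_right, Matrix.fromBlocks_apply₂₂]
        rw [coordDer_linForm, Matrix.one_apply]
        simp
    rw [← Matrix.det_submatrix_equiv_self finSumFinEquiv, hmat, Matrix.det_fromBlocks_zero₂₁,
      Matrix.det_one, mul_one, ← AlgHom.map_det]
    exact ((h.det_associated u).map (res q)).trans (res_defPoly_pull hM).symm

/-- U is a complement of X and q the projection along X; a form vanishing on X is determined by its
values on U. -/
theorem exists_complement_basis {m n : ℕ} [FiniteDimensional K V] {X : Submodule K V}
    (hV : finrank K V = m + n) (hX : finrank K X = n) :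
    ∃ (U : Submodule K V) (q : V →ₗ[K] U) (u : Basis (Fin m) K (Dual K U))
      (x : Basis (Fin (m + n)) K (Dual K V)), q ∘ₗ U.subtype = LinearMap.id ∧
      (∀ k, x (Fin.castAdd n k) = u k ∘ₗ q) ∧ (∀ k, x (Fin.natAdd m k) ∘ₗ U.subtype = 0) ∧
      ∀ β : Dual K V, X ≤ LinearMap.ker β → (β ∘ₗ U.subtype) ∘ₗ q = β := by
  obtain ⟨U, hU⟩ := Submodule.exists_isCompl X
  have hUr : finrank K U = m := by
    have := Submodule.finrank_add_eq_of_isCompl hU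
    omega
  let bU := finBasisOfFinrankEq K U hUr
  let bX := finBasisOfFinrankEq K X hX
  let e := Submodule.prodEquivOfIsCompl U X hU.symm
  let b : Basis (Fin (m + n)) K V := ((bU.prod bX).map e).reindex finSumFinEquiv
  let q : V →ₗ[K] U := LinearMap.fst K U X ∘ₗ e.symm.toLinearMap
  have hbl : ∀ k, b (Fin.castAdd n k) = bU k := fun k => by simp [b, e]
  have hbr : ∀ k, b (Fin.natAdd m k) = bX k := fun k => by simp [b, e]
  have hqU : ∀ w : U, q w = w := fun w => by simp [q, e]
  have hqX : ∀ w : X, q w = 0 := fun w => by simp [q, e]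
  refine ⟨U, q, bU.dualBasis, b.dualBasis, LinearMap.ext hqU, fun k => ?_, fun k => ?_,
    fun β hβ => ?_⟩
  · refine b.ext fun l => ?_
    refine Fin.addCases (fun l => ?_) (fun l => ?_) l
    · rw [LinearMap.comp_apply, hbl l, hqU, ← hbl l, b.dualBasis_apply_self,
        bU.dualBasis_apply_self]
      simp
    · rw [LinearMap.comp_apply, hbr l, hqX, ← hbr l, b.dualBasis_apply_self, map_zero, if_neg]
      intro h
      have := congrArg Fin.val h
      simp at this
      omega
  · refine bU.ext fun l => ?_
    rw [LinearMap.comp_apply, Submodule.subtype_apply, ← hbl l, b.dualBasis_apply_self,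
      LinearMap.zero_apply, if_neg]
    intro h
    have := congrArg Fin.val h
    simp at this
    omega
  · refine b.ext fun l => ?_
    refine Fin.addCases (fun l => ?_) (fun l => ?_) l
    · simp [hbl, hqU]
    · have : β (bX l) = 0 := hβ (bX l).2
      simp [hbr, hqX, this]

theorem finrank_eq_of_isCoatom [FiniteDimensional K V] {H : Submodule K V} (hH : IsCoatom H) :
    finrank K V = finrank K H + 1 := by
  have h1 := LinearMap.finrank_range_add_finrank_ker (formOf H)
  rw [LinearMap.range_eq_top.2 (LinearMap.surjective (formOf_ne_zero hH)), finrank_top,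
    finrank_self, ker_formOf hH] at h1
  omega

theorem isEulerMultiplicity_of_isDerBasis {n : ℕ} (hn : finrank K V = n)
    {M : MultiArrangement K V} {H : Submodule K V} {Y : Submodule K H}
    {θ : Fin n → Der K V} (h : IsDerBasis (M.localization (Y.map H.subtype)) θ)
    {α : Dual K V} (hα : LinearMap.ker α = H) {i j : Fin n} (hij : i ≠ j) {d p : ℕ}
    (hi : HasPDeg (θ i) d) (hi' : ¬ ∃ η : Der K V, θ i = linForm α • η)
    (hj : HasPDeg (θ j) p) (hj' : ∃ η : Der K V, θ j = linForm α • η)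
    (hk : ∀ k, k ≠ i → k ≠ j → HasPDeg (θ k) 0) : IsEulerMultiplicity M H Y d := by
  subst hn
  obtain ⟨b, hb⟩ := exists_basis_of_isDerBasis h
  refine ⟨α, b, i, j, p, hα, hij, ?_⟩
  simp only [hb]
  exact ⟨hi, hi', hj, hj', hk⟩

theorem MultiArrangement.localization_mult (M : MultiArrangement K V) (X : Submodule K V)
    {H : Submodule K V} : (X ≤ H → (M.localization X).mult H = M.mult H) ∧
      (¬ X ≤ H → (M.localization X).mult H = 0) := by
  classical
  constructor <;> intro h <;> simp [localization, h]

theorem MultiArrangement.localization_le (M : MultiArrangement K V) (X H : Submodule K V) :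
    (M.localization X).mult H ≤ M.mult H := by
  by_cases h : X ≤ H
  · exact ((M.localization_mult X).1 h).le
  · rw [(M.localization_mult X).2 h]
    exact Nat.zero_le _

/-- A hyperplane containing Y is H itself or has trace Y on H. -/
theorem MultiArrangement.sum_localization (M : MultiArrangement K V) {H : Submodule K V}
    (hH : H ∈ M.hyperplanes) {Y : Submodule K H} (hY : IsCoatom Y) :
    (M.localization (Y.map H.subtype)).mult.sum (fun _ k => k) =
      M.mult H + pullMult (M.mult.erase H) H.subtype Y := by
  classical
  have hle : Y.map H.subtype ≤ H := by
    rw [Submodule.map_le_iff_le_comap]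
    simp
  have h1 : (M.localization (Y.map H.subtype)).mult.sum (fun _ k => k) =
      ∑ H' ∈ M.mult.support with Y.map H.subtype ≤ H', M.mult H' := by
    rw [Finsupp.sum]
    have hs : (M.localization (Y.map H.subtype)).mult.support =
        M.mult.support.filter fun H' => Y.map H.subtype ≤ H' := by
      ext H'
      rw [Finsupp.mem_support_iff, Finset.mem_filter, Finsupp.mem_support_iff]
      by_cases h : Y.map H.subtype ≤ H'
      · simp [(M.localization_mult _).1 h, h]
      · simp [(M.localization_mult _).2 h, h]
    rw [hs]
    exact Finset.sum_congr rfl fun H' hH' =>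
      (M.localization_mult _).1 (Finset.mem_filter.1 hH').2
  rw [h1, ← Finset.add_sum_erase _ _ (Finset.mem_filter.2 ⟨hH, hle⟩), pullMult_apply _ _ hY.1]
  congr 1
  refine Finset.sum_congr ?_ fun H' hH' => ?_
  · ext H'
    simp only [Finset.mem_erase, Finset.mem_filter, Finsupp.support_erase,
      Submodule.map_le_iff_le_comap]
    constructor
    · rintro ⟨hne, hs, hle'⟩
      refine ⟨⟨hne, hs⟩, (hY.le_iff.1 hle').resolve_left fun htop => hne ?_⟩
      exact (comap_eq_top_iff (M.isCoatom _ hs) (M.isCoatom _ hH) (by simp)).1 htop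
    · rintro ⟨⟨hne, hs⟩, rfl⟩
      exact ⟨hne, hs, le_rfl⟩
  · rw [Finset.mem_filter, Finsupp.support_erase, Finset.mem_erase] at hH'
    exact (Finsupp.erase_ne hH'.1.1).symm

end

/-! ### The Euler restriction read off from a basis -/

section

variable {W : Type v} [AddCommGroup W] [Module K W]

/-- Existence of the Euler multiplicity `d` at `Y`, with the divisibility properties of `D(M)`
and of `D(M')` along `Y`. -/
theorem exists_isEulerMultiplicity [FiniteDimensional K V] {M : MultiArrangement K V}
    {H : Submodule K V} (hH : H ∈ M.hyperplanes) {Y : Submodule K H} (hY : IsCoatom Y) :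
    ∃ d s, IsEulerMultiplicity M H Y d ∧ d + s = pullMult (M.mult.erase H) H.subtype Y ∧
      (∀ θ ∈ derModule M, ∀ θ' : Der K H, RestrictsTo H.subtype θ θ' →
        linForm (formOf Y) ^ d ∣ θ' (linForm (formOf Y))) ∧
      ∀ η ∈ derModule (M.deletion H), ∀ g,
        η (linForm (formOf H)) = linForm (formOf H) ^ (M.mult H - 1) * g →
        linForm (formOf Y) ^ s ∣ res H.subtype g := by
  have hc := M.isCoatom H hH
  have hm0 := MultiArrangement.mem_hyperplanes.1 hH
  set α := formOf H with hαdef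
  have hα : LinearMap.ker α = H := ker_formOf hc
  have hα0 : α ≠ 0 := formOf_ne_zero hc
  set X := Y.map H.subtype with hX
  have hXH : X ≤ H := by
    rw [hX, Submodule.map_le_iff_le_comap]
    simp
  have hXr : finrank K X = finrank K Y :=
    Submodule.finrank_map_subtype_eq H Y
  -- Y has codimension two in V, so its complement U is a plane and the localization at Y lives
  -- there.
  obtain ⟨U, q, u, x, hqi, hu, hx, hfix⟩ := exists_complement_basis (m := 2) (n := finrank K X)
    (X := X) (by rw [finrank_eq_of_isCoatom hc, finrank_eq_of_isCoatom hY, hXr]; omega) rfl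
  set i := U.subtype with hi
  set ML := M.localization X with hML
  have hMLH : ML.mult H = M.mult H := (M.localization_mult X).1 hXH
  have hHL : H ∈ ML.hyperplanes := MultiArrangement.mem_hyperplanes.2 (hMLH ▸ hm0)
  have hXle : ∀ H' ∈ ML.hyperplanes, X ≤ H' := by
    intro H' hH'
    by_contra hle
    exact MultiArrangement.mem_hyperplanes.1 hH' ((M.localization_mult X).2 hle)
  have hMLfix : ∀ H' ∈ ML.hyperplanes, (formOf H' ∘ₗ i) ∘ₗ q = formOf H' := fun H' hH' =>
    hfix _ (by rw [ker_formOf (ML.isCoatom H' hH')]; exact hXle H' hH')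
  have hαfix : (α ∘ₗ i) ∘ₗ q = α := hMLfix H hHL
  have hαi : α ∘ₗ i ≠ 0 := by
    intro h
    rw [h, LinearMap.zero_comp] at hαfix
    exact hα0 hαfix.symm
  set HU := H.comap i with hHU
  have hkerU : LinearMap.ker (α ∘ₗ i) = HU := by rw [ker_comp, hα]
  have hHUc : IsCoatom HU := hkerU ▸ isCoatom_ker hαi
  set N := ML.pull i with hN
  have hHN : HU ∈ N.hyperplanes :=
    MultiArrangement.mem_pull_hyperplanes.2 ⟨hHUc.1, H, hHL, rfl⟩
  have hNm : N.mult HU = M.mult H := by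
    classical
    rw [← hMLH]
    change pullMult ML.mult i HU = _
    rw [pullMult_apply _ _ hHUc.1]
    -- Hyperplanes through X keep distinct traces on U, each being the preimage under q of its
    -- trace.
    have : (ML.mult.support.filter fun H' => H'.comap i = HU) = {H} := by
      ext H'
      rw [Finset.mem_filter, Finset.mem_singleton]
      constructor
      · rintro ⟨h1, h2⟩
        have hc' := ML.isCoatom H' h1
        have h3 : LinearMap.ker (α ∘ₗ i) = LinearMap.ker (formOf H' ∘ₗ i) := by
          rw [hkerU, ker_comp, ker_formOf hc', h2]
        rw [← ker_formOf hc', ← hα, ← hMLfix H' h1, ← hαfix, ker_comp, ker_comp _ q, h3]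
      · rintro rfl
        exact ⟨hHL, rfl⟩
    rw [this, Finset.sum_singleton]
  obtain ⟨η, ξ, d, s, hξd, hηd, hξ, hbas, hsum, hy⟩ := exists_euler_basis_plane u hHN hkerU
  rw [hNm] at hηd hsum
  -- a form cutting out `Y`
  obtain ⟨β, hβ⟩ := exists_comp_eq H.subtype_injective (formOf Y)
  have hβfix : (β ∘ₗ i) ∘ₗ q = β := hfix β (by
    rw [hX, Submodule.map_le_iff_le_comap, ← ker_comp, hβ, ker_formOf hY])
  have hβi : (β ∘ₗ i) ∘ₗ HU.subtype ≠ 0 := by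
    intro h
    obtain ⟨c, hc'⟩ := eq_smul_of_comp_eq_zero (j := HU.subtype) (α := α ∘ₗ i)
      (by rw [hkerU, Submodule.range_subtype]) h
    have h2 : β = c • α := by
      rw [← hβfix, hc', LinearMap.smul_comp, hαfix]
    have h3 : α ∘ₗ H.subtype = 0 := comp_eq_zero_of_range (by simp [hα])
    rw [h2, LinearMap.smul_comp, h3, smul_zero] at hβ
    exact formOf_ne_zero hY hβ.symm
  obtain ⟨⟨c₁, hc₁, hξy⟩, c₂, g₀, hc₂, hηg, hgy⟩ := hy (β ∘ₗ i) hβi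
  rw [hNm] at hηg
  have hresα : res H.subtype (linForm α) = 0 := by
    rw [res_linForm, comp_eq_zero_of_range (by simp [hα]), linForm_zero]
  have hresq : ∀ f : CoordRing K U, linForm (α ∘ₗ i) ∣ f → res H.subtype (res q f) = 0 := by
    rintro f ⟨g, rfl⟩
    rw [map_mul, res_linForm, hαfix, map_mul, hresα, zero_mul]
  have hresβ : ∀ (c : K) (k : ℕ), res H.subtype (res q (algebraMap K _ c *
      linForm (β ∘ₗ i) ^ k)) = algebraMap K _ c * linForm (formOf Y) ^ k := by
    intro c k
    rw [map_mul, map_pow, res_linForm, hβfix, map_mul, map_pow, res_linForm, hβ,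
      AlgHom.commutes, AlgHom.commutes]
  have hres1 : res H.subtype (res q (ξ 0 (linForm (β ∘ₗ i)))) =
      algebraMap K _ c₁ * linForm (formOf Y) ^ d := by
    rw [← hresβ, ← sub_eq_zero, ← map_sub, ← map_sub, hresq _ hξy]
  have hres2 : res H.subtype (res q g₀) = algebraMap K _ c₂ * linForm (formOf Y) ^ s := by
    rw [← hresβ, ← sub_eq_zero, ← map_sub, ← map_sub, hresq _ hgy]
  have hcoord : ∀ (k : Fin (finrank K X)) (γ : Dual K V), (γ ∘ₗ i) ∘ₗ q = γ →
      coordDer x (Fin.natAdd 2 k) (linForm γ) = 0 := fun k γ hγ => by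
    rw [← hγ, coordDer_natAdd hu]
  -- the two lifted bases
  have hbN : IsDerBasis N (Fin.cons (linForm (α ∘ₗ i) • η) ξ : Fin 2 → Der K U) :=
    hbas.smul_cons u hHN hkerU hξ
  have hB := isDerBasis_liftDer hqi hu hx hMLfix hbN
  have hpd : (ML.deletion H).pull i = N.deletion HU := ML.pull_deletion hHL hHUc.1
  have hB' := isDerBasis_liftDer (M := ML.deletion H) hqi hu hx (fun H' hH' => hMLfix H' (by
    rw [MultiArrangement.mem_hyperplanes] at hH' ⊢
    have : (ML.deletion H).mult H' ≤ ML.mult H' := by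
      rw [MultiArrangement.deletion_mult, Finsupp.tsub_apply]
      exact Nat.sub_le _ _
    omega)) (by rw [hpd]; exact hbas)
  have hlift : liftDer i q (linForm (α ∘ₗ i) • η) = linForm α • liftDer i q η :=
    der_ext fun γ => by
      rw [liftDer_linForm, Derivation.smul_apply, Derivation.smul_apply, liftDer_linForm,
        smul_eq_mul, map_mul, res_linForm, hαfix, smul_eq_mul]
  have hliftα : liftDer i q η (linForm α) = linForm α ^ (M.mult H - 1) * res q g₀ := by
    rw [liftDer_linForm, hηg, map_mul, map_pow, res_linForm, hαfix]
  refine ⟨d, s, ?_, ?_, ?_, ?_⟩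
  -- Index 1 carries the lift of ξ, in the role of θ_Y, and index 0 the lift of α η, in the role of
  -- ψ_Y; the others are coordinate derivations.
  · refine isEulerMultiplicity_of_isDerBasis (i := Fin.castAdd _ 1) (j := Fin.castAdd _ 0)
      (p := 1 + (M.mult H - 1 + s))
      (by rw [finrank_eq_of_isCoatom hc, finrank_eq_of_isCoatom hY, hXr]; omega) hB hα ?_ ?_ ?_
      ?_ ?_ ?_
    · intro h
      have := congrArg Fin.val h
      simp at this
    · rw [Fin.append_left]
      exact liftDer_hasPDeg i q hξd
    · rw [Fin.append_left]
      -- A multiple of α restricts to zero on H, whereas the value at β restricts to a nonzero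
      -- multiple of a power of the equation of Y.
      rintro ⟨ζ, hζ⟩
      have h1 := congrArg (fun D : Der K V => res H.subtype (D (linForm β))) hζ
      have h2 : (Fin.cons (linForm (α ∘ₗ i) • η) ξ : Fin 2 → Der K U) 1 = ξ 0 := rfl
      simp only [h2] at h1
      rw [liftDer_linForm, hres1, Derivation.smul_apply, smul_eq_mul, map_mul, hresα, zero_mul]
        at h1
      exact mul_ne_zero (isUnit_algebraMap hc₁).ne_zero
        (pow_ne_zero _ (prime_formOf hY).ne_zero) h1
    · rw [Fin.append_left]
      exact liftDer_hasPDeg i q (hηd.smul (linForm_mem _))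
    · rw [Fin.append_left]
      exact ⟨_, hlift⟩
    · intro k
      refine Fin.addCases (fun k => ?_) (fun k => ?_) k
      · intro h1 h2
        exfalso
        fin_cases k
        · exact h2 rfl
        · exact h1 rfl
      · intro _ _
        rw [Fin.append_right]
        exact coordDer_mem x _
  · have h1 := degree_eq_of_associated (res_defPoly_pull hMLfix) (powProd_ne_zero ML.isCoatom)
      (powProd_mem _) (res_mem q (powProd_mem _))
    change ML.mult.sum (fun _ k => k) = N.mult.sum fun _ k => k at h1
    rw [hML, M.sum_localization hH hY] at h1
    omega
  -- Evaluation at β, restricted to H: the coordinate derivations kill β, the lift of α η vanishes,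
  -- and the lift of ξ contributes a multiple of y ^ d, where y is the equation of Y.
  · intro θ hθ θ' hθ'
    have hθL : θ ∈ derModule ML := derModule_anti (M.localization_le X) hθ
    obtain ⟨c, rfl⟩ := hB.exists_coeff hθL
    rw [← hβ, hθ', der_sum_apply, Fin.sum_univ_add, Fin.sum_univ_two]
    simp only [Fin.append_left, Fin.append_right]
    rw [Finset.sum_eq_zero (fun k _ => by rw [hcoord k β hβfix, mul_zero]), add_zero]
    have h2 : (Fin.cons (linForm (α ∘ₗ i) • η) ξ : Fin 2 → Der K U) 1 = ξ 0 := rfl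
    have h3 : (Fin.cons (linForm (α ∘ₗ i) • η) ξ : Fin 2 → Der K U) 0 =
      linForm (α ∘ₗ i) • η := rfl
    rw [h2, h3, hlift, Derivation.smul_apply, smul_eq_mul, map_add, map_mul, map_mul, map_mul,
      hresα, zero_mul, mul_zero, zero_add, liftDer_linForm, hres1, hβ]
    exact (dvd_mul_left _ _).mul_left _
  -- Evaluation at α: the lift of ξ contributes one factor α too many and disappears on H, while the
  -- lift of η contributes a multiple of y ^ s.
  · intro ζ hζ g hg
    have hζL : ζ ∈ derModule (ML.deletion H) := by
      refine derModule_anti (fun H' => ?_) hζ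
      by_cases h : H' = H
      · subst h
        rw [MultiArrangement.deletion_mult_self, MultiArrangement.deletion_mult_self, hMLH]
      · rw [MultiArrangement.deletion_mult_of_ne _ h, MultiArrangement.deletion_mult_of_ne _ h]
        exact M.localization_le X H'
    obtain ⟨c, rfl⟩ := hB'.exists_coeff hζL
    obtain ⟨t, ht⟩ := dvd_of_mem_derModule (liftDer_mem hMLfix (hξ 0)) hc hα
    rw [hMLH] at ht
    have hpow : linForm α ^ M.mult H = linForm α ^ (M.mult H - 1) * linForm α := by
      rw [← pow_succ, Nat.sub_add_cancel (Nat.pos_of_ne_zero hm0)]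
    rw [der_sum_apply, Fin.sum_univ_add, Fin.sum_univ_two] at hg
    simp only [Fin.append_left, Fin.append_right] at hg
    rw [Finset.sum_eq_zero (fun k _ => by rw [hcoord k α hαfix, mul_zero]), add_zero] at hg
    have h2 : (Fin.cons η ξ : Fin 2 → Der K U) 1 = ξ 0 := rfl
    have h3 : (Fin.cons η ξ : Fin 2 → Der K U) 0 = η := rfl
    rw [h2, h3, hliftα, ht, hpow] at hg
    have hg' : g = c (Fin.castAdd _ 0) * res q g₀ + c (Fin.castAdd _ 1) * (linForm α * t) := by
      refine mul_left_cancel₀ (pow_ne_zero (M.mult H - 1) (linForm_ne_zero hα0)) ?_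
      rw [← hg]
      ring
    rw [hg', map_add, map_mul, map_mul, map_mul, hresα, zero_mul, mul_zero, add_zero, hres2]
    exact (dvd_mul_left _ _).mul_left _

/-- If `η, θ₁, …` is a basis of `D(M')` with `θᵢ ∈ D(M)` and the restrictions of the `θᵢ` have
determinant `Q(N)`, then `N` is the Euler restriction of `M`. -/
theorem isEulerRestriction_of_det [FiniteDimensional K V] {n : ℕ}
    {M : MultiArrangement K V} {H : Submodule K V} (hH : H ∈ M.hyperplanes)
    {η : Der K V} {θ : Fin n → Der K V} (hb : IsDerBasis (M.deletion H) (Fin.cons η θ))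
    (hθ : ∀ i, θ i ∈ derModule M) {θ' : Fin n → Der K H}
    (hθ' : ∀ i, RestrictsTo H.subtype (θ i) (θ' i)) (y : Basis (Fin n) K (Dual K H))
    {N : MultiArrangement K H} (hNhyp : N.hyperplanes = restrictSet M.hyperplanes H)
    (hN : Associated (coeffMatrix y θ').det N.defPoly) : IsEulerRestriction M H N := by
  refine ⟨hNhyp, fun Y hYN => ?_⟩
  have hc := M.isCoatom H hH
  have hm0 := MultiArrangement.mem_hyperplanes.1 hH
  have hY := N.isCoatom Y hYN
  have hα0 := formOf_ne_zero hc
  have hrange : LinearMap.range H.subtype = LinearMap.ker (formOf H) := by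
    rw [ker_formOf hc, Submodule.range_subtype]
  obtain ⟨d, s, hE, hds, hd, hs⟩ := exists_isEulerMultiplicity hH hY
  -- All restricted derivations have values at y divisible by y ^ d, so y ^ d divides their
  -- determinant.
  have hle1 : d ≤ N.mult Y := by
    refine le_of_pow_dvd_powProd hY N.isCoatom (dvd_trans ?_ hN.dvd)
    obtain ⟨c, k, hc0, hdet⟩ := exists_mul_det_coeffMatrix y (formOf_ne_zero hY) θ'
    rw [← (isUnit_algebraMap (V := H) hc0).dvd_mul_left, ← hdet]
    choose g hg using fun k => hd _ (hθ k) _ (hθ' k)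
    have : (fun k => θ' k (linForm (formOf Y))) = linForm (formOf Y) ^ d • g := by
      funext k
      simp [hg]
    rw [this, Matrix.det_updateCol_smul]
    exact dvd_mul_right _ _
  -- Stripped of its power of α_H, the determinant of η, θᵢ restricts to `res g` times that of the
  -- θᵢ'. In this product y has exponent d + s, of which `res g` already takes up s.
  have hle2 : N.mult Y ≤ d := by
    obtain ⟨x, hx0, hxy⟩ := exists_basis_cons H.subtype_injective hα0 hrange y
    obtain ⟨g, hg⟩ := exists_eq_pow_mul hH (ker_formOf hc) (hb.mem 0)
    obtain ⟨D, hD1, hD2⟩ := exists_det_cons (x := x) (y := y)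
      (by rw [hx0]; exact comp_eq_zero_of_range hrange) hxy hθ' (η := η)
      (k := M.mult H - 1) (g := g) (by rw [hx0]; exact hg) (fun i => by
        rw [hx0, Nat.sub_add_cancel (Nat.pos_of_ne_zero hm0)]
        exact dvd_of_mem_derModule (hθ i) hc (ker_formOf hc))
    have hdet := hb.det_associated x
    have hQ : (M.deletion H).defPoly =
        linForm (formOf H) ^ (M.mult H - 1) * powProd (M.mult.erase H) := by
      rw [MultiArrangement.defPoly, powProd_erase _ H, MultiArrangement.deletion_mult_self]
      congr 2
      ext H'
      by_cases h : H' = H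
      · subst h
        simp
      · rw [Finsupp.erase_ne h, Finsupp.erase_ne h, MultiArrangement.deletion_mult_of_ne _ h]
    rw [hD1, hQ, hx0] at hdet
    have hDP : Associated D (powProd (M.mult.erase H)) :=
      Associated.of_mul_left hdet (Associated.refl _) (pow_ne_zero _ (linForm_ne_zero hα0))
    have hec : ∀ H' ∈ (M.mult.erase H).support, IsCoatom H' ∧ H' ≠ H := fun H' hH' => by
      classical
      rw [Finsupp.support_erase, Finset.mem_erase] at hH'
      exact ⟨M.isCoatom H' hH'.2, hH'.1⟩
    have hres := (hDP.map (res H.subtype)).trans (res_powProd _ _ (fun H' h => (hec H' h).1)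
      fun H' h htop => (hec H' h).2
        ((comap_eq_top_iff (hec H' h).1 hc (Submodule.range_subtype _)).1 htop))
    rw [hD2] at hres
    have h1 := hs _ (hb.mem 0) g hg
    have h2 : linForm (formOf Y) ^ N.mult Y ∣ (coeffMatrix y θ').det := by
      refine dvd_trans ?_ hN.symm.dvd
      exact (powProd_dvd_iff N.isCoatom).1 dvd_rfl Y hYN
    have h3 := (mul_dvd_mul h1 h2).trans hres.dvd
    rw [← pow_add] at h3
    have h4 := le_of_pow_dvd_powProd hY (fun Y' hY' => ?_) h3
    · omega
    · obtain ⟨ht, H', hH', rfl⟩ := exists_of_pullMult_ne_zero (Finsupp.mem_support_iff.1 hY')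
      exact (Submodule.isCoatom_comap_or_eq_top _ (hec H' hH').1).resolve_right ht
  rwa [le_antisymm hle2 hle1]

end

/-! ### Homogeneous relations, and adapted bases for addition -/

section

variable {W : Type v} [AddCommGroup W] [Module K W]

/-! ### Homogeneous coefficients -/

theorem homComp_sum_smul {ι : Type*} [Fintype ι] {φ : ι → Der K V} {c : ι → ℕ}
    (hφ : ∀ i, HasPDeg (φ i) (c i)) {η : Der K V} {p : ℕ} (hη : HasPDeg η p)
    {m : ι → CoordRing K V} (h : η = ∑ i, m i • φ i) :
    η = ∑ i, (if c i ≤ p then homComp (p - c i) (m i) else 0) • φ i := by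
  refine der_ext fun β => ?_
  rw [← homComp_eq_self (hη β)]
  conv_lhs => rw [h]
  rw [der_sum_apply, der_sum_apply, map_sum]
  refine Finset.sum_congr rfl fun i _ => ?_
  rw [mul_comm]
  split_ifs with hle
  · rw [homComp_mul_of_le hle (hφ i β), mul_comm]
  · rw [homComp_mul_of_lt (by omega) (hφ i β), zero_mul]

/-- A relation between homogeneous derivations can be made homogeneous. -/
theorem exists_homogeneous_coeff {ι : Type*} [Fintype ι] {φ : ι → Der K V} {c : ι → ℕ}
    (hφ : ∀ i, HasPDeg (φ i) (c i)) {η : Der K V} {p : ℕ} (hη : HasPDeg η p)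
    {m : ι → CoordRing K V} (h : η = ∑ i, m i • φ i) :
    ∃ m' : ι → CoordRing K V, η = ∑ i, m' i • φ i ∧ (∀ i, m i = 0 → m' i = 0) ∧
      ∀ i, (c i ≤ p ∧ m' i ∈ homogeneousPart K V (p - c i)) ∨ m' i = 0 := by
  refine ⟨_, homComp_sum_smul hφ hη h, fun i hi => ?_, fun i => ?_⟩
  · rw [hi, map_zero, ite_self]
  · split_ifs with hle
    · exact Or.inl ⟨hle, homComp_mem _ _⟩
    · exact Or.inr rfl

/-- More rows than columns force a relation between the rows. -/
theorem exists_relation {R ι κ : Type*} [CommRing R] [IsDomain R] [Fintype ι] [Fintype κ]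
    (m : ι → κ → R) (I : Finset ι) (J : Finset κ) (h : J.card < I.card) :
    ∃ f : ι → R, (∀ i, i ∉ I → f i = 0) ∧ (∃ i, f i ≠ 0) ∧ ∀ j ∈ J, ∑ i, f i * m i j = 0 := by
  classical
  have hdep : ¬ LinearIndependent R fun (i : I) (j : J) => m i j := by
    intro hli
    have := hli.fintype_card_le_finrank
    rw [finrank_fintype_fun_eq_card, Fintype.card_coe, Fintype.card_coe] at this
    omega
  obtain ⟨g, hg, ⟨i₀, hi₀⟩, hne⟩ := Fintype.not_linearIndependent_iff.1 hdep
  refine ⟨fun i => if hi : i ∈ I then g ⟨i, hi⟩ else 0, fun i hi => dif_neg hi,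
    ⟨i₀, by simpa [hi₀] using hne⟩, fun j hj => ?_⟩
  have h1 := congrFun hg ⟨j, hj⟩
  rw [Finset.sum_apply] at h1
  have h2 : ∑ i : ι, (if hi : i ∈ I then g ⟨i, hi⟩ else 0) * m i j =
      ∑ i ∈ I, (if hi : i ∈ I then g ⟨i, hi⟩ else 0) * m i j := by
    refine (Finset.sum_subset (Finset.subset_univ I) fun i _ hi => ?_).symm
    rw [dif_neg hi, zero_mul]
  rw [h2, ← Finset.sum_coe_sort]
  simpa using h1

theorem card_filter_eq_countP {n : ℕ} (p : Fin n → ℕ) (P : ℕ → Prop) [DecidablePred P] :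
    (Finset.univ.filter fun i => P (p i)).card = (Finset.univ.val.map p).countP P := by
  rw [Multiset.countP_map, Finset.card_def, Finset.filter_val]

theorem exists_eq_cons_of_le {n : ℕ} {e e' : Multiset ℕ} (h : e ≤ e') (h1 : e.card = n)
    (h2 : e'.card = n + 1) : ∃ b, e' = b ::ₘ e := by
  obtain ⟨f, rfl⟩ := Multiset.le_iff_exists_add.1 h
  rw [Multiset.card_add, h1] at h2
  obtain ⟨b, rfl⟩ := Multiset.card_eq_one.1 (show f.card = 1 by omega)
  exact ⟨b, by rw [add_comm, Multiset.singleton_add]⟩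

theorem IsDerBasis.cons_succAbove {n : ℕ} {M : MultiArrangement K V} {θ : Fin (n + 1) → Der K V}
    (h : IsDerBasis M θ) (k : Fin (n + 1)) :
    IsDerBasis M (Fin.cons (θ k) fun i => θ (k.succAbove i)) := by
  have h1 := h.comp_equiv k.cycleRange.symm
  have h2 : θ ∘ k.cycleRange.symm = Fin.cons (θ k) fun i => θ (k.succAbove i) := by
    funext i
    refine Fin.cases ?_ (fun i => ?_) i
    · simp
    · simp
  rwa [h2] at h1

theorem IsDerBasis.of_smul_cons {n : ℕ} (x : Basis (Fin (n + 1)) K (Dual K V))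
    {M : MultiArrangement K V} {H : Submodule K V} (hH : H ∈ M.hyperplanes) {α : Dual K V}
    (hα : LinearMap.ker α = H) {θ : Fin n → Der K V} {η : Der K V}
    (h : IsDerBasis M (Fin.cons (linForm α • η) θ)) :
    IsDerBasis (M.deletion H) (Fin.cons η θ) := by
  have hc := M.isCoatom H hH
  refine isDerBasis_of_det x (fun i => ?_) ?_
  · refine Fin.cases ?_ (fun i => ?_) i
    · exact mem_derModule_of_smul_mem hc hα (h.mem 0)
    · exact derModule_le_deletion M H (h.mem i.succ)
  · have hdet := h.det_associated x
    rw [det_coeffMatrix_smul_cons, M.defPoly_eq_mul hH, mul_comm] at hdet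
    exact Associated.of_mul_right hdet (associated_linForm (formOf_ne_zero hc)
      (hα.trans (ker_formOf hc).symm)) (linForm_ne_zero (ne_zero_of_ker_eq hc hα))

/-! ### Adapted bases -/

/-- A homogeneous basis `η, θ₁, …` of `D(M')` with `θᵢ ∈ D(M)`, so that `α η, θ₁, …` is a basis
of `D(M)`. -/
structure IsAdaptedBasis {n : ℕ} (M : MultiArrangement K V) (H : Submodule K V) (η : Der K V)
    (θ : Fin n → Der K V) (a : ℕ) (d : Fin n → ℕ) : Prop where
  basis : IsDerBasis (M.deletion H) (Fin.cons η θ)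
  mem : ∀ i, θ i ∈ derModule M
  hasPDeg_left : HasPDeg η a
  hasPDeg_right : ∀ i, HasPDeg (θ i) (d i)

theorem Arrangement.deletion_toMulti_mult_eq_erase {A : Arrangement K V} {H : Submodule K V} :
    (A.toMulti.deletion H).mult = A.toMulti.mult.erase H := by
  ext H'
  by_cases h : H' = H
  · subst h
    rw [MultiArrangement.deletion_mult_self, toMulti_mult, Finsupp.erase_same]
    split_ifs <;> rfl
  · rw [MultiArrangement.deletion_mult_of_ne _ h, Finsupp.erase_ne h]

theorem Arrangement.restriction_mult_le {A : Arrangement K V} {H : Submodule K V}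
    (h : H ∈ A.hyperplanes) (Y : Submodule K H) :
    (A.restriction H h).toMulti.mult Y ≤ pullMult (A.toMulti.mult.erase H) H.subtype Y := by
  classical
  rw [toMulti_mult]
  split_ifs with hY
  · have hYc := (A.restriction H h).isCoatom Y hY
    obtain ⟨H', ⟨hH', hne⟩, rfl⟩ := hY
    refine le_trans ?_ (le_pullMult _ _ hYc.1)
    rw [Finsupp.erase_ne hne, toMulti_mult, if_pos hH']
  · exact Nat.zero_le _

/-- The polynomial `B` of degree `|A'| - |A''|` such that `θ(α_H) ∈ (α_H, B)` for `θ ∈ D(A')`. -/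
theorem exists_polynomial_B [FiniteDimensional K V] {A : Arrangement K V} {H : Submodule K V}
    (h : H ∈ A.hyperplanes) : ∃ (b : ℕ) (B : CoordRing K H), B ≠ 0 ∧ B ∈ homogeneousPart K H b ∧
      (A.toMulti.deletion H).mult.sum (fun _ k => k) =
        b + (A.restriction H h).toMulti.mult.sum (fun _ k => k) ∧
      Associated (B * (A.restriction H h).toMulti.defPoly)
        (res H.subtype (A.toMulti.deletion H).defPoly) ∧
      ∀ η ∈ derModule (A.toMulti.deletion H), B ∣ res H.subtype (η (linForm (formOf H))) := by
  classical
  have hH : H ∈ A.toMulti.hyperplanes := by rwa [A.toMulti_hyperplanes]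
  have hc := A.isCoatom H h
  set κ := pullMult (A.toMulti.mult.erase H) H.subtype with hκ
  set ρ := (A.restriction H h).toMulti.mult with hρ
  have hle : ρ ≤ κ := fun Y => A.restriction_mult_le h Y
  have hec : ∀ H' ∈ (A.toMulti.mult.erase H).support, IsCoatom H' ∧ H' ≠ H := fun H' hH' => by
    rw [Finsupp.support_erase, Finset.mem_erase] at hH'
    exact ⟨A.toMulti.isCoatom H' hH'.2, hH'.1⟩
  have hκc : ∀ Y, κ Y ≠ 0 → IsCoatom Y := fun Y hY => by
    obtain ⟨ht, H', hH', rfl⟩ := exists_of_pullMult_ne_zero hY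
    exact (Submodule.isCoatom_comap_or_eq_top _ (hec H' hH').1).resolve_right ht
  have hsupp : ∀ Y ∈ (κ - ρ).support, IsCoatom Y := fun Y hY => by
    refine hκc Y ?_
    rw [Finsupp.mem_support_iff, Finsupp.tsub_apply] at hY
    omega
  have hres := res_powProd (A.toMulti.mult.erase H) H.subtype (fun H' h => (hec H' h).1)
    fun H' h htop => (hec H' h).2
      ((comap_eq_top_iff (hec H' h).1 hc (Submodule.range_subtype _)).1 htop)
  -- B is the product of the y ^ (κ(Y) - 1), with κ(Y) the number of hyperplanes of A' with trace Y
  -- and y the equation of Y.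
  refine ⟨(κ - ρ).sum fun _ k => k, powProd (κ - ρ), powProd_ne_zero hsupp, powProd_mem _, ?_, ?_, ?_⟩
  · have h2 := degree_eq_of_associated hres.symm (powProd_ne_zero fun Y hY =>
      hκc Y (Finsupp.mem_support_iff.1 hY)) (powProd_mem _) (res_mem _ (powProd_mem _))
    rw [A.deletion_toMulti_mult_eq_erase, ← h2, ← Finsupp.sum_add_index' (by simp) (by simp),
      tsub_add_cancel_of_le hle]
  · rw [MultiArrangement.defPoly, MultiArrangement.defPoly, A.deletion_toMulti_mult_eq_erase,
      ← powProd_add, tsub_add_cancel_of_le hle]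
    exact hres.symm
  · intro η hη
    rw [powProd_dvd_iff hsupp]
    intro Y hY
    have hYc := hsupp Y hY
    obtain ⟨d, s, -, hds, hd, hs⟩ := exists_isEulerMultiplicity hH hYc
    -- The Euler derivation takes the value y at y, so d is at most 1 and s at least κ(Y) - 1.
    have hd1 : d ≤ 1 := by
      have h1 := hd _ (euler_mem_derModule A) _ (restrictsTo_euler H.subtype)
      rw [euler_linForm] at h1
      refine le_of_pow_dvd_pow_mul (b := 1) (prime_formOf hYc) (prime_formOf hYc).not_dvd_one ?_
      simpa using h1
    have hm : A.toMulti.mult H = 1 := by rw [A.toMulti_mult, if_pos h]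
    have h2 := hs η hη (η (linForm (formOf H))) (by rw [hm]; simp)
    refine (pow_dvd_pow _ ?_).trans h2
    have hY0 : κ Y ≠ 0 := by
      rw [Finsupp.mem_support_iff, Finsupp.tsub_apply] at hY
      omega
    have hρ1 : ρ Y = 1 := by
      rw [hρ, Arrangement.toMulti_mult, if_pos]
      obtain ⟨ht, H', hH', rfl⟩ := exists_of_pullMult_ne_zero hY0
      refine ⟨H', ⟨?_, (hec H' hH').2⟩, rfl⟩
      rw [Finsupp.support_erase, Finset.mem_erase] at hH'
      exact A.mem_support.1 hH'.2
    rw [Finsupp.tsub_apply, hρ1]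
    change d + s = κ Y at hds
    omega

theorem exists_basis_dual {n : ℕ} [FiniteDimensional K V] (hn : finrank K V = n) :
    Nonempty (Basis (Fin n) K (Dual K V)) :=
  ⟨finBasisOfFinrankEq K _ (by rw [Subspace.dual_finrank_eq, hn])⟩

theorem card_of_hasExponents {M : MultiArrangement K V} {e : Multiset ℕ}
    (h : HasExponents M e) : e.card = finrank K V := by
  obtain ⟨b, d, -, rfl⟩ := h
  simp

/-- Adapted bases in the situation of the addition theorem. -/
theorem exists_isAdaptedBasis_of_add [FiniteDimensional K V] {n : ℕ} (hn : finrank K V = n + 1)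
    {A : Arrangement K V} {H : Submodule K V} (h : H ∈ A.hyperplanes) {e' e'' : Multiset ℕ}
    (he' : HasExponents (A.deletion H).toMulti e')
    (he'' : HasExponents (A.restriction H h).toMulti e'') (hle : e'' ≤ e') :
    ∃ (η : Der K V) (θ : Fin n → Der K V) (a : ℕ) (d : Fin n → ℕ),
      IsAdaptedBasis A.toMulti H η θ a d := by
  classical
  have hH : H ∈ A.toMulti.hyperplanes := by rwa [A.toMulti_hyperplanes]
  have hc := A.isCoatom H h
  have hnH : finrank K H = n := by
    have := finrank_eq_of_isCoatom hc
    omega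
  obtain ⟨x⟩ := exists_basis_dual hn
  obtain ⟨y⟩ := exists_basis_dual hnH
  rw [A.toMulti_deletion] at he'
  obtain ⟨b₀, hb₀⟩ := exists_eq_cons_of_le hle ((card_of_hasExponents he'').trans hnH)
    ((card_of_hasExponents he').trans hn)
  obtain ⟨θ, p, hb, hp, rfl⟩ := he'.exists_isDerBasis hn
  obtain ⟨φ, c, hφ, hcφ, rfl⟩ := he''.exists_isDerBasis hnH
  obtain ⟨b, B, hB0, hBb, hsum, -, hB⟩ := exists_polynomial_B h
  -- The exponents of A' and of A'' sum to the numbers of hyperplanes, whose difference is the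
  -- degree of B.
  have hb₀b : b₀ = b := by
    have h1 := congrArg Multiset.sum hb₀
    rw [Multiset.sum_cons] at h1
    change ∑ i, p i = b₀ + ∑ i, c i at h1
    rw [hb.sum_degree x hp, hφ.sum_degree y hcφ] at h1
    omega
  subst hb₀b
  choose q hq using fun i => hB _ (hb.mem i)
  set α := formOf H with hα
  have hα0 : α ≠ 0 := formOf_ne_zero hc
  have hαk : LinearMap.ker α = H := ker_formOf hc
  have hrange : LinearMap.range H.subtype = LinearMap.ker α := by
    rw [hαk, Submodule.range_subtype]
  have hres := res_eq_zero_iff H.subtype_injective hα0 hrange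
  have hmem : ∀ η ∈ derModule (A.toMulti.deletion H), res H.subtype (η (linForm α)) = 0 →
      η ∈ derModule A.toMulti := fun η hη h0 => by
    refine mem_derModule_of_deletion hc hαk hη ?_
    rw [A.toMulti_mult, if_pos h, pow_one]
    exact (hres _).1 h0
  have hqdeg : ∀ i, q i = 0 ∨ (b₀ ≤ p i ∧ q i ∈ homogeneousPart K H (p i - b₀)) := by
    intro i
    by_cases h0 : q i = 0
    · exact Or.inl h0
    · have h1 := res_mem H.subtype (hp i α)
      rw [hq i] at h1
      obtain ⟨s, hs, hs'⟩ := degree_of_pow_mul_mem hBb h1 (mul_ne_zero hB0 h0)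
      exact Or.inr ⟨by omega, by rwa [hs, Nat.add_sub_cancel_left]⟩
  -- For such a k the polynomial q k is a nonzero constant, and multiples of θ k remove the
  -- obstruction q from all other members.
  by_cases hcase : ∃ k, p k = b₀ ∧ q k ≠ 0
  · obtain ⟨k, hpk, hqk⟩ := hcase
    obtain ⟨c₀, hc₀⟩ : ∃ c₀ : K, q k = algebraMap K _ c₀ := by
      have := ((hqdeg k).resolve_left hqk).2
      rwa [hpk, Nat.sub_self, mem_homogeneousPart_zero_iff] at this
    have hc₀0 : c₀ ≠ 0 := by
      rintro rfl
      exact hqk (by rw [hc₀, RingHom.map_zero])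
    have hf : ∀ i, ∃ f : CoordRing K V, res H.subtype f = q i ∧
        HasPDeg (f • θ k) (p i) := by
      intro i
      rcases hqdeg i with h0 | ⟨h1, h2⟩
      · refine ⟨0, by rw [h0, map_zero], fun β => ?_⟩
        simp
      · obtain ⟨f, hf1, hf2⟩ := exists_res_eq H.subtype_injective (q i)
        refine ⟨f, hf1, ?_⟩
        have := (hp k).smul (hf2 _ h2)
        rwa [hpk, Nat.sub_add_cancel h1] at this
    choose f hf1 hf2 using hf
    let g : Fin (n + 1) → CoordRing K V := fun i =>
      if i = k then 0 else algebraMap K _ (-c₀⁻¹) * f i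
    let θ' : Fin (n + 1) → Der K V := fun i => θ i + g i • θ k
    have hθ' : IsDerBasis (A.toMulti.deletion H) θ' :=
      hb.add_smul x k g (by simp [g]) fun i => rfl
    have hpdeg : ∀ i, HasPDeg (θ' i) (p i) := by
      intro i β
      simp only [θ', g]
      split_ifs with hik
      · simpa using hp i β
      · rw [Derivation.add_apply, mul_smul, Derivation.smul_apply, smul_eq_mul,
          ← Algebra.smul_def]
        exact Submodule.add_mem _ (hp i β) (Submodule.smul_mem _ _ (hf2 i β))
    refine ⟨θ' k, fun i => θ' (k.succAbove i), p k, fun i => p (k.succAbove i),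
      hθ'.cons_succAbove k, fun i => ?_, hpdeg k, fun i => hpdeg _⟩
    refine hmem _ (hθ'.mem _) ?_
    have hne : k.succAbove i ≠ k := Fin.succAbove_ne k i
    simp only [θ', g, if_neg hne]
    rw [Derivation.add_apply, Derivation.smul_apply, smul_eq_mul, map_add, map_mul, map_mul,
      hq, hq, hf1, AlgHom.commutes, hc₀]
    have h4 : algebraMap K (CoordRing K H) (-c₀⁻¹) * algebraMap K _ c₀ = -1 := by
      rw [← map_mul, neg_mul, inv_mul_cancel₀ hc₀0, RingHom.map_neg, RingHom.map_one]
    linear_combination (B * q (k.succAbove i)) * h4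
  -- Now all θ i with p i ≤ b₀ lie in D(A). By degree they restrict to combinations of the φ j with
  -- c j ≤ b₀, of which there is one fewer, since b₀ is the additional exponent.
  · exfalso
    push Not at hcase
    have hq0 : ∀ i, p i ≤ b₀ → q i = 0 := by
      intro i hi
      rcases hqdeg i with h0 | ⟨h1, -⟩
      · exact h0
      · exact hcase i (le_antisymm hi h1)
    have hrest : ∀ i, p i ≤ b₀ → θ i ∈ derModule A.toMulti ∧
        ∃ θ' : Der K H, RestrictsTo H.subtype (θ i) θ' := by
      intro i hi
      have h0 : res H.subtype (θ i (linForm α)) = 0 := by rw [hq, hq0 i hi, mul_zero]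
      exact ⟨hmem _ (hb.mem i) h0,
        exists_restrictsTo_of_dvd H.subtype_injective hrange ((hres _).1 h0)⟩
    have hm : ∀ i, ∃ m : Fin n → CoordRing K H, p i ≤ b₀ →
        RestrictsTo H.subtype (θ i) (∑ j, m j • φ j) ∧ ∀ j, ¬ c j ≤ b₀ → m j = 0 := by
      intro i
      by_cases hi : p i ≤ b₀
      · obtain ⟨h1, θ', h2⟩ := hrest i hi
        obtain ⟨m, hm⟩ := hφ.exists_coeff (mem_derModule_restriction h h2 h1)
        obtain ⟨m', hm', -, hdeg⟩ := exists_homogeneous_coeff hcφ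
          (h2.hasPDeg H.subtype_injective (hp i)) hm
        refine ⟨m', fun _ => ⟨hm' ▸ h2, fun j hj => ?_⟩⟩
        exact (hdeg j).resolve_left fun hh => hj (hh.1.trans hi)
      · exact ⟨0, fun hh => absurd hh hi⟩
    choose m hm using hm
    obtain ⟨f, hf0, ⟨i₀, hi₀⟩, hf⟩ := exists_relation m (Finset.univ.filter fun i => p i ≤ b₀)
      (Finset.univ.filter fun j => c j ≤ b₀) (by
        rw [card_filter_eq_countP p (· ≤ b₀), card_filter_eq_countP c (· ≤ b₀), hb₀,
          Multiset.countP_cons_of_pos (p := (· ≤ b₀)) _ le_rfl]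
        omega)
    choose F hF _ using fun i => exists_res_eq H.subtype_injective (f i)
    let F' : Fin (n + 1) → CoordRing K V := fun i => if p i ≤ b₀ then F i else 0
    have hF' : ∀ i, res H.subtype (F' i) = f i := by
      intro i
      simp only [F']
      split_ifs with hi
      · exact hF i
      · rw [map_zero, hf0 i (by simpa using hi)]
    have hzero : RestrictsTo H.subtype (∑ i, F' i • θ i) 0 := by
      intro β
      rw [der_sum_apply, map_sum, Derivation.zero_apply]
      have h1 : ∀ i, res H.subtype (F' i * θ i (linForm β)) =
          ∑ j, (f i * m i j) * φ j (linForm (β ∘ₗ H.subtype)) := by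
        intro i
        rw [map_mul, hF']
        by_cases hi : p i ≤ b₀
        · rw [← (hm i hi).1 β, der_sum_apply, Finset.mul_sum]
          exact Finset.sum_congr rfl fun j _ => (mul_assoc _ _ _).symm
        · have : f i = 0 := hf0 i (by simpa using hi)
          simp [this]
      simp only [h1]
      rw [Finset.sum_comm]
      symm
      refine Finset.sum_eq_zero fun j _ => ?_
      rw [← Finset.sum_mul]
      by_cases hj : c j ≤ b₀
      · rw [hf j (by simpa using hj), zero_mul]
      · rw [Finset.sum_eq_zero, zero_mul]
        intro i _
        by_cases hi : p i ≤ b₀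
        · rw [(hm i hi).2 j hj, mul_zero]
        · rw [hf0 i (by simpa using hi), zero_mul]
    -- The relation on H lifts to ∑ F' i θ i = α ζ with ζ in D(A'). Expanding ζ in the basis shows
    -- that α divides every F' i, so every f i would vanish.
    obtain ⟨ζ, hζ⟩ := exists_eq_smul_of_restrictsTo_zero H.subtype_injective hα0 hrange hzero
    have hζmem : ζ ∈ derModule (A.toMulti.deletion H) := by
      have h1 : linForm α • ζ ∈ derModule (A.toMulti.deletion H) := by
        rw [← hζ]
        exact Submodule.sum_mem _ fun i _ => Submodule.smul_mem _ _ (hb.mem i)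
      refine derModule_anti (fun H' => ?_) (mem_derModule_of_smul_mem hc hαk h1)
      by_cases hh : H' = H
      · subst hh
        rw [A.deletion_toMulti_mult_eq_erase, Finsupp.erase_same]
        exact Nat.zero_le _
      · rw [MultiArrangement.deletion_mult_of_ne _ hh, MultiArrangement.deletion_mult_of_ne _ hh,
          MultiArrangement.deletion_mult_of_ne _ hh]
    obtain ⟨g, hg⟩ := hb.exists_coeff hζmem
    have hli := Fintype.linearIndependent_iff.1 hb.li (fun i => F' i - linForm α * g i) (by
      simp only [sub_smul, Finset.sum_sub_distrib, mul_smul]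
      rw [← Finset.smul_sum, ← hg, hζ, sub_self])
    apply hi₀
    rw [← hF', sub_eq_zero.1 (hli i₀), hres]
    exact dvd_mul_right _ _

end

/-! ### Adapted bases for deletion -/

section

variable {W : Type v} [AddCommGroup W] [Module K W]

theorem der_sub_smul (a b : CoordRing K V) (θ : Der K V) : (a - b) • θ = a • θ - b • θ :=
  der_ext fun β => by simp [sub_mul]

theorem der_neg_smul (a : CoordRing K V) (θ : Der K V) : (-a) • θ = -(a • θ) :=
  der_ext fun β => by simp

/-- Let `φ` be a homogeneous family whose degrees arise from those of the homogeneous family `ψ`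
by omitting one degree. If all `ψᵢ` are combinations of the `φⱼ`, then some `ψᵢ` is a combination
of the others. -/
theorem exists_redundant {n : ℕ} {ψ : Fin (n + 1) → Der K V} {p : Fin (n + 1) → ℕ}
    {φ : Fin n → Der K V} {c : Fin n → ℕ} (hψ : ∀ i, HasPDeg (ψ i) (p i))
    (hφ : ∀ j, HasPDeg (φ j) (c j)) (hspan : ∀ i, ∃ m : Fin n → CoordRing K V,
      ψ i = ∑ j, m j • φ j) {b : ℕ}
    (hb : Finset.univ.val.map p = b ::ₘ Finset.univ.val.map c) :
    ∃ (i₀ : Fin (n + 1)) (g : Fin (n + 1) → CoordRing K V), g i₀ = 0 ∧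
      ψ i₀ = ∑ i, g i • ψ i := by
  classical
  -- Suppose that no ψ i is a combination of the others. In each degree below b the ψ i and φ j are
  -- equally many and, degree by degree, the φ j can be expressed by the ψ i; in degree b there is
  -- one ψ i too many.
  by_contra! hnot
  have hcoef : ∀ i, ∃ m : Fin n → CoordRing K V, ψ i = ∑ j, m j • φ j ∧
      ∀ j, (c j ≤ p i ∧ m j ∈ homogeneousPart K V (p i - c j)) ∨ m j = 0 := fun i => by
    obtain ⟨m, hm⟩ := hspan i
    obtain ⟨m', h1, -, h2⟩ := exists_homogeneous_coeff hφ (hψ i) hm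
    exact ⟨m', h1, h2⟩
  choose m hm hmdeg using hcoef
  have hconst : ∀ i j, ∃ k : K, p i = c j → m i j = algebraMap K _ k := by
    intro i j
    by_cases h : p i = c j
    · rcases hmdeg i j with h1 | h1
      · have := h1.2
        rw [h, Nat.sub_self, mem_homogeneousPart_zero_iff] at this
        obtain ⟨k, hk⟩ := this
        exact ⟨k, fun _ => hk⟩
      · exact ⟨0, fun _ => by rw [h1, RingHom.map_zero]⟩
    · exact ⟨0, fun hh => absurd hh h⟩
  choose k hk using hconst
  let L : ℕ → Submodule (CoordRing K V) (Der K V) := fun d =>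
    Submodule.span _ (ψ '' {i | p i < d})
  have hLmono : ∀ d d', d ≤ d' → L d ≤ L d' := fun d d' hdd =>
    Submodule.span_mono (Set.image_mono fun i (hi : p i < d) => lt_of_lt_of_le hi hdd)
  -- a constant combination of the `ψᵢ` of degree `d`, modulo the generators of lower degree
  have hcomb : ∀ d, (∀ j, c j < d → φ j ∈ L d) → ∀ f : Fin (n + 1) → K,
      (∀ i, p i ≠ d → f i = 0) →
      (∑ i, algebraMap K (CoordRing K V) (f i) • ψ i) -
        ∑ j with c j = d, algebraMap K (CoordRing K V) (∑ i, f i * k i j) • φ j ∈ L d := by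
    intro d hlow f hf
    have h1 : ∑ i, algebraMap K (CoordRing K V) (f i) • ψ i =
        ∑ j, (∑ i, algebraMap K (CoordRing K V) (f i) * m i j) • φ j := by
      simp only [Finset.sum_smul, mul_smul]
      rw [Finset.sum_comm]
      refine Finset.sum_congr rfl fun i _ => ?_
      rw [← Finset.smul_sum, ← hm i]
    rw [h1, Finset.sum_filter, ← Finset.sum_sub_distrib]
    refine Submodule.sum_mem _ fun j _ => ?_
    split_ifs with hj
    · have : ∑ i, algebraMap K (CoordRing K V) (f i) * m i j =
          algebraMap K _ (∑ i, f i * k i j) := by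
        rw [map_sum]
        refine Finset.sum_congr rfl fun i _ => ?_
        by_cases hi : p i = d
        · rw [hk i j (hi.trans hj.symm), map_mul]
        · rw [hf i hi, RingHom.map_zero, zero_mul, zero_mul, RingHom.map_zero]
      rw [this, sub_self]
      exact Submodule.zero_mem _
    · rw [sub_zero]
      rcases lt_or_gt_of_ne hj with hlt | hgt
      · exact Submodule.smul_mem _ _ (hlow j hlt)
      · rw [Finset.sum_eq_zero, zero_smul]
        · exact Submodule.zero_mem _
        · intro i _
          by_cases hi : p i = d
          · rw [(hmdeg i j).resolve_left (fun hh => by omega), mul_zero]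
          · rw [hf i hi, RingHom.map_zero, zero_mul]
  -- constant relations are impossible
  have hnorel : ∀ d, ∀ f : Fin (n + 1) → K, (∀ i, p i ≠ d → f i = 0) → (∃ i, f i ≠ 0) →
      ∑ i, algebraMap K (CoordRing K V) (f i) • ψ i ∉ L d := by
    rintro d f hf ⟨i₀, hi₀⟩ hmem
    have hp0 : p i₀ = d := by
      by_contra hne
      exact hi₀ (hf i₀ hne)
    obtain ⟨l, hl, hl'⟩ := (Finsupp.mem_span_image_iff_linearCombination _).1 hmem
    have hl0 : ∀ i, ¬ p i < d → l i = 0 := fun i hi => by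
      by_contra hne
      exact hi (hl (Finsupp.mem_support_iff.2 hne))
    rw [Finsupp.linearCombination_apply, Finsupp.sum_fintype] at hl'
    swap
    · exact fun i => zero_smul _ _
    let g : Fin (n + 1) → CoordRing K V := fun i =>
      if i = i₀ then 0 else algebraMap K _ (f i₀)⁻¹ * (l i - algebraMap K _ (f i))
    refine hnot i₀ g (by simp [g]) ?_
    have h1 : ∑ i, (l i - algebraMap K (CoordRing K V) (f i)) • ψ i = 0 := by
      simp only [der_sub_smul, Finset.sum_sub_distrib]
      rw [hl', sub_self]
    rw [← Finset.add_sum_erase _ _ (Finset.mem_univ i₀), hl0 i₀ (by omega), zero_sub] at h1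
    rw [← Finset.add_sum_erase _ _ (Finset.mem_univ i₀)]
    have h2 : ∑ i ∈ Finset.univ.erase i₀, g i • ψ i = algebraMap K (CoordRing K V) (f i₀)⁻¹ •
        ∑ i ∈ Finset.univ.erase i₀, (l i - algebraMap K (CoordRing K V) (f i)) • ψ i := by
      rw [Finset.smul_sum]
      refine Finset.sum_congr rfl fun i hi => ?_
      simp only [g, if_neg (Finset.ne_of_mem_erase hi), mul_smul]
    rw [h2, show g i₀ = 0 by simp [g], zero_smul, zero_add,
      eq_neg_of_add_eq_zero_right h1, der_neg_smul, neg_neg, smul_smul, ← map_mul,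
      inv_mul_cancel₀ hi₀, RingHom.map_one, one_smul]
  -- the `φⱼ` of degree less than `b` are generated by the `ψᵢ`
  have hgen : ∀ d, d ≤ b → ∀ j, c j < d → φ j ∈ L d := by
    intro d
    induction d with
    | zero => intro _ j hj; omega
    | succ d ih =>
      intro hd j hj
      rcases Nat.lt_succ_iff_lt_or_eq.1 hj with hlt | heq
      · exact hLmono d (d + 1) (Nat.le_succ d) (ih (by omega) j hlt)
      have hlow := ih (by omega)
      -- A row standing for φ j joins those of the ψ i of degree d, so that rows outnumber columns.
      -- The new row must occur in the relation, since otherwise the ψ i would satisfy a constant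
      -- relation modulo lower degrees.
      obtain ⟨f, hf0, hfne, hf⟩ := exists_relation
        (fun (i : Option (Fin (n + 1))) j' => i.elim (if j' = j then (1 : K) else 0)
          fun i => k i j')
        (Finset.insertNone (Finset.univ.filter fun i => p i = d))
        (Finset.univ.filter fun j' => c j' = d) (by
          rw [Finset.card_insertNone, card_filter_eq_countP p (· = d),
            card_filter_eq_countP c (· = d), hb,
            Multiset.countP_cons_of_neg (p := (· = d)) _ (by omega)]
          omega)
      have hf0' : ∀ i, p i ≠ d → f (some i) = 0 := fun i hi => hf0 _ (by simpa using hi)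
      have hcm := hcomb d hlow (fun i => f (some i)) hf0'
      have hcoef : ∀ j', c j' = d → ∑ i, f (some i) * k i j' = - if j' = j then f none else 0 := by
        intro j' hj'
        have h1 := hf j' (by simpa using hj')
        rw [Fintype.sum_option] at h1
        simp only [Option.elim, mul_ite, mul_one, mul_zero] at h1
        linear_combination h1
      have hsum : ∑ j' with c j' = d, algebraMap K (CoordRing K V)
          (∑ i, f (some i) * k i j') • φ j' = algebraMap K (CoordRing K V) (-f none) • φ j := by
        rw [Finset.sum_eq_single j]
        · rw [hcoef j heq, if_pos rfl]
        · intro j' hj' hne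
          rw [hcoef j' (by simpa using hj'), if_neg hne, neg_zero, RingHom.map_zero, zero_smul]
        · intro h
          exact absurd (by simpa using heq) h
      rw [hsum] at hcm
      by_cases hnone : f none = 0
      · exfalso
        rw [hnone, neg_zero, RingHom.map_zero, zero_smul, sub_zero] at hcm
        refine hnorel d _ hf0' ?_ hcm
        obtain ⟨i, hi⟩ := hfne
        cases i with
        | none => exact absurd hnone hi
        | some i => exact ⟨i, hi⟩
      · have hin : ∑ i, algebraMap K (CoordRing K V) (f (some i)) • ψ i ∈ L (d + 1) := by
          refine Submodule.sum_mem _ fun i _ => ?_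
          by_cases hi : p i = d
          · exact Submodule.smul_mem _ _ (Submodule.subset_span ⟨i, by
              simp [hi], rfl⟩)
          · rw [hf0' i hi, RingHom.map_zero, zero_smul]
            exact Submodule.zero_mem _
        have h3 := Submodule.sub_mem _ hin (hLmono d (d + 1) (Nat.le_succ d) hcm)
        rw [sub_sub_cancel] at h3
        have h4 := Submodule.smul_mem _ (algebraMap K (CoordRing K V) (-f none)⁻¹) h3
        rwa [smul_smul, ← map_mul, inv_mul_cancel₀ (neg_ne_zero.2 hnone), RingHom.map_one,
          one_smul] at h4
  -- In degree b the rows outnumber the columns without any addition.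
  obtain ⟨f, hf0, hfne, hf⟩ := exists_relation k (Finset.univ.filter fun i => p i = b)
    (Finset.univ.filter fun j => c j = b) (by
      rw [card_filter_eq_countP p (· = b), card_filter_eq_countP c (· = b), hb,
        Multiset.countP_cons_of_pos (p := (· = b)) _ rfl]
      omega)
  have hf0' : ∀ i, p i ≠ b → f i = 0 := fun i hi => hf0 _ (by simpa using hi)
  have hcm := hcomb b (hgen b le_rfl) f hf0'
  rw [Finset.sum_eq_zero (s := Finset.univ.filter fun j => c j = b), sub_zero] at hcm
  · exact hnorel b f hf0' hfne hcm
  · intro j hj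
    rw [hf j hj, RingHom.map_zero, zero_smul]

/-- Adapted bases in the situation of the deletion theorem. -/
theorem exists_isAdaptedBasis_of_delete [FiniteDimensional K V] {n : ℕ}
    (hn : finrank K V = n + 1) {A : Arrangement K V} {H : Submodule K V} (h : H ∈ A.hyperplanes)
    {e e'' : Multiset ℕ} (he : HasExponents A.toMulti e)
    (he'' : HasExponents (A.restriction H h).toMulti e'') (hle : e'' ≤ e) :
    ∃ (η : Der K V) (θ : Fin n → Der K V) (a : ℕ) (d : Fin n → ℕ),
      IsAdaptedBasis A.toMulti H η θ a d := by
  classical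
  have hH : H ∈ A.toMulti.hyperplanes := by rwa [A.toMulti_hyperplanes]
  have hc := A.isCoatom H h
  have hnH : finrank K H = n := by
    have := finrank_eq_of_isCoatom hc
    omega
  obtain ⟨x⟩ := exists_basis_dual hn
  obtain ⟨b, hb⟩ := exists_eq_cons_of_le hle ((card_of_hasExponents he'').trans hnH)
    ((card_of_hasExponents he).trans hn)
  obtain ⟨θ, p, hbas, hp, rfl⟩ := he.exists_isDerBasis hn
  obtain ⟨φ, c, hφ, hcφ, rfl⟩ := he''.exists_isDerBasis hnH
  have hα0 : formOf H ≠ 0 := formOf_ne_zero hc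
  have hαk : LinearMap.ker (formOf H) = H := ker_formOf hc
  have hrange : LinearMap.range H.subtype = LinearMap.ker (formOf H) := by
    rw [hαk, Submodule.range_subtype]
  choose ψ hψ using fun i => exists_restrictsTo_of_dvd H.subtype_injective hrange (by
    have := dvd_of_mem_derModule (hbas.mem i) hc hαk
    rwa [A.toMulti_mult, if_pos h, pow_one] at this)
  have hψdeg := fun i => (hψ i).hasPDeg H.subtype_injective (hp i)
  obtain ⟨i₀, g, hg0, hg⟩ := exists_redundant hψdeg hcφ (fun i =>
    hφ.exists_coeff (mem_derModule_restriction h (hψ i) (hbas.mem i))) hb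
  obtain ⟨g', hg', hg'0, hg'deg⟩ := exists_homogeneous_coeff hψdeg (hψdeg i₀) hg
  choose G hG hGdeg using fun i => exists_res_eq H.subtype_injective (g' i)
  -- Zero coefficients are kept zero explicitly: for them there is no bound on p i, and the
  -- combination must stay homogeneous.
  let c' : Fin (n + 1) → CoordRing K V := fun i => if i = i₀ then 1 else
    if g' i = 0 then 0 else - G i
  have hupd := hbas.update_of_isUnit x i₀ c' (by simp [c'])
  -- The redundancy lifted to V makes the new member restrict to zero on H, so it has the form α η.
  have hrestr : RestrictsTo H.subtype (∑ i, c' i • θ i) 0 := by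
    have h1 := RestrictsTo.sum Finset.univ c' fun i _ => hψ i
    have h2 : ∑ i, res H.subtype (c' i) • ψ i = 0 := by
      rw [← Finset.add_sum_erase _ _ (Finset.mem_univ i₀)]
      simp only [c', if_true]
      rw [map_one, one_smul, hg', ← Finset.add_sum_erase _ _ (Finset.mem_univ i₀),
        hg'0 i₀ hg0, zero_smul, zero_add, ← Finset.sum_add_distrib]
      refine Finset.sum_eq_zero fun i hi => ?_
      rw [if_neg (Finset.ne_of_mem_erase hi)]
      split_ifs with h0
      · rw [h0, map_zero, zero_smul, add_zero]
      · rw [map_neg, hG, ← add_smul, add_neg_cancel, zero_smul]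
    rwa [h2] at h1
  have hdeg : HasPDeg (∑ i, c' i • θ i) (p i₀) := by
    intro β
    rw [der_sum_apply]
    refine Submodule.sum_mem _ fun i _ => ?_
    simp only [c']
    split_ifs with h1 h2
    · rw [one_mul, h1]
      exact hp i₀ β
    · rw [zero_mul]
      exact Submodule.zero_mem _
    · obtain ⟨h3, h4⟩ := (hg'deg i).resolve_right h2
      rw [neg_mul]
      refine Submodule.neg_mem _ ?_
      have := mul_mem_homogeneousPart (hGdeg i _ h4) (hp i β)
      rwa [Nat.sub_add_cancel h3] at this
  obtain ⟨η, hη⟩ := exists_eq_smul_of_restrictsTo_zero H.subtype_injective hα0 hrange hrestr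
  have hcons := hupd.cons_succAbove i₀
  rw [Function.update_self, hη] at hcons
  have hθ : (fun i => Function.update θ i₀ (∑ i, c' i • θ i) (i₀.succAbove i)) =
      fun i => θ (i₀.succAbove i) := by
    funext i
    rw [Function.update_of_ne (Fin.succAbove_ne i₀ i)]
  rw [← hη] at hcons
  rw [hθ, hη] at hcons
  have hne : linForm (formOf H) • η ≠ 0 := hcons.li.ne_zero 0
  rw [hη] at hdeg
  obtain ⟨a, ha⟩ : ∃ a, HasPDeg η a := by
    rcases Nat.eq_zero_or_pos (p i₀) with h0 | hpos
    · refine absurd (der_ext fun β => ?_) hne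
      have h1 := hdeg β
      rw [h0, Derivation.smul_apply, smul_eq_mul] at h1
      exact eq_zero_of_mul_mem_of_lt Nat.zero_lt_one (linForm_mem _) h1
    · refine ⟨p i₀ - 1, HasPDeg.of_smul (linForm_mem _) (linForm_ne_zero hα0) (η := η) ?_⟩
      rwa [Nat.add_sub_cancel' hpos]
  exact ⟨η, fun i => θ (i₀.succAbove i), a, fun i => p (i₀.succAbove i),
    hcons.of_smul_cons x hH hαk, fun i => hbas.mem _, ha, fun i => hp _⟩

end

/-! ### Bases of simple and Ziegler restrictions -/

section

variable {W : Type v} [AddCommGroup W] [Module K W]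

/-! ### Bases of restrictions -/

/-- On H the determinant of η, θᵢ becomes η(α) times that of the θᵢ', and it is associated to B
Q(A''). As B divides η(α) on H, it cancels, leaving the determinant of the θᵢ' as a divisor of
Q(A''). -/
theorem IsAdaptedBasis.isDerBasis_restriction [FiniteDimensional K V] {n : ℕ}
    {A : Arrangement K V} {H : Submodule K V} (h : H ∈ A.hyperplanes) {η : Der K V}
    {θ : Fin n → Der K V} {a : ℕ} {d : Fin n → ℕ} (hb : IsAdaptedBasis A.toMulti H η θ a d)
    {θ' : Fin n → Der K H} (hθ' : ∀ i, RestrictsTo H.subtype (θ i) (θ' i))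
    (y : Basis (Fin n) K (Dual K H)) : IsDerBasis (A.restriction H h).toMulti θ' := by
  have hc := A.isCoatom H h
  have hmem := fun i => mem_derModule_restriction h (hθ' i) (hb.mem i)
  refine isDerBasis_of_det y hmem (associated_of_dvd_dvd ?_ (defPoly_dvd_det y hmem))
  obtain ⟨x, hx0, hx⟩ := exists_basis_cons H.subtype_injective (formOf_ne_zero hc)
    (by rw [ker_formOf hc, Submodule.range_subtype]) y
  obtain ⟨D, hD, hD'⟩ := exists_det_cons (x := x) (y := y) (j := H.subtype)
    (comp_eq_zero_of_range (by rw [hx0, ker_formOf hc, Submodule.range_subtype])) hx hθ'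
    (η := η) (k := 0) (g := η (linForm (x 0))) (by simp) (fun i => by
      have := dvd_of_mem_derModule (hb.mem i) hc (ker_formOf hc)
      rwa [A.toMulti_mult, if_pos h, ← hx0] at this)
  rw [pow_zero, one_mul] at hD
  obtain ⟨b, B, hB0, -, -, hBQ, hB⟩ := exists_polynomial_B h
  obtain ⟨q, hq⟩ := hB η (hb.basis.mem 0)
  have h1 := (hb.basis.det_associated x).map (res H.subtype)
  rw [hD, hD', hx0, hq] at h1
  have h2 := (h1.trans hBQ.symm).dvd
  rw [mul_assoc] at h2
  exact (dvd_mul_left _ _).trans ((mul_dvd_mul_iff_left hB0).1 h2)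

theorem der_linForm_eq_zero_of_range {j : W →ₗ[K] V} {α : Dual K V}
    (hr : LinearMap.range j = LinearMap.ker α) {θ : Der K V} (h : θ (linForm α) = 0)
    (β : Dual K V) (hβ : β ∘ₗ j = 0) : θ (linForm β) = 0 := by
  obtain ⟨c, rfl⟩ := eq_smul_of_comp_eq_zero hr hβ
  rw [der_smul_linForm, h, mul_zero]

/-- Ziegler's theorem on the multirestriction of a free arrangement. -/
theorem IsDerBasis.pull_of_range_eq_ker {n : ℕ} {A : Arrangement K V} {α : Dual K V}
    (hα : LinearMap.ker α ∈ A.hyperplanes) {θ : Fin n → Der K V}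
    (hb : IsDerBasis A.toMulti (Fin.cons (euler K V) θ)) (h0 : ∀ i, θ i (linForm α) = 0)
    {j : W →ₗ[K] V} (hj : Function.Injective j) (hr : LinearMap.range j = LinearMap.ker α)
    {θ' : Fin n → Der K W} (hθ' : ∀ i, RestrictsTo j (θ i) (θ' i))
    (y : Basis (Fin n) K (Dual K W)) : IsDerBasis (A.toMulti.pull j) θ' := by
  have hc := A.isCoatom _ hα
  have hα0 := ne_zero_of_ker_eq hc rfl
  have hα' : LinearMap.ker α ∈ A.toMulti.hyperplanes := by rwa [A.toMulti_hyperplanes]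
  refine isDerBasis_of_det y (fun i => mem_derModule_pull hj (hθ' i) (hb.mem i.succ)
    (der_linForm_eq_zero_of_range hr (h0 i))) ?_
  obtain ⟨x, hx0, hx⟩ := exists_basis_cons hj hα0 hr y
  -- The Euler derivation takes the value α at α and the θ i kill α; hence `k = 1` and `g = 1`.
  obtain ⟨D, hD, hD'⟩ := exists_det_cons (x := x) (y := y) (j := j)
    (comp_eq_zero_of_range (by rw [hx0, hr])) hx hθ'
    (η := euler K V) (k := 1) (g := 1) (by simp) (fun i => by
      rw [hx0, h0]
      exact dvd_zero _)
  have h1 := hb.det_associated x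
  rw [hD, pow_one, hx0, A.toMulti.defPoly_eq_mul hα', mul_comm] at h1
  have h2 := (Associated.of_mul_right h1 (associated_linForm (formOf_ne_zero hc)
    (ker_formOf hc).symm) (linForm_ne_zero hα0)).map (res j)
  rw [hD', map_one, one_mul] at h2
  refine h2.trans ?_
  have htop : (LinearMap.ker α).comap j = ⊤ := (comap_eq_top_iff hc hc hr).2 rfl
  -- `ker α` leaves no trace, so it may be deleted beforehand; no remaining equation vanishes on the
  -- range.
  rw [← A.toMulti.pull_deletion_of_eq_top hα' htop]
  refine res_powProd _ j (fun H hH => (A.toMulti.deletion _).isCoatom H hH) fun H hH ht => ?_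
  have h3 := (comap_eq_top_iff ((A.toMulti.deletion _).isCoatom H hH) hc hr).1 ht
  rw [Finsupp.mem_support_iff, h3, MultiArrangement.deletion_mult_self, A.toMulti_mult,
    if_pos hα] at hH
  exact hH rfl

theorem IsDerBasis.pull_of_range_eq_top {n : ℕ} {M : MultiArrangement K V} {θ : Fin n → Der K V}
    (hb : IsDerBasis M θ) {j : W →ₗ[K] V} (hj : Function.Injective j)
    (hr : LinearMap.range j = ⊤) {θ' : Fin n → Der K W}
    (hθ' : ∀ i, RestrictsTo j (θ i) (θ' i)) (y : Basis (Fin n) K (Dual K W)) :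
    IsDerBasis (M.pull j) θ' := by
  have hsurj := LinearMap.range_eq_top.1 hr
  refine isDerBasis_of_det y (fun i => mem_derModule_pull hj (hθ' i) (hb.mem i)
    fun β hβ => ?_) ?_
  · have : β = 0 := by
      ext v
      obtain ⟨w, rfl⟩ := hsurj v
      exact LinearMap.congr_fun hβ w
    rw [this, linForm_zero, map_zero]
  · let e := LinearEquiv.ofBijective j ⟨hj, hsurj⟩
    let x : Basis (Fin n) K (Dual K V) := y.map e.symm.dualMap
    have hx : ∀ i, x i ∘ₗ j = y i := fun i => by
      ext w
      have : e.symm (j w) = w := e.symm_apply_apply w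
      simp [x, this]
    rw [det_coeffMatrix_restrictsTo hx hθ']
    refine ((hb.det_associated x).map (res j)).trans
      (res_powProd _ j M.isCoatom fun H hH ht => (M.isCoatom H hH).1 ?_)
    rw [eq_top_iff, ← hr, ← Submodule.map_top, ← ht]
    exact Submodule.map_comap_le _ _

theorem exists_restrictsTo_of_range_eq_top {j : W →ₗ[K] V} (hj : Function.Injective j)
    (hr : LinearMap.range j = ⊤) (θ : Der K V) : ∃ θ' : Der K W, RestrictsTo j θ θ' := by
  refine exists_restrictsTo hj fun β hβ => ?_
  have : β = 0 := by
    ext v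
    obtain ⟨w, rfl⟩ := LinearMap.range_eq_top.1 hr v
    exact LinearMap.congr_fun hβ w
  rw [this, linForm_zero, map_zero, map_zero]

theorem RestrictsTo.of_comp {U : Type v} [AddCommGroup U] [Module K U] {i : U →ₗ[K] W}
    {j : W →ₗ[K] V} (hj : Function.Injective j) {θ : Der K V} {θ' : Der K W} {θ'' : Der K U}
    (h : RestrictsTo j θ θ') (h' : RestrictsTo (j ∘ₗ i) θ θ'') : RestrictsTo i θ' θ'' := fun γ => by
  obtain ⟨β, rfl⟩ := exists_comp_eq hj γ
  rw [LinearMap.comp_assoc, h', h, res_res]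

theorem MultiArrangement.pull_pull {U : Type v} [AddCommGroup U] [Module K U]
    (M : MultiArrangement K V) (j : W →ₗ[K] V) (i : U →ₗ[K] W) :
    (M.pull j).pull i = M.pull (j ∘ₗ i) := by
  ext1
  change pullMult (pullMult M.mult j) i = pullMult M.mult (j ∘ₗ i)
  induction M.mult using Finsupp.induction_linear with
  | zero => simp [pullMult]
  | add f g hf hg => rw [pullMult_add, pullMult_add, pullMult_add, hf, hg]
  | single H k =>
    by_cases h : H.comap j = ⊤
    · rw [pullMult_single_of_eq_top h, pullMult_single_of_eq_top (by
        rw [Submodule.comap_comp, h, Submodule.comap_top])]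
      simp [pullMult]
    · rw [pullMult_single h]
      by_cases h' : (H.comap j).comap i = ⊤
      · rw [pullMult_single_of_eq_top h', pullMult_single_of_eq_top (by
          rw [Submodule.comap_comp, h'])]
      · rw [pullMult_single h', pullMult_single (by rwa [Submodule.comap_comp]),
          Submodule.comap_comp]

theorem MultiArrangement.restrictSet_pull_subtype (M : MultiArrangement K V) (L : Submodule K V)
    (hL : L ∈ M.hyperplanes) :
    restrictSet M.hyperplanes L = (M.pull L.subtype).hyperplanes := by
  have hLc := M.isCoatom L hL
  ext Z
  rw [mem_pull_hyperplanes]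
  constructor
  · rintro ⟨H, ⟨hH, hne⟩, rfl⟩
    exact ⟨(isCoatom_comap_subtype hLc (M.isCoatom H hH) hne).1, H, hH, rfl⟩
  · rintro ⟨hZ, H, hH, rfl⟩
    refine ⟨H, ⟨hH, ?_⟩, rfl⟩
    rintro (rfl : H = L)
    exact hZ (by simp)

/-! ### Moving the Euler derivation into the basis -/

theorem IsDerBasis.cons_comp_equiv {n : ℕ} {M : MultiArrangement K V} {η : Der K V}
    {θ : Fin n → Der K V} (h : IsDerBasis M (Fin.cons η θ : Fin (n + 1) → Der K V))
    (σ : Equiv.Perm (Fin n)) : IsDerBasis M (Fin.cons η (θ ∘ σ) : Fin (n + 1) → Der K V) := by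
  have h1 := h.comp_equiv (Equiv.Perm.decomposeFin.symm (0, σ))
  convert h1 using 1
  funext i
  refine Fin.cases ?_ (fun i => ?_) i
  · simp
  · simp

theorem IsDerBasis.cons_swap {n : ℕ} {M : MultiArrangement K V} {η ζ : Der K V}
    {θ : Fin n → Der K V}
    (h : IsDerBasis M (Fin.cons η (Fin.cons ζ θ : Fin (n + 1) → Der K V) :
      Fin (n + 2) → Der K V)) :
    IsDerBasis M (Fin.cons ζ (Fin.cons η θ : Fin (n + 1) → Der K V) :
      Fin (n + 2) → Der K V) := by
  have h1 := h.comp_equiv (Equiv.swap 0 1)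
  convert h1 using 1
  funext i
  refine Fin.cases ?_ (fun i => ?_) i
  · simp
  · refine Fin.cases ?_ (fun i => ?_) i
    · simp
    · simp [Equiv.swap_apply_of_ne_of_ne, Fin.ext_iff]

/-- The Euler derivation expands in the basis α η, θₖ of D(A) with only members of degree at most 1.
If no θₖ of degree 1 occurred, evaluation at the equation of `H₁`, which every θₖ of degree 0 kills,
would make it a multiple of α. So some θₖ of degree 1 occurs, with a constant coefficient, and can
be exchanged. -/
theorem IsAdaptedBasis.exists_cons_euler {n : ℕ} (x : Basis (Fin (n + 1)) K (Dual K V))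
    {A : Arrangement K V} {H H₁ : Submodule K V}
    (h : H ∈ A.hyperplanes) (h₁ : H₁ ∈ A.hyperplanes) (hne : H₁ ≠ H) {η : Der K V}
    {θ : Fin n → Der K V} {a : ℕ} {d : Fin n → ℕ} (hb : IsAdaptedBasis A.toMulti H η θ a d) :
    ∃ (m : ℕ) (θ' : Fin m → Der K V) (d' : Fin m → ℕ), n = m + 1 ∧
      IsAdaptedBasis A.toMulti H η (Fin.cons (euler K V) θ' : Fin (m + 1) → Der K V) a
        (Fin.cons 1 d' : Fin (m + 1) → ℕ) := by
  have hH : H ∈ A.toMulti.hyperplanes := by rwa [A.toMulti_hyperplanes]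
  have hc := A.isCoatom H h
  have hc₁ := A.isCoatom H₁ h₁
  set α := formOf H with hα
  have hαk : LinearMap.ker α = H := ker_formOf hc
  have hrange : LinearMap.range H.subtype = LinearMap.ker α := by
    rw [hαk, Submodule.range_subtype]
  have hM := hb.basis.smul_cons x hH hαk hb.mem
  have hdeg : ∀ i, HasPDeg ((Fin.cons (linForm α • η) θ : Fin (n + 1) → Der K V) i)
      ((Fin.cons (1 + a) d : Fin (n + 1) → ℕ) i) := fun i => by
    refine Fin.cases ?_ (fun i => ?_) i
    · have := hb.hasPDeg_left.smul (linForm_mem α)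
      simpa using this
    · exact hb.hasPDeg_right i
  obtain ⟨c₀, hc₀⟩ := hM.exists_coeff (euler_mem_derModule A)
  obtain ⟨c, hcs, -, hcd⟩ := exists_homogeneous_coeff hdeg euler_hasPDeg hc₀
  obtain ⟨k, hk1, hk0⟩ : ∃ k, d k = 1 ∧ c k.succ ≠ 0 := by
    by_contra! hno
    set β := formOf H₁ with hβ
    have h1 : ∀ k, c k.succ * θ k (linForm β) = 0 := fun k => by
      rcases hcd k.succ with ⟨hle, -⟩ | h0
      · by_cases hk : d k = 1
        · rw [hno k hk, zero_mul]
        · have hk0 : d k = 0 := by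
            have : d k ≤ 1 := hle
            omega
          have h2 := dvd_of_mem_derModule (hb.mem k) hc₁ (ker_formOf hc₁)
          rw [A.toMulti_mult, if_pos h₁, pow_one] at h2
          obtain ⟨g, hg⟩ := h2
          have h3 := hb.hasPDeg_right k β
          rw [hk0, hg] at h3
          rw [hg, eq_zero_of_mul_mem_of_lt Nat.zero_lt_one (linForm_mem _) h3, mul_zero]
      · rw [h0, zero_mul]
    have h2 : linForm β = c 0 * (linForm α * η (linForm β)) := by
      have h3 := euler_linForm β
      rw [hcs, der_sum_apply, Fin.sum_univ_succ] at h3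
      simpa [h1] using h3.symm
    have h3 := congrArg (res H.subtype) h2
    rw [map_mul, map_mul, res_linForm, res_linForm, comp_eq_zero_of_range hrange, linForm_zero,
      zero_mul, mul_zero, ← linForm_zero] at h3
    have h4 := linForm_injective h3
    have h5 : H ≤ H₁ := by
      intro v hv
      rw [← ker_formOf hc₁, LinearMap.mem_ker]
      exact LinearMap.congr_fun h4 ⟨v, hv⟩
    exact hne ((hc.le_iff.1 h5).resolve_left hc₁.1)
  obtain ⟨u, hu⟩ : ∃ u : K, c k.succ = algebraMap K _ u := by
    have := ((hcd k.succ).resolve_right hk0).2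
    simp only [Fin.cons_succ, hk1] at this
    rwa [Nat.sub_self, mem_homogeneousPart_zero_iff] at this
  have hu0 : u ≠ 0 := by
    rintro rfl
    exact hk0 (by rw [hu, RingHom.map_zero])
  -- The expansion in the basis of D(A) is also one in that of D(A'), with c 0 α as the coefficient
  -- of η.
  have h1 := hb.basis.update_of_isUnit x k.succ
    (Fin.cons (c 0 * linForm α) fun i => c i.succ) (by
      rw [Fin.cons_succ, hu]
      exact isUnit_algebraMap hu0)
  have h2 : ∑ i, (Fin.cons (c 0 * linForm α) fun i => c i.succ : Fin (n + 1) → CoordRing K V) i •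
      (Fin.cons η θ : Fin (n + 1) → Der K V) i = euler K V := by
    rw [hcs, Fin.sum_univ_succ, Fin.sum_univ_succ]
    simp [mul_smul]
  rw [h2, ← Fin.cons_update] at h1
  obtain ⟨m, rfl⟩ : ∃ m, n = m + 1 := ⟨n - 1, by have := k.2; omega⟩
  have h3 := h1.cons_comp_equiv k.cycleRange.symm
  have h4 : Function.update θ k (euler K V) ∘ k.cycleRange.symm =
      (Fin.cons (euler K V) fun i => θ (k.succAbove i) : Fin (m + 1) → Der K V) := by
    funext i
    refine Fin.cases ?_ (fun i => ?_) i
    · simp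
    · simp
  rw [h4] at h3
  refine ⟨m, fun i => θ (k.succAbove i), fun i => d (k.succAbove i), rfl, h3, fun i => ?_,
    hb.hasPDeg_left, fun i => ?_⟩
  · exact Fin.cases (euler_mem_derModule A) (fun i => hb.mem _) i
  · exact Fin.cases euler_hasPDeg (fun i => hb.hasPDeg_right _) i

/-- A multiple of the Euler derivation can be added to make a derivation kill `α`. -/
theorem exists_add_euler {α : Dual K V} (hα : α ≠ 0) {θ : Der K V} {p : ℕ} (hp : HasPDeg θ p)
    (h : linForm α ∣ θ (linForm α)) : ∃ g : CoordRing K V, HasPDeg (g • euler K V) p ∧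
      (θ + g • euler K V) (linForm α) = 0 ∧ θ (linForm α) = -(linForm α * g) := by
  obtain ⟨q, hq⟩ := h
  refine ⟨-q, ?_, ?_, by rw [hq]; ring⟩
  · by_cases h0 : q = 0
    · intro β
      simp [h0]
    · have h1 := hp α
      rw [hq] at h1
      obtain ⟨s, rfl, hs⟩ := degree_of_pow_mul_mem (linForm_mem α) h1
        (mul_ne_zero (linForm_ne_zero hα) h0)
      have := (euler_hasPDeg (K := K) (V := V)).smul (Submodule.neg_mem _ hs)
      rwa [add_comm] at this
  · rw [Derivation.add_apply, Derivation.smul_apply, euler_linForm, hq, smul_eq_mul]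
    ring

theorem IsDerBasis.cons_add_euler {n : ℕ} (x : Basis (Fin (n + 1)) K (Dual K V))
    {M : MultiArrangement K V} {θ : Fin n → Der K V}
    (h : IsDerBasis M (Fin.cons (euler K V) θ : Fin (n + 1) → Der K V))
    (g : Fin n → CoordRing K V) :
    IsDerBasis M (Fin.cons (euler K V) fun i => θ i + g i • euler K V :
      Fin (n + 1) → Der K V) :=
  h.add_smul x 0 (Fin.cons 0 g) (by simp) fun i => by
    refine Fin.cases ?_ (fun i => ?_) i <;> simp

theorem HasPDeg.add {θ η : Der K V} {p : ℕ} (h : HasPDeg θ p) (h' : HasPDeg η p) :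
    HasPDeg (θ + η) p := fun α => by
  rw [Derivation.add_apply]
  exact Submodule.add_mem _ (h α) (h' α)

/-- Once the Euler derivation is a member of the basis, adding multiples of it to the others, η
included, is a row operation. -/
theorem IsAdaptedBasis.add_euler {m : ℕ} (x : Basis (Fin (m + 2)) K (Dual K V))
    {A : Arrangement K V} {H : Submodule K V} {η : Der K V} {θ : Fin m → Der K V} {a : ℕ}
    {d : Fin m → ℕ}
    (hb : IsAdaptedBasis A.toMulti H η (Fin.cons (euler K V) θ : Fin (m + 1) → Der K V) a
      (Fin.cons 1 d : Fin (m + 1) → ℕ)) {f : CoordRing K V} (hf : HasPDeg (f • euler K V) a)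
    {g : Fin m → CoordRing K V} (hg : ∀ i, HasPDeg (g i • euler K V) (d i)) :
    IsAdaptedBasis A.toMulti H (η + f • euler K V)
      (Fin.cons (euler K V) fun i => θ i + g i • euler K V : Fin (m + 1) → Der K V) a
      (Fin.cons 1 d : Fin (m + 1) → ℕ) := by
  refine ⟨?_, fun i => ?_, hb.hasPDeg_left.add hf, fun i => ?_⟩
  · have h1 := hb.basis.cons_swap.cons_add_euler x (Fin.cons f g)
    have h2 : (fun i => (Fin.cons η θ : Fin (m + 1) → Der K V) i +
        (Fin.cons f g : Fin (m + 1) → CoordRing K V) i • euler K V) =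
        (Fin.cons (η + f • euler K V) fun i => θ i + g i • euler K V :
          Fin (m + 1) → Der K V) := by
      funext i
      refine Fin.cases ?_ (fun i => ?_) i <;> simp
    rw [h2] at h1
    exact h1.cons_swap
  · refine Fin.cases (euler_mem_derModule A) (fun i => ?_) i
    exact Submodule.add_mem _ (hb.mem i.succ)
      (Submodule.smul_mem _ _ (euler_mem_derModule A))
  · exact Fin.cases euler_hasPDeg (fun i => (hb.hasPDeg_right i.succ).add (hg i)) i

end

/-! ### Addition and deletion for pull-backs -/

section

variable {W : Type v} [AddCommGroup W] [Module K W]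

/-! ### Recursive freeness -/

theorem map_univ_fin_cons {n : ℕ} (a : ℕ) (d : Fin n → ℕ) :
    Finset.univ.val.map (Fin.cons a d : Fin (n + 1) → ℕ) = a ::ₘ Finset.univ.val.map d := by
  simp [Fin.univ_val_map, List.ofFn_succ]

theorem finrank_eq_of_basis_dual {n : ℕ} [FiniteDimensional K V] (y : Basis (Fin n) K (Dual K V)) :
    finrank K V = n := by
  rw [← Subspace.dual_finrank_eq, finrank_eq_card_basis y, Fintype.card_fin]

/-- The exponents are a, d for M', a + 1, d for M, and d for N, which is the Euler restriction by
`isEulerRestriction_of_det`. Hence addition and deletion are both available. -/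
theorem IsAdaptedBasis.isRecursivelyFree_iff [FiniteDimensional K V] {n : ℕ}
    {M : MultiArrangement K V} {H : Submodule K V} (hH : H ∈ M.hyperplanes) {η : Der K V}
    {θ : Fin n → Der K V} {a : ℕ} {d : Fin n → ℕ} (hb : IsAdaptedBasis M H η θ a d)
    {N : MultiArrangement K H} (hN : N.IsRecursivelyFree)
    (hNhyp : N.hyperplanes = restrictSet M.hyperplanes H) {θ' : Fin n → Der K H}
    (hθ' : ∀ i, RestrictsTo H.subtype (θ i) (θ' i)) (hb' : IsDerBasis N θ')
    (y : Basis (Fin n) K (Dual K H)) :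
    (M.deletion H).IsRecursivelyFree ↔ M.IsRecursivelyFree := by
  have hnH := finrank_eq_of_basis_dual y
  have hnV : finrank K V = n + 1 := by rw [finrank_eq_of_isCoatom (M.isCoatom H hH), hnH]
  obtain ⟨x⟩ := exists_basis_dual hnV
  have hE := isEulerRestriction_of_det hH hb.basis hb.mem hθ' y hNhyp (hb'.det_associated y)
  have heN := hasExponents_of_isDerBasis hnH hb'
    fun i => (hθ' i).hasPDeg H.subtype_injective (hb.hasPDeg_right i)
  constructor
  · intro h
    have he := hasExponents_of_isDerBasis hnV hb.basis (d := (Fin.cons a d : Fin (n + 1) → ℕ))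
      (fun i => Fin.cases hb.hasPDeg_left hb.hasPDeg_right i)
    rw [map_univ_fin_cons] at he
    exact .add M H hH N hE _ _ h hN he heN (Multiset.le_cons_self _ _)
  · intro h
    have he := hasExponents_of_isDerBasis hnV
      (hb.basis.smul_cons x hH (ker_formOf (M.isCoatom H hH)) hb.mem)
      (d := (Fin.cons (1 + a) d : Fin (n + 1) → ℕ)) (fun i => by
        refine Fin.cases ?_ hb.hasPDeg_right i
        simpa [add_comm] using hb.hasPDeg_left.smul (linForm_mem (formOf H)))
    rw [map_univ_fin_cons] at he
    exact .delete M H hH N hE _ _ h hN he heN (Multiset.le_cons_self _ _)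

/-- A multiarrangement on a recursively free arrangement `B` with a basis of `D(B)` consisting of
the Euler derivation and of elements of `D(M)` is recursively free. -/
theorem isRecursivelyFree_of_mem_derModule [FiniteDimensional K V] {m : ℕ}
    (hm : finrank K V = m + 1) {B : Arrangement K V} {φ : Fin m → Der K V} {d : Fin m → ℕ}
    (hB : IsDerBasis B.toMulti (Fin.cons (euler K V) φ : Fin (m + 1) → Der K V))
    (hd : ∀ i, HasPDeg (φ i) (d i)) (hrf : B.toMulti.IsRecursivelyFree)
    (hY : ∀ Y ∈ B.hyperplanes, (B.toMulti.pull Y.subtype).IsRecursivelyFree) (k : ℕ) :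
    ∀ M : MultiArrangement K V, (M.mult.sum fun _ k => k) = k → M.hyperplanes = B.hyperplanes →
      (∀ i, φ i ∈ derModule M) → M.IsRecursivelyFree := by
  classical
  obtain ⟨x⟩ := exists_basis_dual hm
  induction k with
  | zero =>
    intro M hM hMB _
    have : M = B.toMulti := by
      ext Y
      have h0 : M.mult Y = 0 := by
        by_contra hne
        have := Finset.sum_eq_zero_iff.1 hM Y (Finsupp.mem_support_iff.2 hne)
        exact hne this
      rw [h0, B.toMulti_mult, if_neg]
      rw [← hMB, MultiArrangement.mem_hyperplanes, h0]
      simp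
    rwa [this]
  | succ k ih =>
    intro M hM hMB hφ
    by_cases h1 : ∀ Y ∈ B.hyperplanes, M.mult Y = 1
    · have : M = B.toMulti := by
        ext Y
        rw [B.toMulti_mult]
        split_ifs with hYB
        · exact h1 Y hYB
        · rw [← hMB, MultiArrangement.mem_hyperplanes, not_not] at hYB
          exact hYB
      rwa [this]
    push Not at h1
    obtain ⟨Y, hYB, hY1⟩ := h1
    have hYM : Y ∈ M.hyperplanes := by rwa [hMB]
    have hY0 := MultiArrangement.mem_hyperplanes.1 hYM
    have hc := M.isCoatom Y hYM
    have hdel : (M.deletion Y).hyperplanes = B.hyperplanes := by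
      rw [← hMB]
      ext Z
      rw [MultiArrangement.mem_hyperplanes, MultiArrangement.mem_hyperplanes]
      by_cases hZ : Z = Y
      · subst hZ
        rw [MultiArrangement.deletion_mult_self]
        omega
      · rw [MultiArrangement.deletion_mult_of_ne _ hZ]
    have hsum : ((M.deletion Y).mult.sum fun _ k => k) = k := by
      rw [← M.deletion_add hYM, Finsupp.sum_add_index' (by simp) (by simp),
        Finsupp.sum_single_index rfl] at hM
      omega
    have hM' := ih _ hsum hdel fun i => derModule_le_deletion M Y (hφ i)
    have hle : B.toMulti.mult ≤ (M.deletion Y).mult := fun Z => by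
      rw [B.toMulti_mult]
      split_ifs with hZ
      · rw [← hdel, MultiArrangement.mem_hyperplanes] at hZ
        omega
      · exact Nat.zero_le _
    -- `powProd δ` is Q(M') / Q(B); by Saito's criterion this multiple of the Euler derivation and
    -- the φ i form a basis of D(M').
    set δ := (M.deletion Y).mult - B.toMulti.mult with hδ
    have hδc : ∀ Z ∈ δ.support, IsCoatom Z := fun Z hZ =>
      (M.deletion Y).isCoatom Z (Finsupp.support_tsub hZ)
    have hη : powProd δ • euler K V ∈ derModule (M.deletion Y) := by
      rw [mem_derModule_iff]
      intro Z hZ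
      have h2 : (M.deletion Y).mult Z = δ Z + B.toMulti.mult Z := by
        rw [hδ, Finsupp.tsub_apply, Nat.sub_add_cancel (hle Z)]
      rw [h2, pow_add, Derivation.smul_apply, smul_eq_mul]
      refine mul_dvd_mul ?_ (mem_derModule_iff.1 (euler_mem_derModule B) Z hZ)
      by_cases hZδ : Z ∈ δ.support
      · exact (powProd_dvd_iff hδc).1 dvd_rfl Z hZδ
      · rw [Finsupp.notMem_support_iff.1 hZδ, pow_zero]
        exact one_dvd _
    have hbas : IsDerBasis (M.deletion Y)
        (Fin.cons (powProd δ • euler K V) φ : Fin (m + 1) → Der K V) := by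
      refine isDerBasis_of_det x (fun i => ?_) ?_
      · exact Fin.cases hη (fun i => derModule_le_deletion M Y (hφ i)) i
      · rw [det_coeffMatrix_smul_cons, MultiArrangement.defPoly, ← tsub_add_cancel_of_le hle,
          powProd_add]
        exact (hB.det_associated x).mul_left _
    have hadapt : IsAdaptedBasis M Y (powProd δ • euler K V) φ _ d :=
      ⟨hbas, hφ, euler_hasPDeg.smul (powProd_mem δ), hd⟩
    set γ := formOf Y with hγ
    have hγ0 : γ ≠ 0 := formOf_ne_zero hc
    have hγk : LinearMap.ker γ = Y := ker_formOf hc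
    have hrange : LinearMap.range Y.subtype = LinearMap.ker γ := by
      rw [hγk, Submodule.range_subtype]
    -- M has multiplicity at least 2 at Y. So the multiple g i of the Euler derivation that makes φ
    -- i kill γ vanishes on Y, and the correction does not change the restriction to Y.
    have hdvd : ∀ i, linForm γ ^ 2 ∣ φ i (linForm γ) := fun i =>
      (pow_dvd_pow _ (by omega)).trans (dvd_of_mem_derModule (hφ i) hc hγk)
    choose g hg1 hg2 hg3 using fun i => exists_add_euler hγ0 (hd i)
      ((dvd_pow_self _ two_ne_zero).trans (hdvd i))
    have hg0 : ∀ i, res Y.subtype (g i) = 0 := fun i => by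
      rw [res_eq_zero_iff Y.subtype_injective hγ0 hrange]
      have := hdvd i
      rw [hg3, dvd_neg, sq] at this
      exact (mul_dvd_mul_iff_left (linForm_ne_zero hγ0)).1 this
    choose ψ hψ using fun i => exists_restrictsTo_of_dvd Y.subtype_injective hrange
      (θ := φ i + g i • euler K V) (by rw [hg2]; exact dvd_zero _)
    obtain ⟨y⟩ := exists_basis_dual (K := K) (V := Y) (n := m) (by
      have := finrank_eq_of_isCoatom hc
      omega)
    -- By Ziegler's theorem for B, the Euler restriction of M at Y is the Ziegler restriction of B,
    -- independently of the higher multiplicities.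
    have hN := (hB.cons_add_euler x g).pull_of_range_eq_ker (α := γ) (by rwa [hγk]) hg2
      Y.subtype_injective hrange hψ y
    refine (hadapt.isRecursivelyFree_iff hYM (hY Y hYB) ?_ (fun i β => ?_) hN y).1 hM'
    · rw [hMB, ← B.toMulti_hyperplanes]
      refine (B.toMulti.restrictSet_pull_subtype Y ?_).symm
      rwa [B.toMulti_hyperplanes]
    · rw [hψ i β, Derivation.add_apply, Derivation.smul_apply, smul_eq_mul, map_add, map_mul, hg0,
        zero_mul, add_zero]

/-- Distinct hyperplanes have distinct preimages under a surjection, so all multiplicities remain 1.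
-/
theorem exists_arrangement_toMulti_eq {A : Arrangement K V} {j : W →ₗ[K] V}
    (hr : LinearMap.range j = ⊤) : ∃ B : Arrangement K W, B.toMulti = A.toMulti.pull j := by
  classical
  refine ⟨⟨(A.toMulti.pull j).hyperplanes, Finset.finite_toSet _,
    fun H hH => (A.toMulti.pull j).isCoatom H hH⟩, ?_⟩
  ext Y
  rw [Arrangement.toMulti_mult]
  split_ifs with hY
  · obtain ⟨ht, H, hH, rfl⟩ := MultiArrangement.mem_pull_hyperplanes.1 hY
    change 1 = pullMult A.toMulti.mult j _
    have hH' : H ∈ A.toMulti.mult.support := hH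
    rw [pullMult_apply _ _ ht, Finset.sum_eq_single H, A.toMulti_mult, if_pos (A.mem_support.1 hH')]
    · intro H' hH' hne
      exact absurd (Submodule.comap_injective_of_surjective (LinearMap.range_eq_top.1 hr)
        (Finset.mem_filter.1 hH').2) hne
    · intro h
      exact (h (Finset.mem_filter.2 ⟨hH', rfl⟩)).elim
  · by_contra hne
    exact hY (MultiArrangement.mem_hyperplanes.2 (Ne.symm hne))

/-- The Ziegler restriction to the hyperplane of an adapted basis. -/
theorem isRecursivelyFree_pull_of_range_eq [FiniteDimensional K V] {n : ℕ}
    (hn : finrank K V = n + 1) {A : Arrangement K V} {H : Submodule K V} (h : H ∈ A.hyperplanes)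
    {η : Der K V} {θ : Fin n → Der K V} {a : ℕ} {d : Fin n → ℕ}
    (hb : IsAdaptedBasis A.toMulti H η θ a d)
    (hres : ∀ (U : Type v) [AddCommGroup U] [Module K U] (i : U →ₗ[K] H), Function.Injective i →
      (LinearMap.range i = ⊤ ∨ LinearMap.range i ∈ (A.restriction H h).hyperplanes) →
      ((A.restriction H h).toMulti.pull i).IsRecursivelyFree)
    {j : W →ₗ[K] V} (hj : Function.Injective j) (hr : LinearMap.range j = H) :
    (A.toMulti.pull j).IsRecursivelyFree := by
  have hfW : FiniteDimensional K W := FiniteDimensional.of_injective j hj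
  have hc := A.isCoatom H h
  -- A second hyperplane is needed to bring the Euler derivation into the basis; without one the
  -- pull-back is empty.
  by_cases hex : ∃ H₁ ∈ A.hyperplanes, H₁ ≠ H
  swap
  · push Not at hex
    rw [MultiArrangement.isEmpty_pull]
    · exact .empty W
    · intro H' hH'
      rw [A.toMulti_hyperplanes] at hH'
      exact (comap_eq_top_iff (A.isCoatom _ hH') hc hr).2 (hex H' hH')
  obtain ⟨H₁, h₁, hne⟩ := hex
  obtain ⟨x⟩ := exists_basis_dual hn
  obtain ⟨m, θ₁, d₁, hnm, hb₁⟩ := hb.exists_cons_euler x h h₁ hne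
  subst hnm
  set α := formOf H with hα
  have hα0 : α ≠ 0 := formOf_ne_zero hc
  have hαk : LinearMap.ker α = H := ker_formOf hc
  have hrange : LinearMap.range H.subtype = LinearMap.ker α := by
    rw [hαk, Submodule.range_subtype]
  choose g hg1 hg2 _ using fun i => exists_add_euler hα0 (hb₁.hasPDeg_right (Fin.succ i))
    (by
      have := dvd_of_mem_derModule (hb₁.mem (Fin.succ i)) hc hαk
      rwa [A.toMulti_mult, if_pos h, pow_one] at this)
  simp only [Fin.cons_succ] at hg1 hg2
  have hb2 := hb₁.add_euler x (f := 0) (fun β => by simp) hg1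
  choose φ hφ using fun i => exists_restrictsTo_of_dvd hj (hr.trans hαk.symm)
    (θ := θ₁ i + g i • euler K V) (by rw [hg2]; exact dvd_zero _)
  choose ψ hψ using fun i => exists_restrictsTo_of_dvd H.subtype_injective hrange
    (θ := θ₁ i + g i • euler K V) (by rw [hg2]; exact dvd_zero _)
  have hmem : ∀ w, j w ∈ H := fun w => hr ▸ LinearMap.mem_range_self j w
  let j₀ : W →ₗ[K] H := j.codRestrict H hmem
  have hj₀ : H.subtype ∘ₗ j₀ = j := rfl
  have hj₀i : Function.Injective j₀ := fun u v huv => hj (congrArg Subtype.val huv)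
  have hj₀r : LinearMap.range j₀ = ⊤ := by
    rw [LinearMap.range_eq_top]
    rintro ⟨v, hv⟩
    rw [← hr] at hv
    obtain ⟨w, rfl⟩ := hv
    exact ⟨w, rfl⟩
  have hnH : finrank K H = m + 1 := by
    have := finrank_eq_of_isCoatom hc
    omega
  have hnW : finrank K W = m + 1 := by
    rw [← hnH, ← hr, LinearMap.finrank_range_of_inj hj]
  obtain ⟨yH⟩ := exists_basis_dual hnH
  obtain ⟨yW⟩ := exists_basis_dual hnW
  have hres' := hb2.isDerBasis_restriction h
    (θ' := (Fin.cons (euler K H) ψ : Fin (m + 1) → Der K H))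
    (fun i => Fin.cases (restrictsTo_euler _) hψ i) yH
  have hpull := hres'.pull_of_range_eq_top hj₀i hj₀r
    (θ' := (Fin.cons (euler K W) φ : Fin (m + 1) → Der K W))
    (fun i => Fin.cases (restrictsTo_euler _) (fun i =>
      RestrictsTo.of_comp H.subtype_injective (hψ i) (hφ i)) i) yW
  obtain ⟨B, hB⟩ := exists_arrangement_toMulti_eq (A := A.restriction H h) hj₀r
  have hBhyp : B.hyperplanes = ((A.restriction H h).toMulti.pull j₀).hyperplanes := by
    rw [← B.toMulti_hyperplanes, hB]
  rw [← hB] at hpull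
  -- Since their lifts to V kill α, the φ i satisfy the conditions of the full Ziegler
  -- multiplicities, up to which those of the copy B of A'' are raised.
  refine isRecursivelyFree_of_mem_derModule hnW hpull
    (fun i => (hφ i).hasPDeg hj (hb2.hasPDeg_right (Fin.succ i))) ?_ (fun Y hY => ?_) _ _ rfl ?_
    fun i => mem_derModule_pull hj (hφ i) (hb2.mem (Fin.succ i))
      (der_linForm_eq_zero_of_range (hr.trans hαk.symm) (hg2 i))
  · rw [hB]
    exact hres W j₀ hj₀i (Or.inl hj₀r)
  · rw [hB, MultiArrangement.pull_pull]
    refine hres Y _ (hj₀i.comp Y.subtype_injective) (Or.inr ?_)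
    rw [hBhyp] at hY
    obtain ⟨-, Z, hZ, rfl⟩ := MultiArrangement.mem_pull_hyperplanes.1 hY
    rw [LinearMap.range_comp, Submodule.range_subtype,
      Submodule.map_comap_eq_of_surjective (LinearMap.range_eq_top.1 hj₀r)]
    rwa [Arrangement.toMulti_hyperplanes] at hZ
  · rw [hBhyp]
    ext Y
    rw [MultiArrangement.mem_pull_hyperplanes, MultiArrangement.mem_pull_hyperplanes,
      Arrangement.toMulti_hyperplanes, Arrangement.toMulti_hyperplanes]
    refine and_congr_right fun ht => ⟨?_, ?_⟩
    · rintro ⟨H', hH', rfl⟩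
      refine ⟨H'.comap H.subtype, ⟨H', ⟨hH', ?_⟩, rfl⟩, rfl⟩
      rintro (rfl : H' = H)
      exact ht ((comap_eq_top_iff hc hc hr).2 rfl)
    · rintro ⟨_, ⟨H', ⟨hH', -⟩, rfl⟩, rfl⟩
      exact ⟨H', hH', rfl⟩

/-- Addition and deletion for the pull-backs along a map whose range is not the hyperplane `H`. -/
theorem isRecursivelyFree_pull_deletion_iff [FiniteDimensional K V] {n : ℕ}
    (hn : finrank K V = n + 1) {A : Arrangement K V} {H : Submodule K V} (h : H ∈ A.hyperplanes)
    {η : Der K V} {θ : Fin n → Der K V} {a : ℕ} {d : Fin n → ℕ}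
    (hb : IsAdaptedBasis A.toMulti H η θ a d) {j : W →ₗ[K] V} (hj : Function.Injective j)
    (hr : LinearMap.range j = ⊤ ∨ LinearMap.range j ∈ A.hyperplanes)
    (hne : LinearMap.range j ≠ H)
    (hres : ((A.restriction H h).toMulti.pull (hyperplaneMap j H)).IsRecursivelyFree) :
    ((A.deletion H).toMulti.pull j).IsRecursivelyFree ↔
      (A.toMulti.pull j).IsRecursivelyFree := by
  have hfW : FiniteDimensional K W := FiniteDimensional.of_injective j hj
  have hH : H ∈ A.toMulti.hyperplanes := by rwa [A.toMulti_hyperplanes]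
  have hc := A.isCoatom H h
  have hL : H.comap j ≠ ⊤ := by
    intro ht
    rcases hr with hr | hr
    · rw [← top_le_iff, ← Submodule.map_le_iff_le_comap, Submodule.map_top, hr, top_le_iff] at ht
      exact hc.1 ht
    · exact hne ((comap_eq_top_iff hc (A.isCoatom _ hr) rfl).1 ht).symm
  have hLc := (Submodule.isCoatom_comap_or_eq_top j hc).resolve_right hL
  have hLM : H.comap j ∈ (A.toMulti.pull j).hyperplanes :=
    MultiArrangement.mem_pull_hyperplanes.2 ⟨hL, H, hH, rfl⟩
  have hnH : finrank K H = n := by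
    have := finrank_eq_of_isCoatom hc
    omega
  obtain ⟨x⟩ := exists_basis_dual hn
  have hji := hyperplaneMap_injective hj H
  have hHrange : LinearMap.range H.subtype = LinearMap.ker (formOf H) := by
    rw [ker_formOf hc, Submodule.range_subtype]
  have hdvd : ∀ θ ∈ derModule A.toMulti, linForm (formOf H) ∣ θ (linForm (formOf H)) :=
    fun θ hθ => by
      have := dvd_of_mem_derModule hθ hc (ker_formOf hc)
      rwa [A.toMulti_mult, if_pos h, pow_one] at this
  rw [A.toMulti_deletion, A.toMulti.pull_deletion hH hL]
  have hdel := A.toMulti.pull_deletion hH hL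
  rcases hr with hr | hr
  · have hnW : finrank K W = n + 1 := by
      rw [← hn, ← LinearMap.finrank_range_of_inj hj, hr, finrank_top]
    have hnL : finrank K (H.comap j) = n := by
      have := finrank_eq_of_isCoatom hLc
      omega
    obtain ⟨yW⟩ := exists_basis_dual hnW
    obtain ⟨yH⟩ := exists_basis_dual hnH
    obtain ⟨yL⟩ := exists_basis_dual hnL
    have hjr : LinearMap.range (hyperplaneMap j H) = ⊤ := by
      rw [range_hyperplaneMap, hr, Submodule.comap_top]
    obtain ⟨η', hη'⟩ := exists_restrictsTo_of_range_eq_top hj hr η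
    choose θ' hθ' using fun i => exists_restrictsTo_of_range_eq_top hj hr (θ i)
    choose ψ hψ using fun i => exists_restrictsTo_of_dvd H.subtype_injective hHrange
      (hdvd _ (hb.mem i))
    choose φ hφ using fun i => exists_restrictsTo_of_range_eq_top hji hjr (ψ i)
    have h1 := hb.basis.pull_of_range_eq_top hj hr
      (θ' := (Fin.cons η' θ' : Fin (n + 1) → Der K W)) (fun i => Fin.cases hη' hθ' i) yW
    rw [hdel] at h1
    have h2 := (hb.basis.smul_cons x hH (ker_formOf hc) hb.mem).pull_of_range_eq_top hj hr
      (θ' := (Fin.cons (res j (linForm (formOf H)) • η') θ' : Fin (n + 1) → Der K W))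
      (fun i => Fin.cases (hη'.smul _) hθ' i) yW
    have h3 : IsAdaptedBasis (A.toMulti.pull j) (H.comap j) η' θ' a d :=
      ⟨h1, fun i => h2.mem i.succ, hη'.hasPDeg hj hb.hasPDeg_left,
        fun i => (hθ' i).hasPDeg hj (hb.hasPDeg_right i)⟩
    exact h3.isRecursivelyFree_iff hLM hres (A.restrictSet_pull h hL).symm
      (fun i => RestrictsTo.of_comp hj (hθ' i) ((hψ i).comp (hφ i)))
      ((hb.isDerBasis_restriction h hψ yH).pull_of_range_eq_top hji hjr hφ yL) yL
  -- The range is a hyperplane L of A other than H. Once η and the θᵢ are corrected to kill α_L,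
  -- Ziegler's theorem is applied twice: to A' on L and to A'' on L ∩ H.
  · obtain ⟨m, θ₁, d₁, hnm, hb₁⟩ := hb.exists_cons_euler x h hr hne
    subst hnm
    have hc₀ := A.isCoatom _ hr
    set α := formOf (LinearMap.range j) with hα
    have hα0 : α ≠ 0 := formOf_ne_zero hc₀
    have hαk : LinearMap.ker α = LinearMap.range j := ker_formOf hc₀
    have hdvd₀ : ∀ θ ∈ derModule (A.deletion H).toMulti, linForm α ∣ θ (linForm α) :=
      fun θ hθ => by
        have := dvd_of_mem_derModule hθ hc₀ hαk
        rwa [Arrangement.toMulti_mult, if_pos ⟨hr, hne⟩, pow_one] at this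
    rw [A.toMulti_deletion] at hdvd₀
    obtain ⟨f, hf1, hf2, -⟩ := exists_add_euler hα0 hb₁.hasPDeg_left (hdvd₀ _ (hb₁.basis.mem 0))
    choose g hg1 hg2 _ using fun i => exists_add_euler hα0 (hb₁.hasPDeg_right (Fin.succ i))
      (hdvd₀ _ (derModule_le_deletion _ _ (hb₁.mem (Fin.succ i))))
    simp only [Fin.cons_succ] at hg1 hg2
    have hb2 := hb₁.add_euler x hf1 hg1
    have hnW : finrank K W = m + 1 := by
      have := finrank_eq_of_isCoatom hc₀
      rw [LinearMap.finrank_range_of_inj hj] at this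
      omega
    have hnL : finrank K (H.comap j) = m := by
      have := finrank_eq_of_isCoatom hLc
      omega
    obtain ⟨yW⟩ := exists_basis_dual hnW
    obtain ⟨yH⟩ := exists_basis_dual hnH
    obtain ⟨yL⟩ := exists_basis_dual hnL
    obtain ⟨η', hη'⟩ := exists_restrictsTo_of_dvd hj hαk.symm (θ := η + f • euler K V)
      (by rw [hf2]; exact dvd_zero _)
    choose θ' hθ' using fun i => exists_restrictsTo_of_dvd hj hαk.symm
      (θ := θ₁ i + g i • euler K V) (by rw [hg2]; exact dvd_zero _)
    choose ψ hψ using fun i => exists_restrictsTo_of_dvd H.subtype_injective hHrange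
      (hdvd _ (hb2.mem (Fin.succ i)))
    simp only [Fin.cons_succ] at hψ
    have hres' := hb2.isDerBasis_restriction h
      (θ' := (Fin.cons (euler K H) ψ : Fin (m + 1) → Der K H))
      (fun i => Fin.cases (restrictsTo_euler _) hψ i) yH
    have hjr : LinearMap.range (hyperplaneMap j H) = LinearMap.ker (α ∘ₗ H.subtype) := by
      rw [range_hyperplaneMap, ker_comp, hαk]
    have hψ0 : ∀ i, ψ i (linForm (α ∘ₗ H.subtype)) = 0 := fun i => by
      rw [hψ i, hg2, map_zero]
    choose φ hφ using fun i => exists_restrictsTo_of_dvd hji hjr (θ := ψ i)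
      (by rw [hψ0]; exact dvd_zero _)
    have hN := hres'.pull_of_range_eq_ker (A := A.restriction H h) (α := α ∘ₗ H.subtype)
      ⟨LinearMap.range j, ⟨hr, hne⟩, by rw [ker_comp, hαk]⟩ hψ0 hji hjr hφ yL
    have h1 := hb2.basis.cons_swap
    rw [← A.toMulti_deletion] at h1
    have h2 := h1.pull_of_range_eq_ker (α := α) (by rw [hαk]; exact ⟨hr, hne⟩)
      (fun i => Fin.cases hf2 hg2 i) hj hαk.symm
      (θ' := (Fin.cons η' θ' : Fin (m + 1) → Der K W)) (fun i => Fin.cases hη' hθ' i) yW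
    rw [A.toMulti_deletion, hdel] at h2
    have h3 : IsAdaptedBasis (A.toMulti.pull j) (H.comap j) η' θ' a d₁ :=
      ⟨h2, fun i => mem_derModule_pull hj (hθ' i) (hb2.mem (Fin.succ i))
          (der_linForm_eq_zero_of_range hαk.symm (hg2 i)), hη'.hasPDeg hj hb2.hasPDeg_left,
        fun i => (hθ' i).hasPDeg hj (hb2.hasPDeg_right (Fin.succ i))⟩
    exact h3.isRecursivelyFree_iff hLM hres (A.restrictSet_pull h hL).symm
      (fun i => RestrictsTo.of_comp hj (hθ' i) ((hψ i).comp (hφ i))) hN yL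

/-! ### The induction over recursively free arrangements -/

theorem Arrangement.IsRecursivelyFree.finiteDimensional {A : Arrangement K V}
    (hA : A.IsRecursivelyFree) : FiniteDimensional K V := by
  induction hA with
  | empty V => infer_instance
  | add A H h e' e'' hdel hres he' he'' hle ihdel ihres => exact ihdel
  | delete A H h e e'' hA hres he he'' hle ihA ihres => exact ihA

theorem Arrangement.range_hyperplaneMap_mem {A : Arrangement K V} {H : Submodule K V}
    (h : H ∈ A.hyperplanes) {j : W →ₗ[K] V}
    (hr : LinearMap.range j = ⊤ ∨ LinearMap.range j ∈ A.hyperplanes)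
    (hne : LinearMap.range j ≠ H) : LinearMap.range (hyperplaneMap j H) = ⊤ ∨
      LinearMap.range (hyperplaneMap j H) ∈ (A.restriction H h).hyperplanes := by
  rw [range_hyperplaneMap]
  rcases hr with hr | hr
  · exact Or.inl (by rw [hr, Submodule.comap_top])
  · exact Or.inr ⟨_, ⟨hr, hne⟩, rfl⟩

/-- All pull-backs of a recursively free arrangement to the ambient space or to one of its
hyperplanes are recursively free multiarrangements. -/
theorem Arrangement.IsRecursivelyFree.pull {A : Arrangement K V} (hA : A.IsRecursivelyFree) :
    ∀ (W : Type v) [AddCommGroup W] [Module K W] (j : W →ₗ[K] V), Function.Injective j →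
      (LinearMap.range j = ⊤ ∨ LinearMap.range j ∈ A.hyperplanes) →
      (A.toMulti.pull j).IsRecursivelyFree := by
  induction hA with
  | empty V =>
    intro W _ _ j hj _
    have : FiniteDimensional K W := FiniteDimensional.of_injective j hj
    rw [MultiArrangement.isEmpty_pull]
    · exact .empty W
    · intro H hH
      rw [Arrangement.toMulti_hyperplanes] at hH
      exact absurd hH (Set.notMem_empty H)
  | add A H h e' e'' hdel hres he' he'' hle ihdel ihres =>
    intro W _ _ j hj hr
    have := hdel.finiteDimensional
    obtain ⟨η, θ, a, d, hb⟩ := exists_isAdaptedBasis_of_add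
      (finrank_eq_of_isCoatom (A.isCoatom H h)) h he' he'' hle
    -- H is not a hyperplane of A', so on H only the induction hypothesis for A'' is available.
    by_cases hne : LinearMap.range j = H
    · exact isRecursivelyFree_pull_of_range_eq (finrank_eq_of_isCoatom (A.isCoatom H h)) h hb
        (fun U _ _ i hi hir => ihres U i hi hir) hj hne
    · exact (isRecursivelyFree_pull_deletion_iff (finrank_eq_of_isCoatom (A.isCoatom H h)) h hb hj
        hr hne (ihres _ _ (hyperplaneMap_injective hj H)
          (Arrangement.range_hyperplaneMap_mem h hr hne))).1
        (ihdel W j hj (hr.imp id fun hr => ⟨hr, hne⟩))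
  | delete A H h e e'' hA hres he he'' hle ihA ihres =>
    intro W _ _ j hj hr
    have := hA.finiteDimensional
    obtain ⟨η, θ, a, d, hb⟩ := exists_isAdaptedBasis_of_delete
      (finrank_eq_of_isCoatom (A.isCoatom H h)) h he he'' hle
    have hr' : LinearMap.range j = ⊤ ∨ LinearMap.range j ∈ A.hyperplanes :=
      hr.imp id fun hr => hr.1
    -- The range is V or a hyperplane of A', and H is neither.
    have hne : LinearMap.range j ≠ H := by
      intro hrH
      rcases hr with hr | hr
      · exact (A.isCoatom H h).1 (hrH.symm.trans hr)
      · exact hr.2 hrH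
    exact (isRecursivelyFree_pull_deletion_iff (finrank_eq_of_isCoatom (A.isCoatom H h)) h hb hj
      hr' hne (ihres _ _ (hyperplaneMap_injective hj H)
        (Arrangement.range_hyperplaneMap_mem h hr' hne))).2 (ihA W j hj hr')

end

end HyperplaneArrangement

end

theorem theorem1p6 {K : Type u} [Field K] {V : Type v} [AddCommGroup V] [Module K V]
    [FiniteDimensional K V] (A : HyperplaneArrangement.Arrangement K V)
    (hA : A.IsRecursivelyFree) (H₀ : Submodule K V) (h₀ : H₀ ∈ A.hyperplanes) :
    (A.zieglerRestriction H₀ h₀).IsRecursivelyFree := by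
  rw [A.zieglerRestriction_eq_pull H₀ h₀]
  exact hA.pull H₀ H₀.subtype H₀.subtype_injective (Or.inr (by rwa [Submodule.range_subtype]))
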